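/- Observation model. For $n\ge 1$ one observes the path $Z_n(t)=\int_0^t f(x)\,dx+n^{-1/2}B(t)$, $0\le t\le 1$, with $B$ a standard Brownian motion and $f:[0,1]\to\mathbb R$ unknown. For $\alpha>0$ and $M>0$ let $F(\alpha,M)$ be the Hölder class of all functions $f$ that are $k$ times continuously differentiable on $[0,1]$ with $|f^{(k)}(x)-f^{(k)}(y)|\le M|x-y|^{\alpha-k}$ for $0\le x<y\le 1$, where $k$ is the greatest integer strictly less than $\alpha$. For $0<x_0<1$ and $c>0$ the risk of an estimator $\hat f$ is $$R(\hat f,f;x_0,c)=\frac1{2c}E_f\int_{[x_0-c,\,x_0+c]\cap[0,1]}(\hat f(x)-f(x))^2\,dx ,$$ and $R(\hat f,f;x_0,0)=E_f(\hat f(x_0)-f(x_0))^2$ is the pointwise risk. Wavelets. Let $\phi,\psi$ be compactly supported father and mother wavelets with $\int\phi=1$, and let $\{\phi_{j_0,k},\,1\le k\le 2^{j_0};\ \psi_{j,k},\,j\ge j_0,\,1\le k\le 2^j\}$ be an orthonormal basis of $L^2[0,1]$. For $K<k\le 2^j-K$ we have $\psi_{j,k}(x)=2^{j/2}\psi(2^jx-k)$,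 with support in $[0,1]$. The first $K$ and the last $K$ functions of level $j$ are boundary corrected: they are $2^{j/2}\psi^L_k(2^jx)$, $1\le k\le K$, and $2^{j/2}\psi^R_i(2^j(1-x))$ with $i=2^j+1-k$, $1\le i\le K$, for fixed compactly supported edge functions; here $2K\le 2^{j_0}$. The functions $\phi_{j_0,k}$ have the same form, with edge functions $\phi^L_k,\phi^R_i$. The wavelet is $r$-regular ($r$ an integer): $\psi$ and its edge versions have $r$ continuous derivatives, $\psi$ has $r$ vanishing moments, and every $\psi_{j,k}$ has $r$ vanishing moments on $[0,1]$; $\phi$ and its edge versions are continuously differentiable. BlockJS estimator. Put $\tilde y_{j_0,k}=\int_0^1\phi_{j_0,k}\,dZ_n$ and $y_{j,k}=\int_0^1\psi_{j,k}\,dZ_n$. Let $L=L_n$ be $\log n$ rounded to an integer ($L_n$ an integer with $|L_n-\log n|\le 1$), let $\lambda_*\approx 4.505$ be the root greater than $1$ of $\lambda-\log\lambda-1=2$, and let $J=\lceil\log_2 n\rceil$. At each level $j_0\le j<J$ divide the indices $1\le k\le 2^j$ into the blocks $(jb)=\{k:(b-1)L+1\le k\le bL\}$ and put $S_{(jb)}^2=\sum_{k\in(jb)}y_{j,k}^2$.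 The BlockJS estimator is $$\hat f_n(x)=\sum_{k=1}^{2^{j_0}}\tilde y_{j_0,k}\phi_{j_0,k}(x)+\sum_{j=j_0}^{J-1}\sum_{k=1}^{2^j}\hat\theta_{j,k}\psi_{j,k}(x),\qquad \hat\theta_{j,k}=\Big(1-\frac{\lambda_*Ln^{-1}}{S_{(jb)}^2}\Big)_+y_{j,k}\quad(k\in(jb)).$$ It depends neither on $\alpha$ and $M$ nor on the location $x_0$ and the size of the neighborhood. Theorem 4. Let $0<\alpha<r$, $M>0$, $0<x_0<1$, $d_n\ge 0$ and $c_n=d_n n^{-1/(1+2\alpha)}$. (i) If $\limsup_{n\to\infty} d_n(\log n)^{-1/(1+2\alpha)}<\infty$, then $$\limsup_{n\to\infty}\Big(\frac n{\log n}\Big)^{2\alpha/(1+2\alpha)}\sup_{f\in F(\alpha,M)}R(\hat f_n,f;x_0,c_n)<\infty .$$ (ii) If $\liminf_{n\to\infty} d_n(\log n)^{-1/(1+2\alpha)}=\infty$ and $\limsup_{n\to\infty} d_n[(\log n)(\log\log n)]^{-1}=0$, then $$\limsup_{n\to\infty} n^{2\alpha/(1+2\alpha)}\frac{d_n}{(\log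 n)(\log\log n)}\sup_{f\in F(\alpha,M)}R(\hat f_n,f;x_0,c_n)<\infty .$$ (iii) If $\liminf_{n\to\infty} d_n[(\log n)(\log\log n)]^{-1}>0$, then $$\limsup_{n\to\infty} n^{2\alpha/(1+2\alpha)}\sup_{f\in F(\alpha,M)}R(\hat f_n,f;x_0,c_n)<\infty .$$ -/

import Mathlib

open MeasureTheory Filter
open scoped ENNReal NNReal

noncomputable section

/-- The Hölder class `F(α, M)` on `[0, 1]`: with `k = ⌈α⌉ - 1` the greatest integer strictly less
than `α`, the functions with `k` continuous derivatives on `[0, 1]` whose `k`-th derivative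
satisfies `|f⁽ᵏ⁾(x) - f⁽ᵏ⁾(y)| ≤ M |x - y| ^ (α - k)`. Only the values on `[0, 1]` matter. -/
def holderClass (α M : ℝ) : Set (ℝ → ℝ) :=
  {f | ContDiffOn ℝ ((⌈α⌉₊ - 1 : ℕ) : ℕ∞) f (Set.Icc 0 1) ∧
    ∀ x ∈ Set.Icc (0 : ℝ) 1, ∀ y ∈ Set.Icc (0 : ℝ) 1, x < y →
      |iteratedDerivWithin (⌈α⌉₊ - 1) f (Set.Icc 0 1) x
        - iteratedDerivWithin (⌈α⌉₊ - 1) f (Set.Icc 0 1) y|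
        ≤ M * |x - y| ^ (α - ((⌈α⌉₊ - 1 : ℕ) : ℝ))}

/-- The function with index `k ∈ {1, …, 2 ^ j}` at level `j` of a boundary corrected system of
dilations and translations on `[0, 1]`. Away from the two end points it is
`2 ^ (j/2) g (2 ^ j x - k)`; the `K` functions next to `0` are the dilations
`2 ^ (j/2) gL k (2 ^ j x)`, and the `K` functions next to `1` are the dilations
`2 ^ (j/2) gR i (2 ^ j (1 - x))` with `i = 2 ^ j + 1 - k ∈ {1, …, K}`. -/
def edgeDilation (K : ℕ) (g : ℝ → ℝ) (gL gR : ℕ → ℝ → ℝ) (j k : ℕ) (x : ℝ) : ℝ :=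
  Real.sqrt (2 ^ j) *
    if k ≤ K then gL k (2 ^ j * x)
    else if 2 ^ j < k + K then gR (2 ^ j + 1 - k) (2 ^ j * (1 - x))
    else g (2 ^ j * x - k)

/-- The data of a wavelet system on `[0, 1]`: father and mother wavelet `φ`, `ψ`, the coarsest
level `j₀`, the number `K` of functions that are corrected at either end point, and the edge
functions (indexed by `1, …, K`) used for the corrections. -/
structure IntervalWavelets where
  φ : ℝ → ℝ
  ψ : ℝ → ℝ
  j₀ : ℕ
  K : ℕ
  φL : ℕ → ℝ → ℝ
  φR : ℕ → ℝ → ℝ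
  ψL : ℕ → ℝ → ℝ
  ψR : ℕ → ℝ → ℝ

namespace IntervalWavelets

variable (W : IntervalWavelets)

/-- `φ_{j₀,k}`, `1 ≤ k ≤ 2 ^ j₀`. -/
def father (k : ℕ) : ℝ → ℝ := edgeDilation W.K W.φ W.φL W.φR W.j₀ k

/-- `ψ_{j,k}`, `j ≥ j₀`, `1 ≤ k ≤ 2 ^ j`. -/
def mother (j k : ℕ) : ℝ → ℝ := edgeDilation W.K W.ψ W.ψL W.ψR j k

/-- `φ`, `ψ` are compactly supported, `∫ φ = 1`, and the system
`{φ_{j₀,k}, 1 ≤ k ≤ 2 ^ j₀; ψ_{j,k}, j ≥ j₀, 1 ≤ k ≤ 2 ^ j}`, with its boundary corrections, is an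
orthonormal basis of `L²[0, 1]`. The supports of `φ`, `ψ` are such that every function that is not
corrected is supported in `[0, 1]`. -/
structure IsWaveletBasis : Prop where
  two_mul_K_le : 2 * W.K ≤ 2 ^ W.j₀
  support_φ : Function.support W.φ ⊆ Set.Icc (-((W.K : ℝ) + 1)) W.K
  support_ψ : Function.support W.ψ ⊆ Set.Icc (-((W.K : ℝ) + 1)) W.K
  compact_φL : ∀ k ∈ Finset.Icc 1 W.K, HasCompactSupport (W.φL k)
  compact_φR : ∀ k ∈ Finset.Icc 1 W.K, HasCompactSupport (W.φR k)
  compact_ψL : ∀ k ∈ Finset.Icc 1 W.K, HasCompactSupport (W.ψL k)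
  compact_ψR : ∀ k ∈ Finset.Icc 1 W.K, HasCompactSupport (W.ψR k)
  integral_φ : ∫ x, W.φ x = 1
  orthonormal_father : ∀ k ∈ Finset.Icc 1 (2 ^ W.j₀), ∀ k' ∈ Finset.Icc 1 (2 ^ W.j₀),
    ∫ x in Set.Icc (0 : ℝ) 1, W.father k x * W.father k' x = if k = k' then 1 else 0
  orthonormal_mother : ∀ j j' : ℕ, W.j₀ ≤ j → W.j₀ ≤ j' →
    ∀ k ∈ Finset.Icc 1 (2 ^ j), ∀ k' ∈ Finset.Icc 1 (2 ^ j'),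
    ∫ x in Set.Icc (0 : ℝ) 1, W.mother j k x * W.mother j' k' x
      = if j = j' ∧ k = k' then 1 else 0
  orthogonal_father_mother : ∀ j : ℕ, W.j₀ ≤ j →
    ∀ k ∈ Finset.Icc 1 (2 ^ W.j₀), ∀ k' ∈ Finset.Icc 1 (2 ^ j),
    ∫ x in Set.Icc (0 : ℝ) 1, W.father k x * W.mother j k' x = 0
  complete : ∀ g : ℝ → ℝ, MemLp g 2 (volume.restrict (Set.Icc 0 1)) →
    (∀ k ∈ Finset.Icc 1 (2 ^ W.j₀), ∫ x in Set.Icc (0 : ℝ) 1, g x * W.father k x = 0) →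
    (∀ j : ℕ, W.j₀ ≤ j → ∀ k ∈ Finset.Icc 1 (2 ^ j),
      ∫ x in Set.Icc (0 : ℝ) 1, g x * W.mother j k x = 0) →
    g =ᵐ[volume.restrict (Set.Icc 0 1)] 0

/-- The wavelet is `r`-regular: it has `r` continuous derivatives and `r` vanishing moments, and
this is retained by the boundary corrections. The father wavelet and its edge versions are
continuously differentiable, so that they can be integrated against a continuous path. -/
structure IsRegular (r : ℕ) : Prop where
  contDiff_ψ : ContDiff ℝ (r : ℕ∞) W.ψ
  contDiff_ψL : ∀ k ∈ Finset.Icc 1 W.K, ContDiff ℝ (r : ℕ∞) (W.ψL k)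
  contDiff_ψR : ∀ k ∈ Finset.Icc 1 W.K, ContDiff ℝ (r : ℕ∞) (W.ψR k)
  contDiff_φ : ContDiff ℝ 1 W.φ
  contDiff_φL : ∀ k ∈ Finset.Icc 1 W.K, ContDiff ℝ 1 (W.φL k)
  contDiff_φR : ∀ k ∈ Finset.Icc 1 W.K, ContDiff ℝ 1 (W.φR k)
  moment_ψ : ∀ m < r, ∫ x, x ^ m * W.ψ x = 0
  moment_mother : ∀ m < r, ∀ j : ℕ, W.j₀ ≤ j → ∀ k ∈ Finset.Icc 1 (2 ^ j),
    ∫ x in Set.Icc (0 : ℝ) 1, x ^ m * W.mother j k x = 0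

end IntervalWavelets

/-- The observed path `Z_n(t) = ∫₀ᵗ f(x) dx + n ^ (-1/2) b(t)`, `0 ≤ t ≤ 1`, where `b` is the path
of the driving Brownian motion. -/
def observedPath (n : ℕ) (f : ℝ → ℝ) (b : ℝ≥0 → ℝ) (t : ℝ) : ℝ :=
  (∫ x in (0 : ℝ)..t, f x) + (Real.sqrt n)⁻¹ * b t.toNNReal

/-- The stochastic integral `∫₀¹ g(t) dZ(t)` of a continuously differentiable function `g` against
a continuous path `Z`, as a Riemann–Stieltjes integral (integration by parts). -/
def pathIntegral (g Z : ℝ → ℝ) : ℝ :=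
  g 1 * Z 1 - g 0 * Z 0 - ∫ t in (0 : ℝ)..1, deriv g t * Z t

/-- The `b`-th block `{k : (b - 1) L + 1 ≤ k ≤ b L}` of the indices `1, …, 2 ^ j` at level `j`. -/
def jsBlock (L j b : ℕ) : Finset ℕ :=
  (Finset.Icc 1 (2 ^ j)).filter fun k => (b - 1) * L + 1 ≤ k ∧ k ≤ b * L

/-- The block to which the index `k ≥ 1` belongs. -/
def jsBlockIndex (L k : ℕ) : ℕ := (k - 1) / L + 1

/-- The James–Stein shrinkage `(1 - lam L n⁻¹ / S²)₊ y_{j,k}` of the empirical coefficient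
`y_{j,k} = ∫ ψ_{j,k} dZ`, where `S²` is the sum of squares over the block of `k`. -/
def blockJSCoeff (W : IntervalWavelets) (lam : ℝ) (L n : ℕ) (Z : ℝ → ℝ) (j k : ℕ) : ℝ :=
  max 0 (1 - lam * L * (n : ℝ)⁻¹ /
      ∑ i ∈ jsBlock L j (jsBlockIndex L k), pathIntegral (W.mother j i) Z ^ 2)
    * pathIntegral (W.mother j k) Z

/-- The BlockJS estimator, a function of the observed path `Z` alone: the coarse coefficients are
kept, the detail coefficients at levels `j₀ ≤ j < J = ⌈log₂ n⌉` are shrunk block by block, and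
those at levels `j ≥ J` are estimated by zero. -/
def blockJS (W : IntervalWavelets) (lam : ℝ) (L n : ℕ) (Z : ℝ → ℝ) (x : ℝ) : ℝ :=
  (∑ k ∈ Finset.Icc 1 (2 ^ W.j₀), pathIntegral (W.father k) Z * W.father k x)
    + ∑ j ∈ Finset.Ico W.j₀ (Nat.clog 2 n), ∑ k ∈ Finset.Icc 1 (2 ^ j),
        blockJSCoeff W lam L n Z j k * W.mother j k x

/-- The local risk of the random function `fhat` (with values in `[0, ∞]`):
`(2c)⁻¹ E ∫ (fhat(x) - f(x))² dx` over the part in `[0, 1]` of `[x₀ - c, x₀ + c]` if `c > 0`, and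
the pointwise risk `E (fhat(x₀) - f(x₀))²` if `c = 0`. -/
def localRisk {Ω : Type*} [MeasurableSpace Ω] (P : Measure Ω) (fhat : Ω → ℝ → ℝ) (f : ℝ → ℝ)
    (x₀ c : ℝ) : ℝ≥0∞ :=
  if c = 0 then ∫⁻ ω, ENNReal.ofReal ((fhat ω x₀ - f x₀) ^ 2) ∂P
  else (ENNReal.ofReal (2 * c))⁻¹ *
    ∫⁻ ω, (∫⁻ x in Set.Icc (x₀ - c) (x₀ + c) ∩ Set.Icc 0 1,
      ENNReal.ofReal ((fhat ω x - f x) ^ 2)) ∂P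

/-- The maximal risk over `F(α, M)` of BlockJS on `[x₀ - c, x₀ + c]`, for the observations
`Z_n` driven by `B`. -/
def blockJSMaxRisk {Ω : Type*} [MeasurableSpace Ω] (P : Measure Ω) (B : ℝ≥0 → Ω → ℝ)
    (W : IntervalWavelets) (lam : ℝ) (L n : ℕ) (α M x₀ c : ℝ) : ℝ≥0∞ :=
  ⨆ f ∈ holderClass α M,
    localRisk P (fun ω => blockJS W lam L n (observedPath n f fun t => B t ω)) f x₀ c

end

/-!
The error of BlockJS splits into the coarse noise, the errors at the levels `j₀ ≤ j < J`, and the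
tail of the wavelet series, which is `O(n ^ (-α))` uniformly on `[0, 1]` because wavelet
coefficients of a Hölder function are `O(2 ^ (-j (1/2 + α)))`
(`IntervalWavelets.IsRegular.abs_coef_le`, `IntervalWavelets.IsWaveletBasis.abs_sub_partialSum_le`).
The empirical coefficients carry independent centred Gaussian noise of variance `1 / n`:
a Wiener integral is a limit of Riemann–Stieltjes sums, so its characteristic function can be
computed (`charFun_wienerIntegral`).

Shrinkage has three properties. The risk of a whole block is `O(L / n)`
(`lintegral_sum_sq_coefErr_le`). The risk of one coefficient is at most `θ² + 1 / n`
(`lintegral_sq_coefErr_le`). Where the signal energy of the block is a small fraction of the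
threshold, the noise contributes to this risk only when the noise energy of the block is almost at
the threshold; a Chernoff bound for the chi-square law and the equation
`λ - log λ - 1 = 2` make that contribution `O(L n ^ (-(1 + κ)))` for any given `κ < 1`
(`lintegral_sq_coefErr_le_of_small`).

At a point only boundedly many wavelets of each level overlap, and the levels are combined by
Minkowski's inequality. With the bound `L / n` for `2 ^ (j (1 + 2α)) ≤ n / L`, and the other two
bounds above that scale, the sum over the levels is dominated by the scale
`2 ^ j ≈ (n / L) ^ (1 / (1 + 2α))`. This gives the pointwise rate `(L / n) ^ (2α / (1 + 2α))`
(`exists_lintegral_sq_sub_le`), which is also a bound for every local risk and settles the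
smallest neighbourhoods.

For a window of half-width `c = d n ^ (-1 / (1 + 2α))` with `d ≥ 1`, the levels with
`2 ^ j c ≤ 1` are still treated pointwise and contribute `L / (n c)`. The finer levels are treated
in `L²` through a local Bessel inequality (`lintegral_localWindow_sq_le`), which avoids the
logarithmic penalty except for the blocks that straddle the ends of the window. These cost `L / n`
at each of the `O(1 + log d)` levels between the scale `1 / c` and the high levels. The resulting
bound `n ^ (-2α / (1 + 2α)) (1 + L (1 + log d) / d)` (`exists_localRisk_le`) gives the rates for
the two larger kinds of neighbourhood.
-/

/-! ### Riemann–Stieltjes integrals against a continuous path -/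

noncomputable section

open ProbabilityTheory Topology in
/-- The left-point Riemann–Stieltjes sums of a `C¹` function against a continuous path converge to
`pathIntegral`: summation by parts turns them into Riemann sums of `∫ g' b`. -/
theorem tendsto_riemannStieltjes_sum {g b : ℝ → ℝ} (hg : ContDiff ℝ 1 g) (hb : Continuous b) :
    Tendsto (fun N : ℕ => ∑ i ∈ Finset.range N,
      g ((i : ℝ) / N) * (b (((i : ℝ) + 1) / N) - b ((i : ℝ) / N))) atTop
      (𝓝 (pathIntegral g b)) := by
  have hg' : Continuous (deriv g) := hg.continuous_deriv le_rfl
  obtain ⟨G, hG⟩ := (isCompact_Icc (a := (0 : ℝ)) (b := 1)).exists_bound_of_continuousOn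
    hg'.continuousOn
  have hG0 : 0 ≤ G := (norm_nonneg _).trans (hG 0 (by simp))
  have huc := (isCompact_Icc (a := (0 : ℝ)) (b := 1)).uniformContinuousOn_of_continuous
    hb.continuousOn
  rw [Metric.uniformContinuousOn_iff] at huc
  rw [Metric.tendsto_atTop]
  intro ε hε
  obtain ⟨δ, hδ, hbδ⟩ := huc (ε / (G + 1)) (by positivity)
  obtain ⟨N₀, hN₀⟩ := exists_nat_gt (1 / δ)
  refine ⟨max N₀ 1, fun N hN => ?_⟩
  have hN1 : 1 ≤ N := le_of_max_le_right hN
  have hNpos : (0 : ℝ) < N := by exact_mod_cast hN1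
  have hNδ : 1 / (N : ℝ) < δ := by
    have : (1 : ℝ) / δ < N := hN₀.trans_le (by exact_mod_cast le_of_max_le_left hN)
    rw [div_lt_iff₀ hδ] at this
    rw [div_lt_iff₀ hNpos]; linarith
  have hint : ∀ (h : ℝ → ℝ), Continuous h → ∀ k < N, IntervalIntegrable h volume
      ((fun i : ℕ => (i : ℝ) / N) k) ((fun i : ℕ => (i : ℝ) / N) (k + 1)) :=
    fun h hh k _ => hh.intervalIntegrable _ _
  have h1 : ∑ i ∈ Finset.range N, (g (((i : ℝ) + 1) / N) * b (((i : ℝ) + 1) / N)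
      - g ((i : ℝ) / N) * b ((i : ℝ) / N)) = g 1 * b 1 - g 0 * b 0 := by
    have := Finset.sum_range_sub (fun i : ℕ => g ((i : ℝ) / N) * b ((i : ℝ) / N)) N
    simp only [Nat.cast_add, Nat.cast_one] at this
    rw [this]
    simp [hNpos.ne']
  have h2 : ∫ t in (0 : ℝ)..1, deriv g t * b t = ∑ i ∈ Finset.range N,
      ∫ t in ((i : ℝ) / N)..(((i : ℝ) + 1) / N), deriv g t * b t := by
    have := intervalIntegral.sum_integral_adjacent_intervals
      (hint (fun t => deriv g t * b t) (hg'.mul hb))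
    simp only [Nat.cast_add, Nat.cast_one, Nat.cast_zero, zero_div, div_self hNpos.ne'] at this
    exact this.symm
  have h3 : ∀ i : ℕ, g (((i : ℝ) + 1) / N) - g ((i : ℝ) / N)
      = ∫ t in ((i : ℝ) / N)..(((i : ℝ) + 1) / N), deriv g t := fun i =>
    (intervalIntegral.integral_deriv_eq_sub (fun x _ => hg.differentiable one_ne_zero x)
      (hg'.intervalIntegrable _ _)).symm
  have h4 : (∑ i ∈ Finset.range N, g ((i : ℝ) / N) * (b (((i : ℝ) + 1) / N) - b ((i : ℝ) / N)))
      - pathIntegral g b = ∑ i ∈ Finset.range N,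
      ∫ t in ((i : ℝ) / N)..(((i : ℝ) + 1) / N), deriv g t * (b t - b (((i : ℝ) + 1) / N)) := by
    rw [pathIntegral, ← h1, h2, ← Finset.sum_sub_distrib, ← Finset.sum_sub_distrib]
    refine Finset.sum_congr rfl fun i _ => ?_
    have : ∫ t in ((i : ℝ) / N)..(((i : ℝ) + 1) / N), deriv g t * (b t - b (((i : ℝ) + 1) / N))
        = (∫ t in ((i : ℝ) / N)..(((i : ℝ) + 1) / N), deriv g t * b t)
          - (g (((i : ℝ) + 1) / N) - g ((i : ℝ) / N)) * b (((i : ℝ) + 1) / N) := by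
      rw [h3, ← intervalIntegral.integral_mul_const, ← intervalIntegral.integral_sub]
      · simp only [mul_sub]
      · exact (hg'.mul hb).intervalIntegrable _ _
      · exact (hg'.mul continuous_const).intervalIntegrable _ _
    rw [this]; ring
  rw [Real.dist_eq, h4]
  -- by uniform continuity the path varies little on each interval of the partition
  have h5 : ∀ i ∈ Finset.range N, |∫ t in ((i : ℝ) / N)..(((i : ℝ) + 1) / N),
      deriv g t * (b t - b (((i : ℝ) + 1) / N))| ≤ G * (ε / (G + 1)) * (1 / N) := by
    intro i hi
    have hi' : (i : ℝ) + 1 ≤ N := by exact_mod_cast Finset.mem_range.1 hi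
    have hle : (i : ℝ) / N ≤ ((i : ℝ) + 1) / N := by gcongr; linarith
    have hlen : |((i : ℝ) + 1) / N - (i : ℝ) / N| = 1 / N := by
      rw [← sub_div]; simp
    have hle1 : ((i : ℝ) + 1) / N ≤ 1 := by rw [div_le_one hNpos]; exact hi'
    have hge0 : 0 ≤ (i : ℝ) / N := by positivity
    rw [← hlen]
    refine intervalIntegral.norm_integral_le_of_norm_le_const (E := ℝ) fun t ht => ?_
    rw [Set.uIoc_of_le hle] at ht
    rw [norm_mul]
    refine mul_le_mul (hG t ⟨by linarith [ht.1], by linarith [ht.2]⟩) ?_ (norm_nonneg _) hG0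
    rw [← dist_eq_norm]
    refine (hbδ t ⟨by linarith [ht.1], by linarith [ht.2]⟩ _ ⟨by linarith, hle1⟩ ?_).le
    rw [Real.dist_eq, abs_of_nonpos (by linarith [ht.2])]
    have h := le_abs_self (((i : ℝ) + 1) / N - (i : ℝ) / N)
    have h' := ht.1
    rw [hlen] at h
    linarith
  calc |∑ i ∈ Finset.range N, _| ≤ ∑ i ∈ Finset.range N, |_| := Finset.abs_sum_le_sum_abs _ _
    _ ≤ ∑ _i ∈ Finset.range N, G * (ε / (G + 1)) * (1 / N) := Finset.sum_le_sum h5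
    _ = G * (ε / (G + 1)) := by
        rw [Finset.sum_const, Finset.card_range, nsmul_eq_mul]; field_simp
    _ < ε := by
        rw [← mul_div_assoc, div_lt_iff₀ (by positivity)]; nlinarith

/-- Integration by parts identifies the path integral against a primitive. -/
theorem pathIntegral_primitive {g f : ℝ → ℝ} (hg : ContDiff ℝ 1 g)
    (hf : ContinuousOn f (Set.Icc 0 1)) :
    pathIntegral g (fun t => ∫ x in (0 : ℝ)..t, f x) = ∫ x in (0 : ℝ)..1, g x * f x := by
  have hg' : Continuous (deriv g) := hg.continuous_deriv le_rfl
  have hfi : IntervalIntegrable f volume 0 1 :=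
    ContinuousOn.intervalIntegrable (by rwa [Set.uIcc_of_le zero_le_one])
  rw [pathIntegral, intervalIntegral.integral_mul_deriv_eq_deriv_mul_of_hasDerivAt
    (u := g) (v := fun t => ∫ x in (0 : ℝ)..t, f x) (u' := deriv g) (v' := f)
    hg.continuous.continuousOn ?_ ?_ ?_ (hg'.intervalIntegrable _ _) hfi]
  · exact intervalIntegral.continuousOn_primitive_interval
      (by rw [Set.uIcc_of_le zero_le_one]; exact hf.integrableOn_Icc)
  · exact fun x _ => (hg.differentiable one_ne_zero x).hasDerivAt
  · intro x hx
    simp only [zero_le_one, inf_of_le_left, sup_of_le_right] at hx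
    have hfx : ContinuousAt f x := hf.continuousAt (Icc_mem_nhds hx.1 hx.2)
    refine intervalIntegral.integral_hasDerivAt_right
      (hfi.mono_set ?_) ?_ hfx
    · rw [Set.uIcc_of_le hx.1.le, Set.uIcc_of_le zero_le_one]
      exact Set.Icc_subset_Icc_right hx.2.le
    · exact (hf.mono Set.Ioo_subset_Icc_self).stronglyMeasurableAtFilter isOpen_Ioo x hx

theorem pathIntegral_add_mul {g Z Z' : ℝ → ℝ} (hg : ContDiff ℝ 1 g) (a : ℝ)
    (hZ : ContinuousOn Z (Set.Icc 0 1)) (hZ' : ContinuousOn Z' (Set.Icc 0 1)) :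
    pathIntegral g (fun t => Z t + a * Z' t) = pathIntegral g Z + a * pathIntegral g Z' := by
  have hg' : Continuous (deriv g) := hg.continuous_deriv le_rfl
  have hi : ∀ Y : ℝ → ℝ, ContinuousOn Y (Set.Icc 0 1) →
      IntervalIntegrable (fun t => deriv g t * Y t) volume 0 1 := fun Y hY =>
    ContinuousOn.intervalIntegrable
      (by rw [Set.uIcc_of_le zero_le_one]; exact hg'.continuousOn.mul hY)
  have : ∫ t in (0 : ℝ)..1, deriv g t * (Z t + a * Z' t)
      = (∫ t in (0 : ℝ)..1, deriv g t * Z t) + a * ∫ t in (0 : ℝ)..1, deriv g t * Z' t := by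
    rw [← intervalIntegral.integral_const_mul, ← intervalIntegral.integral_add (hi _ hZ)
      ((hi _ hZ').const_mul a)]
    congr 1; ext t; ring
  simp only [pathIntegral, this]; ring

/-- `pathIntegral` is linear in the integrand. -/
theorem pathIntegral_sum {ι : Type*} (s : Finset ι) (a : ι → ℝ) (g : ι → ℝ → ℝ) {Z : ℝ → ℝ}
    (hg : ∀ i ∈ s, ContDiff ℝ 1 (g i)) (hZ : Continuous Z) :
    pathIntegral (fun x => ∑ i ∈ s, a i * g i x) Z = ∑ i ∈ s, a i * pathIntegral (g i) Z := by
  have hd : ∀ t, deriv (fun x => ∑ i ∈ s, a i * g i x) t = ∑ i ∈ s, a i * deriv (g i) t := by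
    intro t
    rw [deriv_fun_sum fun i hi => ((hg i hi).differentiable one_ne_zero t).const_mul _]
    refine Finset.sum_congr rfl fun i hi => ?_
    rw [deriv_const_mul _ ((hg i hi).differentiable one_ne_zero t)]
  have : ∫ t in (0 : ℝ)..1, deriv (fun x => ∑ i ∈ s, a i * g i x) t * Z t
      = ∑ i ∈ s, a i * ∫ t in (0 : ℝ)..1, deriv (g i) t * Z t := by
    simp_rw [hd, Finset.sum_mul]
    rw [intervalIntegral.integral_finsetSum]
    · refine Finset.sum_congr rfl fun i _ => ?_
      rw [← intervalIntegral.integral_const_mul]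
      congr 1; ext t; ring
    · intro i hi
      exact ((continuous_const.mul ((hg i hi).continuous_deriv le_rfl)).mul hZ).intervalIntegrable
        _ _
  simp only [pathIntegral, this, Finset.sum_mul, ← Finset.sum_sub_distrib]
  refine Finset.sum_congr rfl fun i _ => ?_
  ring

end

/-! ### The Wiener integral of a smooth function is Gaussian -/

noncomputable section

/-- The integral `∫₀¹ g dB` of a `C¹` function against the driving path. -/
def wienerIntegral {Ω : Type*} (B : ℝ≥0 → Ω → ℝ) (g : ℝ → ℝ) (ω : Ω) : ℝ :=
  pathIntegral g fun t => B t.toNNReal ω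

section Wiener

open ProbabilityTheory

variable {Ω : Type*} [MeasurableSpace Ω] {P : Measure Ω} {B : ℝ≥0 → Ω → ℝ}

theorem IsBrownianReal.isProbabilityMeasure (hB : IsBrownianReal B P) : IsProbabilityMeasure P :=
  hB.isGaussianProcess.isProbabilityMeasure

theorem ae_continuous_path (hB : IsBrownianReal B P) :
    ∀ᵐ ω ∂P, Continuous fun t : ℝ => B t.toNNReal ω := by
  filter_upwards [hB.cont] with ω hω using hω.comp continuous_real_toNNReal

theorem ae_tendsto_wienerIntegral (hB : IsBrownianReal B P) {g : ℝ → ℝ} (hg : ContDiff ℝ 1 g) :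
    ∀ᵐ ω ∂P, Tendsto (fun N : ℕ => ∑ i ∈ Finset.range N, g ((i : ℝ) / N) *
      (B (((i : ℝ) + 1) / N).toNNReal ω - B ((i : ℝ) / N).toNNReal ω)) atTop
      (nhds (wienerIntegral B g ω)) := by
  filter_upwards [ae_continuous_path hB] with ω hω using tendsto_riemannStieltjes_sum hg hω

theorem aemeasurable_riemannSum (hB : IsBrownianReal B P) (g : ℝ → ℝ) (N : ℕ) :
    AEMeasurable (fun ω => ∑ i ∈ Finset.range N, g ((i : ℝ) / N) *
      (B (((i : ℝ) + 1) / N).toNNReal ω - B ((i : ℝ) / N).toNNReal ω)) P :=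
  Finset.aemeasurable_fun_sum _ fun _ _ =>
    ((hB.aemeasurable _).sub (hB.aemeasurable _)).const_mul _

theorem aemeasurable_wienerIntegral (hB : IsBrownianReal B P) {g : ℝ → ℝ} (hg : ContDiff ℝ 1 g) :
    AEMeasurable (wienerIntegral B g) P :=
  aemeasurable_of_tendsto_metrizable_ae atTop (fun N => aemeasurable_riemannSum hB g N)
    (ae_tendsto_wienerIntegral hB hg)

/-- By the independence of the increments, the Riemann–Stieltjes sums are centred normal; their
variances are Riemann sums of `∫₀¹ g²`. -/
theorem charFun_riemannSum (hB : IsBrownianReal B P) (g : ℝ → ℝ) (N : ℕ) (u : ℝ) :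
    charFun (P.map fun ω => ∑ i ∈ Finset.range N, g ((i : ℝ) / N) *
      (B (((i : ℝ) + 1) / N).toNNReal ω - B ((i : ℝ) / N).toNNReal ω)) u
      = Complex.exp (-(((∑ i ∈ Finset.range N, g ((i : ℝ) / N) ^ 2 *
          (((i : ℝ) + 1) / N - (i : ℝ) / N) : ℝ) : ℂ) * u ^ 2 / 2)) := by
  have hP := IsBrownianReal.isProbabilityMeasure hB
  have hmono : Monotone fun i : ℕ => ((i : ℝ) / N).toNNReal := fun i j hij => by
    refine Real.toNNReal_le_toNNReal ?_
    gcongr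
  have hind := (hB.hasIndepIncrements.nat hmono).comp (fun i x => g ((i : ℝ) / N) * x)
    (fun i => measurable_const_mul _)
  simp only [Function.comp_def, Nat.cast_add, Nat.cast_one] at hind
  have hind' : iIndepFun ((Finset.range N).restrict fun (i : ℕ) ω => g ((i : ℝ) / N) *
      (B (((i : ℝ) + 1) / N).toNNReal ω - B ((i : ℝ) / N).toNNReal ω)) P :=
    hind.precomp (g := fun i : Finset.range N => (i : ℕ)) Subtype.val_injective
  have hm : ∀ i ∈ Finset.range N, AEMeasurable (fun ω => g ((i : ℝ) / N) *
      (B (((i : ℝ) + 1) / N).toNNReal ω - B ((i : ℝ) / N).toNNReal ω)) P := fun i _ =>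
    ((hB.aemeasurable _).sub (hB.aemeasurable _)).const_mul _
  rw [iIndepFun.charFun_map_fun_finsetSum_eq_prod hm hind', Finset.prod_apply]
  have hterm : ∀ i ∈ Finset.range N, charFun (P.map fun ω => g ((i : ℝ) / N) *
      (B (((i : ℝ) + 1) / N).toNNReal ω - B ((i : ℝ) / N).toNNReal ω)) u
      = Complex.exp (-(((g ((i : ℝ) / N) ^ 2 *
          (((i : ℝ) + 1) / N - (i : ℝ) / N) : ℝ) : ℂ) * u ^ 2 / 2)) := by
    intro i _
    have hlaw := hB.hasLaw_sub (((i : ℝ) + 1) / N).toNNReal ((i : ℝ) / N).toNNReal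
    have hmap : P.map (fun ω => g ((i : ℝ) / N) *
        (B (((i : ℝ) + 1) / N).toNNReal ω - B ((i : ℝ) / N).toNNReal ω))
        = (gaussianReal 0 (nndist ((((i : ℝ) + 1) / N).toNNReal : ℝ)
            (((i : ℝ) / N).toNNReal : ℝ))).map (fun x => g ((i : ℝ) / N) * x) := by
      have h := hlaw.map_eq
      rw [show ((((i : ℝ) + 1) / N).toNNReal : ℝ) = (((i : ℝ) + 1) / N).toNNReal.1 from rfl,
        show ((((i : ℝ)) / N).toNNReal : ℝ) = (((i : ℝ)) / N).toNNReal.1 from rfl, ← h,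
        AEMeasurable.map_map_of_aemeasurable (measurable_const_mul _).aemeasurable
          hlaw.aemeasurable]
      rfl
    rw [hmap, charFun_map_mul, charFun_gaussianReal]
    congr 1
    have hd : ((nndist ((((i : ℝ) + 1) / N).toNNReal : ℝ) (((i : ℝ) / N).toNNReal : ℝ) : ℝ≥0) : ℝ)
        = ((i : ℝ) + 1) / N - (i : ℝ) / N := by
      rw [coe_nndist, Real.coe_toNNReal _ (by positivity), Real.coe_toNNReal _ (by positivity),
        Real.dist_eq, ← sub_div, add_sub_cancel_left, abs_of_nonneg (by positivity)]
    rw [show (((nndist ((((i : ℝ) + 1) / N).toNNReal : ℝ) (((i : ℝ) / N).toNNReal : ℝ) : ℝ≥0) : ℂ))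
      = ((((i : ℝ) + 1) / N - (i : ℝ) / N : ℝ) : ℂ) by rw [← hd]]
    push_cast
    ring
  rw [Finset.prod_congr rfl hterm, ← Complex.exp_sum]
  congr 1
  push_cast
  rw [Finset.sum_neg_distrib, Finset.sum_mul, Finset.sum_div]

theorem tendsto_sum_sq {g : ℝ → ℝ} (hg : ContDiff ℝ 1 g) :
    Tendsto (fun N : ℕ => ∑ i ∈ Finset.range N, g ((i : ℝ) / N) ^ 2 *
          (((i : ℝ) + 1) / N - (i : ℝ) / N)) atTop (nhds (∫ x in (0 : ℝ)..1, g x ^ 2)) := by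
  have h := tendsto_riemannStieltjes_sum (g := fun x => g x ^ 2) (b := fun t => t) (hg.pow 2)
    continuous_id
  have h2 : pathIntegral (fun x => g x ^ 2) (fun t => t) = ∫ x in (0 : ℝ)..1, g x ^ 2 := by
    have h3 := pathIntegral_primitive (f := fun _ => 1) (hg.pow 2) continuousOn_const
    simpa using h3
  rwa [h2] at h

/-- The Wiener integral of a `C¹` function has the centred normal characteristic function with
variance `∫₀¹ g²`. -/
theorem charFun_wienerIntegral (hB : IsBrownianReal B P) {g : ℝ → ℝ} (hg : ContDiff ℝ 1 g)
    (u : ℝ) : charFun (P.map (wienerIntegral B g)) u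
      = Complex.exp (-(((∫ x in (0 : ℝ)..1, g x ^ 2 : ℝ) : ℂ) * u ^ 2 / 2)) := by
  have hP := IsBrownianReal.isProbabilityMeasure hB
  have hcont : Continuous fun x : ℝ => Complex.exp (u * x * Complex.I) := by fun_prop
  refine tendsto_nhds_unique (f := fun N : ℕ => charFun (P.map fun ω => ∑ i ∈ Finset.range N,
    g ((i : ℝ) / N) * (B (((i : ℝ) + 1) / N).toNNReal ω - B ((i : ℝ) / N).toNNReal ω)) u)
    (l := atTop) ?_ ?_
  · simp_rw [charFun_apply_real]
    rw [integral_map (aemeasurable_wienerIntegral hB hg) hcont.aestronglyMeasurable]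
    have : ∀ N : ℕ, ∫ x, Complex.exp (u * x * Complex.I) ∂(P.map fun ω => ∑ i ∈ Finset.range N,
        g ((i : ℝ) / N) * (B (((i : ℝ) + 1) / N).toNNReal ω - B ((i : ℝ) / N).toNNReal ω))
        = ∫ ω, Complex.exp (u * ((∑ i ∈ Finset.range N, g ((i : ℝ) / N) *
          (B (((i : ℝ) + 1) / N).toNNReal ω - B ((i : ℝ) / N).toNNReal ω) : ℝ) : ℂ)
            * Complex.I) ∂P :=
      fun N => integral_map (aemeasurable_riemannSum hB g N) hcont.aestronglyMeasurable
    simp_rw [this]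
    refine tendsto_integral_of_dominated_convergence (fun _ => 1) ?_ (integrable_const _) ?_ ?_
    · exact fun N => (hcont.measurable.comp_aemeasurable
        (aemeasurable_riemannSum hB g N)).aestronglyMeasurable
    · intro N
      filter_upwards with ω
      rw [← Complex.ofReal_mul, Complex.norm_exp_ofReal_mul_I]
    · filter_upwards [ae_tendsto_wienerIntegral hB hg] with ω hω
      exact (hcont.tendsto _).comp hω
  · simp_rw [charFun_riemannSum hB]
    have hc : Continuous fun v : ℝ => Complex.exp (-((v : ℂ) * u ^ 2 / 2)) := by fun_prop
    exact (hc.tendsto _).comp (tendsto_sum_sq hg)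

/-- Wiener integrals of functions that are orthonormal in `L²[0, 1]` are independent standard
normal variables. -/
theorem map_wienerIntegral_eq_stdGaussian (hB : IsBrownianReal B P) {ι : Type*} [Fintype ι]
    [DecidableEq ι] {g : ι → ℝ → ℝ} (hg : ∀ i, ContDiff ℝ 1 (g i))
    (horth : ∀ i k, ∫ x in (0 : ℝ)..1, g i x * g k x = if i = k then 1 else 0) :
    P.map (fun ω => WithLp.toLp 2 fun i => wienerIntegral B (g i) ω)
      = stdGaussian (EuclideanSpace ℝ ι) := by
  have hP := IsBrownianReal.isProbabilityMeasure hB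
  have hmeas : AEMeasurable (fun ω => WithLp.toLp 2 fun i => wienerIntegral B (g i) ω) P :=
    (WithLp.measurable_toLp 2 _).comp_aemeasurable
      (aemeasurable_pi_lambda _ fun i => aemeasurable_wienerIntegral hB (hg i))
  have : IsProbabilityMeasure (P.map (fun ω => WithLp.toLp 2 fun i => wienerIntegral B (g i) ω)) :=
    Measure.isProbabilityMeasure_map hmeas
  -- a linear combination of Wiener integrals is the Wiener integral of the linear combination,
  -- so the joint characteristic function is known from the one-dimensional ones
  refine Measure.ext_of_charFun (E := EuclideanSpace ℝ ι) (funext fun a => ?_)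
  rw [charFun_stdGaussian]
  have hsum : ContDiff ℝ 1 fun x => ∑ i, a i * g i x :=
    ContDiff.sum fun i _ => contDiff_const.mul (hg i)
  have hsq : ∫ x in (0 : ℝ)..1, (∑ i, a i * g i x) ^ 2 = ‖a‖ ^ 2 := by
    have h1 : ∀ x, (∑ i, a i * g i x) ^ 2 = ∑ i, ∑ k, a i * a k * (g i x * g k x) := fun x => by
      rw [sq, Finset.sum_mul_sum]
      refine Finset.sum_congr rfl fun i _ => Finset.sum_congr rfl fun k _ => by ring
    have hc : ∀ i k, Continuous fun x => a i * a k * (g i x * g k x) := fun i k =>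
      continuous_const.mul ((hg i).continuous.mul (hg k).continuous)
    simp_rw [h1]
    rw [intervalIntegral.integral_finsetSum fun i _ =>
      (continuous_finsetSum _ fun k _ => hc i k).intervalIntegrable _ _]
    rw [EuclideanSpace.norm_sq_eq]
    refine Finset.sum_congr rfl fun i _ => ?_
    rw [intervalIntegral.integral_finsetSum fun k _ => (hc i k).intervalIntegrable _ _]
    simp_rw [intervalIntegral.integral_const_mul, horth]
    simp [sq]
  have h := charFun_wienerIntegral hB hsum 1
  rw [charFun_apply_real, integral_map (aemeasurable_wienerIntegral hB hsum)
    (by fun_prop), hsq] at h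
  rw [charFun_apply, integral_map hmeas (by fun_prop)]
  have hae : ∀ᵐ ω ∂P, wienerIntegral B (fun x => ∑ i, a i * g i x) ω
      = inner ℝ (WithLp.toLp 2 fun i => wienerIntegral B (g i) ω) a := by
    filter_upwards [ae_continuous_path hB] with ω hω
    rw [wienerIntegral, pathIntegral_sum _ _ _ (fun i _ => hg i) hω]
    simp [PiLp.inner_apply, wienerIntegral]
  rw [← integral_congr_ae (hae.mono fun ω hω => by rw [← hω])]
  simp only [Complex.ofReal_one, one_mul, one_pow, mul_one] at h
  rw [h]
  congr 1
  push_cast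
  ring

end Wiener

end

/-! ### Large deviations of the noise energy of a block -/

noncomputable section

section ChiSquare

open ProbabilityTheory

theorem lintegral_exp_mul_sq_gaussianReal {s : ℝ} (hs : s < 1 / 2) :
    ∫⁻ x, ENNReal.ofReal (Real.exp (s * x ^ 2)) ∂(gaussianReal 0 1)
      = ENNReal.ofReal (√((1 - 2 * s)⁻¹)) := by
  have hpos : 0 < 1 / 2 - s := by linarith
  rw [gaussianReal_of_var_ne_zero _ one_ne_zero,
    lintegral_withDensity_eq_lintegral_mul _ (measurable_gaussianPDF 0 1) (by fun_prop)]
  have h1 : ∀ x : ℝ, (gaussianPDF 0 1 * fun x => ENNReal.ofReal (Real.exp (s * x ^ 2))) x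
      = ENNReal.ofReal ((√(2 * Real.pi))⁻¹ * Real.exp (-(1 / 2 - s) * x ^ 2)) := by
    intro x
    rw [Pi.mul_apply, gaussianPDF, ← ENNReal.ofReal_mul (gaussianPDFReal_nonneg _ _ _),
      gaussianPDFReal, mul_assoc, ← Real.exp_add]
    simp only [NNReal.coe_one, mul_one, sub_zero]
    ring_nf
  simp_rw [h1]
  rw [← ofReal_integral_eq_lintegral_ofReal ((integrable_exp_neg_mul_sq hpos).const_mul _)
    (ae_of_all _ fun x => by positivity), integral_const_mul, integral_gaussian]
  congr 1
  rw [← Real.sqrt_inv, ← Real.sqrt_mul (by positivity)]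
  congr 1
  have : 1 - 2 * s ≠ 0 := by linarith
  have hpi := Real.pi_ne_zero
  rw [show 1 / 2 - s = (1 - 2 * s) / 2 by ring]
  field_simp

theorem lintegral_exp_mul_sum_sq_stdGaussian {ι : Type*} [Fintype ι] {s : ℝ} (hs : s < 1 / 2) :
    ∫⁻ x, ENNReal.ofReal (Real.exp (s * ∑ i, x i ^ 2)) ∂(stdGaussian (EuclideanSpace ℝ ι))
      = ENNReal.ofReal (√((1 - 2 * s)⁻¹)) ^ Fintype.card ι := by
  rw [← map_pi_eq_stdGaussian, lintegral_map (by fun_prop) (by fun_prop)]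
  simp only [Finset.mul_sum, Real.exp_sum]
  simp_rw [ENNReal.ofReal_prod_of_nonneg fun i _ => (Real.exp_pos _).le]
  have hmeas : Measurable fun x : ℝ => ENNReal.ofReal (Real.exp (s * x ^ 2)) := by fun_prop
  have hind := iIndepFun_pi (μ := fun _ : ι => gaussianReal 0 1)
    (X := fun _ x => ENNReal.ofReal (Real.exp (s * x ^ 2))) fun _ => hmeas.aemeasurable
  rw [lintegral_prod_eq_prod_lintegral_of_indepFun Finset.univ _ hind
    fun i => hmeas.comp (measurable_pi_apply i)]
  have : ∀ i : ι, ∫⁻ x : ι → ℝ, ENNReal.ofReal (Real.exp (s * x i ^ 2))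
      ∂(Measure.pi fun _ => gaussianReal 0 1) = ENNReal.ofReal (√((1 - 2 * s)⁻¹)) := fun i => by
    rw [← lintegral_exp_mul_sq_gaussianReal hs]
    exact (measurePreserving_eval (fun _ : ι => gaussianReal 0 1) i).lintegral_comp hmeas
  simp_rw [this]
  simp

variable {Ω : Type*} [MeasurableSpace Ω] {P : Measure Ω} {B : ℝ≥0 → Ω → ℝ}

/-- The noise energy of a block has the exponential moments of a chi-square variable. -/
theorem lintegral_exp_mul_sum_sq_wienerIntegral (hB : IsBrownianReal B P) {S : Finset ℕ}
    {g : ℕ → ℝ → ℝ} (hg : ∀ i ∈ S, ContDiff ℝ 1 (g i))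
    (horth : ∀ i ∈ S, ∀ k ∈ S, ∫ x in (0 : ℝ)..1, g i x * g k x = if i = k then 1 else 0)
    {s : ℝ} (hs : s < 1 / 2) :
    ∫⁻ ω, ENNReal.ofReal (Real.exp (s * ∑ i ∈ S, wienerIntegral B (g i) ω ^ 2)) ∂P
      = ENNReal.ofReal (√((1 - 2 * s)⁻¹)) ^ S.card := by
  have hlaw := map_wienerIntegral_eq_stdGaussian hB (g := fun i : S => g i)
    (fun i => hg i i.2) (fun i k => by
      rw [horth i i.2 k k.2]; simp only [Subtype.coe_inj])
  have h := lintegral_exp_mul_sum_sq_stdGaussian (ι := S) hs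
  have hm : AEMeasurable (fun ω => (WithLp.toLp 2 fun i : S => wienerIntegral B (g i) ω :
      EuclideanSpace ℝ S)) P := (WithLp.measurable_toLp 2 _).comp_aemeasurable
    (aemeasurable_pi_lambda _ fun i : S => aemeasurable_wienerIntegral hB (hg i i.2))
  rw [← hlaw, lintegral_map' (by fun_prop) hm] at h
  simp only [Fintype.card_coe] at h
  rw [← h]
  refine lintegral_congr fun ω => ?_
  rw [← Finset.sum_coe_sort S fun i => wienerIntegral B (g i) ω ^ 2]

theorem lintegral_sq_wienerIntegral (hB : IsBrownianReal B P) {g : ℝ → ℝ} (hg : ContDiff ℝ 1 g)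
    (hone : ∫ x in (0 : ℝ)..1, g x * g x = 1) :
    ∫⁻ ω, ENNReal.ofReal (wienerIntegral B g ω ^ 2) ∂P = 1 := by
  have hm := aemeasurable_wienerIntegral hB hg
  have hP := IsBrownianReal.isProbabilityMeasure hB
  have hPm : IsProbabilityMeasure (P.map (wienerIntegral B g)) :=
    Measure.isProbabilityMeasure_map hm
  have hlaw : P.map (wienerIntegral B g) = gaussianReal 0 1 := by
    refine Measure.ext_of_charFun (funext fun u => ?_)
    rw [charFun_wienerIntegral hB hg, charFun_gaussianReal]
    simp_rw [sq (g _), hone]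
    simp
  have h1 : ∫⁻ ω, ENNReal.ofReal (wienerIntegral B g ω ^ 2) ∂P
      = ∫⁻ x, ENNReal.ofReal (x ^ 2) ∂(gaussianReal 0 1) := by
    rw [← hlaw, lintegral_map' (by fun_prop) hm]
  rw [h1, ← ofReal_integral_eq_lintegral_ofReal _ (ae_of_all _ fun x => sq_nonneg x)]
  · have h2 := variance_id_gaussianReal (μ := 0) (v := 1)
    rw [variance_of_integral_eq_zero aemeasurable_id (by simp)] at h2
    simp only [id, NNReal.coe_one] at h2
    rw [h2, ENNReal.ofReal_one]
  · exact (memLp_id_gaussianReal 2).integrable_sq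

/-- Chernoff's bound for the truncated second moment, in pointwise form. -/
theorem indicator_le_mul_exp {s x₀ u : ℝ} (hs : 1 ≤ s * x₀) (hx₀ : 0 < x₀) :
    (if x₀ < u then u else 0) ≤ x₀ * Real.exp (-(s * x₀)) * Real.exp (s * u) := by
  split_ifs with h
  · have h1 : u / x₀ ≤ Real.exp (u / x₀ - 1) := by
      have := Real.add_one_le_exp (u / x₀ - 1); linarith
    have h2 : u / x₀ - 1 ≤ -(s * x₀) + s * u := by
      have : u / x₀ - 1 = (u - x₀) / x₀ := by field_simp
      rw [this, div_le_iff₀ hx₀]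
      nlinarith [mul_le_mul_of_nonneg_right hs (sub_nonneg.2 h.le)]
    rw [mul_assoc, ← Real.exp_add]
    calc u = x₀ * (u / x₀) := by field_simp
      _ ≤ _ := mul_le_mul_of_nonneg_left (h1.trans (Real.exp_le_exp.2 h2)) hx₀.le
  · positivity

/-- The noise energy of a block of at most `L` coefficients, truncated at a level slightly below
the threshold `lam * L`, has an expectation of almost order `exp (-L)`. The choice of `lam` as root
of `lam - log lam - 1 = 2` is what produces the exponent. -/
theorem lintegral_truncated_sum_sq_le (hB : IsBrownianReal B P) {S : Finset ℕ}
    {g : ℕ → ℝ → ℝ} (hg : ∀ i ∈ S, ContDiff ℝ 1 (g i))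
    (horth : ∀ i ∈ S, ∀ k ∈ S, ∫ x in (0 : ℝ)..1, g i x * g k x = if i = k then 1 else 0)
    {lam : ℝ} (hlam_one : 1 < lam) (hlam : lam - Real.log lam - 1 = 2)
    {L : ℕ} (hS : S.card ≤ L) {δ : ℝ}
    (hL : 1 ≤ L * (1 - δ) ^ 2) :
    ∫⁻ ω, ENNReal.ofReal (if (1 - δ) ^ 2 * (lam * L) < ∑ i ∈ S, wienerIntegral B (g i) ω ^ 2
        then ∑ i ∈ S, wienerIntegral B (g i) ω ^ 2 else 0) ∂P
      ≤ ENNReal.ofReal (((1 - δ) ^ 2 * (lam * L)) * Real.exp (-(1 - (lam - 1) * δ) * L)) := by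
  -- this `s` minimizes the Chernoff bound `exp (-s lam L) (1 - 2 s) ^ (-L / 2)` at `lam L`
  set s : ℝ := (1 - lam⁻¹) / 2 with hs_def
  have hlam0 : 0 < lam := by linarith
  have hlog : 0 < Real.log lam := Real.log_pos hlam_one
  have hs : s < 1 / 2 := by
    have : 0 < lam⁻¹ := by positivity
    rw [hs_def]; linarith
  have hs2 : (1 - 2 * s)⁻¹ = lam := by
    rw [hs_def, show 1 - 2 * ((1 - lam⁻¹) / 2) = lam⁻¹ by ring, inv_inv]
  have hslam : s * lam = (lam - 1) / 2 := by rw [hs_def]; field_simp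
  set x₀ : ℝ := (1 - δ) ^ 2 * (lam * L) with hx₀
  have hsx : s * x₀ = (lam - 1) / 2 * (L * (1 - δ) ^ 2) := by rw [hx₀, ← hslam]; ring
  have hsx1 : 1 ≤ s * x₀ := by rw [hsx]; nlinarith
  have hx₀0 : 0 < x₀ := by
    rw [hx₀]
    have : (1 - δ) ^ 2 * (lam * L) = lam * (L * (1 - δ) ^ 2) := by ring
    rw [this]; positivity
  calc _ ≤ ∫⁻ ω, ENNReal.ofReal (x₀ * Real.exp (-(s * x₀))) *
        ENNReal.ofReal (Real.exp (s * ∑ i ∈ S, wienerIntegral B (g i) ω ^ 2)) ∂P := by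
        refine lintegral_mono fun ω => ?_
        rw [← ENNReal.ofReal_mul (by positivity)]
        exact ENNReal.ofReal_le_ofReal (indicator_le_mul_exp hsx1 hx₀0)
    _ = ENNReal.ofReal (x₀ * Real.exp (-(s * x₀))) * ENNReal.ofReal (√lam) ^ S.card := by
        rw [lintegral_const_mul' _ _ ENNReal.ofReal_ne_top,
          lintegral_exp_mul_sum_sq_wienerIntegral hB hg horth hs, hs2]
    _ ≤ ENNReal.ofReal (x₀ * Real.exp (-(s * x₀))) * ENNReal.ofReal (√lam) ^ L := by
        gcongr
        rw [ENNReal.one_le_ofReal]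
        exact Real.one_le_sqrt.2 hlam_one.le
    _ ≤ _ := by
        rw [← ENNReal.ofReal_pow (by positivity), ← ENNReal.ofReal_mul (by positivity), mul_assoc]
        refine ENNReal.ofReal_le_ofReal (mul_le_mul_of_nonneg_left ?_ hx₀0.le)
        have h1 : √lam ^ L = Real.exp (L * (Real.log lam / 2)) := by
          rw [Real.exp_nat_mul, ← Real.log_sqrt hlam0.le, Real.exp_log (by positivity)]
        rw [h1, ← Real.exp_add]
        refine Real.exp_le_exp.2 ?_
        rw [hsx, show Real.log lam = lam - 3 by linarith]
        have : (0 : ℝ) ≤ L := by positivity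
        nlinarith [mul_nonneg (mul_nonneg (sub_nonneg.2 hlam_one.le) this) (sq_nonneg δ)]

end ChiSquare

end

/-! ### Block James–Stein shrinkage -/

noncomputable section

section Shrinkage

theorem shrink_mem_Icc {T Q : ℝ} (hT : 0 ≤ T) (hQ : 0 ≤ Q) :
    max 0 (1 - T / Q) ∈ Set.Icc (0 : ℝ) 1 :=
  ⟨le_max_left _ _, max_le zero_le_one (by have := div_nonneg hT hQ; linarith)⟩

/-- Shrinking with a factor in `[0, 1]` costs at most the noise plus the signal. -/
theorem sq_shrink_sub_le {a y θ : ℝ} (ha : a ∈ Set.Icc (0 : ℝ) 1) :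
    (a * y - θ) ^ 2 ≤ θ ^ 2 + (y - θ) ^ 2 := by
  obtain ⟨h0, h1⟩ := ha
  nlinarith [mul_nonneg h0 (sub_nonneg.2 h1), sq_nonneg (y - θ + θ), sq_nonneg θ,
    sq_nonneg (y - θ), mul_nonneg (mul_nonneg h0 (sub_nonneg.2 h1)) (sq_nonneg y)]

/-- James–Stein shrinkage moves a block by at most the square root of the threshold. -/
theorem sum_sq_shrink_sub_le {S : Finset ℕ} {y θ : ℕ → ℝ} {T : ℝ} (hT : 0 ≤ T) :
    ∑ k ∈ S, (max 0 (1 - T / ∑ i ∈ S, y i ^ 2) * y k - θ k) ^ 2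
      ≤ 2 * T + 2 * ∑ k ∈ S, (y k - θ k) ^ 2 := by
  set Q := ∑ i ∈ S, y i ^ 2 with hQ
  have hQ0 : 0 ≤ Q := Finset.sum_nonneg fun i _ => sq_nonneg _
  set a := max 0 (1 - T / Q) with ha
  have h1 : (1 - a) ^ 2 * Q ≤ T := by
    rcases hQ0.eq_or_lt with h | h
    · rw [← h]; simpa using hT
    rcases le_total T Q with hTQ | hTQ
    · have : T / Q ≤ 1 := (div_le_one h).2 hTQ
      rw [ha, max_eq_right (by linarith), sub_sub_cancel, div_pow, sq Q, div_mul_eq_mul_div,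
        div_le_iff₀ (by positivity)]
      nlinarith [mul_nonneg hT h.le, mul_nonneg (mul_nonneg hT h.le) (sub_nonneg.2 hTQ)]
    · have : 1 ≤ T / Q := (one_le_div h).2 hTQ
      rw [ha, max_eq_left (by linarith)]
      simpa using hTQ
  calc ∑ k ∈ S, (a * y k - θ k) ^ 2
      ≤ ∑ k ∈ S, (2 * ((1 - a) ^ 2 * y k ^ 2) + 2 * (y k - θ k) ^ 2) := by
        refine Finset.sum_le_sum fun k _ => ?_
        nlinarith [sq_nonneg ((y k - θ k) + (1 - a) * y k)]
    _ = 2 * ((1 - a) ^ 2 * Q) + 2 * ∑ k ∈ S, (y k - θ k) ^ 2 := by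
        rw [Finset.sum_add_distrib, ← Finset.mul_sum, ← Finset.mul_sum, ← Finset.mul_sum]
    _ ≤ _ := by linarith

/-- A block whose signal energy is a small fraction of the threshold is set to zero, unless the
noise energy alone almost exceeds the threshold. -/
theorem sq_shrink_sub_le_of_small {S : Finset ℕ} {y θ : ℕ → ℝ} {T δ : ℝ} (hT : 0 ≤ T)
    (hδ0 : 0 < δ) (hδ1 : δ < 1) (hθ : ∑ i ∈ S, θ i ^ 2 ≤ δ ^ 2 * T) {k : ℕ} (hk : k ∈ S) :
    (max 0 (1 - T / ∑ i ∈ S, y i ^ 2) * y k - θ k) ^ 2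
      ≤ θ k ^ 2 + if (1 - δ) ^ 2 * T < ∑ i ∈ S, (y i - θ i) ^ 2
        then ∑ i ∈ S, (y i - θ i) ^ 2 else 0 := by
  have hQ0 : 0 ≤ ∑ i ∈ S, y i ^ 2 := Finset.sum_nonneg fun i _ => sq_nonneg _
  split_ifs with h
  · have h1 : (y k - θ k) ^ 2 ≤ ∑ i ∈ S, (y i - θ i) ^ 2 :=
      Finset.single_le_sum (f := fun i => (y i - θ i) ^ 2) (fun i _ => sq_nonneg _) hk
    linarith [sq_shrink_sub_le (y := y k) (θ := θ k) (shrink_mem_Icc hT hQ0)]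
  · -- convexity: `y = δ (θ / δ) + (1 - δ) ((y - θ) / (1 - δ))`
    have h1 : ∑ i ∈ S, y i ^ 2 ≤ T := by
      have h2 : ∀ i ∈ S, y i ^ 2 ≤ θ i ^ 2 / δ + (y i - θ i) ^ 2 / (1 - δ) := fun i _ => by
        have hd : 0 < 1 - δ := by linarith
        rw [div_add_div _ _ hδ0.ne' hd.ne', le_div_iff₀ (by positivity)]
        nlinarith [sq_nonneg (θ i - δ * y i)]
      refine (Finset.sum_le_sum h2).trans ?_
      rw [Finset.sum_add_distrib, ← Finset.sum_div, ← Finset.sum_div]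
      have h3 : (∑ i ∈ S, θ i ^ 2) / δ ≤ δ * T := by
        rw [div_le_iff₀ hδ0]; linarith
      have h4 : (∑ i ∈ S, (y i - θ i) ^ 2) / (1 - δ) ≤ (1 - δ) * T := by
        rw [div_le_iff₀ (by linarith)]; linarith
      linarith
    have h5 : max 0 (1 - T / ∑ i ∈ S, y i ^ 2) * y k = 0 := by
      rcases hQ0.eq_or_lt with h | h
      · have : y k ^ 2 = 0 :=
          (Finset.sum_eq_zero_iff_of_nonneg fun i _ => sq_nonneg _).1 h.symm k hk
        rw [pow_eq_zero_iff two_ne_zero] at this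
        rw [this, mul_zero]
      · have : 1 ≤ T / ∑ i ∈ S, y i ^ 2 := (one_le_div h).2 h1
        rw [max_eq_left (by linarith), zero_mul]
    rw [h5]; simp

end Shrinkage

section Blocks

theorem mem_jsBlock {L j b k : ℕ} :
    k ∈ jsBlock L j b ↔ (1 ≤ k ∧ k ≤ 2 ^ j) ∧ (b - 1) * L + 1 ≤ k ∧ k ≤ b * L := by
  simp [jsBlock]

theorem mem_jsBlock_jsBlockIndex {L j k : ℕ} (hL : 1 ≤ L) (hk : k ∈ Finset.Icc 1 (2 ^ j)) :
    k ∈ jsBlock L j (jsBlockIndex L k) := by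
  rw [Finset.mem_Icc] at hk
  refine mem_jsBlock.2 ⟨hk, ?_, ?_⟩
  · rw [jsBlockIndex, Nat.add_sub_cancel]
    have := Nat.div_mul_le_self (k - 1) L
    omega
  · rw [jsBlockIndex, add_mul, one_mul]
    have := Nat.lt_div_mul_add (a := k - 1) (b := L) hL
    omega

theorem jsBlockIndex_eq_of_mem {L j b k : ℕ} (hk : k ∈ jsBlock L j b) :
    jsBlockIndex L k = b := by
  obtain ⟨⟨h1, -⟩, h2, h3⟩ := mem_jsBlock.1 hk
  rcases Nat.eq_zero_or_pos b with rfl | hb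
  · simp at h3; omega
  have : (k - 1) / L = b - 1 := by
    refine Nat.div_eq_of_lt_le (by omega) ?_
    rw [Nat.sub_add_cancel hb]; omega
  rw [jsBlockIndex, this]; omega

theorem card_jsBlock_le (L j b : ℕ) : (jsBlock L j b).card ≤ L := by
  have : jsBlock L j b ⊆ Finset.Icc ((b - 1) * L + 1) ((b - 1) * L + L) := fun k hk => by
    obtain ⟨⟨h1, -⟩, h2, h3⟩ := mem_jsBlock.1 hk
    refine Finset.mem_Icc.2 ⟨h2, h3.trans ?_⟩
    rcases Nat.eq_zero_or_pos b with rfl | hb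
    · simp
    · obtain ⟨b, rfl⟩ : ∃ c, b = c + 1 := ⟨b - 1, by omega⟩
      simp [add_mul]
  refine (Finset.card_le_card this).trans ?_
  simp

theorem jsBlock_subset (L j b : ℕ) : jsBlock L j b ⊆ Finset.Icc 1 (2 ^ j) :=
  Finset.filter_subset _ _

end Blocks

section Noise

open ProbabilityTheory

variable {Ω : Type*} [MeasurableSpace Ω] {P : Measure Ω} {B : ℝ≥0 → Ω → ℝ}

/-- The empirical coefficient is the true coefficient plus `n ^ (-1/2)` times a Wiener integral. -/
theorem ae_pathIntegral_observedPath (hB : IsBrownianReal B P) {g f : ℝ → ℝ}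
    (hg : ContDiff ℝ 1 g) (hf : ContinuousOn f (Set.Icc 0 1)) (n : ℕ) :
    ∀ᵐ ω ∂P, pathIntegral g (observedPath n f fun t => B t ω)
      = (∫ x in (0 : ℝ)..1, g x * f x) + (√n)⁻¹ * wienerIntegral B g ω := by
  filter_upwards [ae_continuous_path hB] with ω hω
  rw [← pathIntegral_primitive hg hf, wienerIntegral, ← pathIntegral_add_mul hg _ _
    hω.continuousOn]
  · rfl
  · have := intervalIntegral.continuousOn_primitive_interval (f := f) (μ := volume) (a := 0)
      (b := 1) (by rw [Set.uIcc_of_le zero_le_one]; exact hf.integrableOn_Icc)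
    rwa [Set.uIcc_of_le zero_le_one] at this

theorem aemeasurable_pathIntegral_observedPath (hB : IsBrownianReal B P) {g f : ℝ → ℝ}
    (hg : ContDiff ℝ 1 g) (hf : ContinuousOn f (Set.Icc 0 1)) (n : ℕ) :
    AEMeasurable (fun ω => pathIntegral g (observedPath n f fun t => B t ω)) P := by
  refine AEMeasurable.congr (f := fun ω => (∫ x in (0 : ℝ)..1, g x * f x)
    + (√n)⁻¹ * wienerIntegral B g ω) ?_ ?_
  · exact ((aemeasurable_wienerIntegral hB hg).const_mul _).const_add _
  · filter_upwards [ae_pathIntegral_observedPath hB hg hf n] with ω hω using hω.symm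

/-- The noise in an empirical coefficient of a normalized function has variance `1 / n`. -/
theorem lintegral_sq_noise (hB : IsBrownianReal B P) {g f : ℝ → ℝ}
    (hg : ContDiff ℝ 1 g) (hone : ∫ x in (0 : ℝ)..1, g x * g x = 1)
    (hf : ContinuousOn f (Set.Icc 0 1)) (n : ℕ) :
    ∫⁻ ω, ENNReal.ofReal ((pathIntegral g (observedPath n f fun t => B t ω)
      - ∫ x in (0 : ℝ)..1, g x * f x) ^ 2) ∂P = ENNReal.ofReal (1 / n) := by
  have : ∀ᵐ ω ∂P, ENNReal.ofReal ((pathIntegral g (observedPath n f fun t => B t ω)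
      - ∫ x in (0 : ℝ)..1, g x * f x) ^ 2)
      = ENNReal.ofReal (1 / n) * ENNReal.ofReal (wienerIntegral B g ω ^ 2) := by
    filter_upwards [ae_pathIntegral_observedPath hB hg hf n] with ω hω
    rw [hω, add_sub_cancel_left, mul_pow, inv_pow, Real.sq_sqrt (by positivity), ← one_div,
      ENNReal.ofReal_mul (by positivity)]
  rw [lintegral_congr_ae this, lintegral_const_mul' _ _ ENNReal.ofReal_ne_top,
    lintegral_sq_wienerIntegral hB hg hone, mul_one]

end Noise

/-- Monotone bound for the expectation of a finite nonnegative linear combination. -/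
theorem lintegral_ofReal_sum_le {Ω : Type*} [MeasurableSpace Ω] {P : Measure Ω} {ι : Type*}
    {s : Finset ι} {a c : ι → ℝ} {u : ι → Ω → ℝ} (ha : ∀ i ∈ s, 0 ≤ a i)
    (hc : ∀ i ∈ s, 0 ≤ c i)
    (hu : ∀ i ∈ s, AEMeasurable (u i) P) (hu0 : ∀ i ∈ s, ∀ ω, 0 ≤ u i ω)
    (h : ∀ i ∈ s, ∫⁻ ω, ENNReal.ofReal (u i ω) ∂P ≤ ENNReal.ofReal (c i)) :
    ∫⁻ ω, ENNReal.ofReal (∑ i ∈ s, a i * u i ω) ∂P ≤ ENNReal.ofReal (∑ i ∈ s, a i * c i) := by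
  have h1 : ∀ ω, ENNReal.ofReal (∑ i ∈ s, a i * u i ω)
      = ∑ i ∈ s, ENNReal.ofReal (a i) * ENNReal.ofReal (u i ω) := fun ω => by
    rw [ENNReal.ofReal_sum_of_nonneg fun i hi => mul_nonneg (ha i hi) (hu0 i hi ω)]
    exact Finset.sum_congr rfl fun i hi => ENNReal.ofReal_mul (ha i hi)
  simp_rw [h1]
  rw [lintegral_finsetSum' _ fun i hi => (hu i hi).ennreal_ofReal.const_mul _,
    ENNReal.ofReal_sum_of_nonneg fun i hi => mul_nonneg (ha i hi) (hc i hi)]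
  refine Finset.sum_le_sum fun i hi => ?_
  rw [lintegral_const_mul' _ _ ENNReal.ofReal_ne_top, ENNReal.ofReal_mul (ha i hi)]
  gcongr
  exact h i hi

end

/-! ### Size, localization and orthonormality of the wavelet system -/

noncomputable section

section Dilations

theorem integral_Icc_eq_intervalIntegral (h : ℝ → ℝ) :
    ∫ x in Set.Icc (0 : ℝ) 1, h x = ∫ x in (0 : ℝ)..1, h x := by
  rw [integral_Icc_eq_integral_Ioc, intervalIntegral.integral_of_le zero_le_one]

theorem contDiff_edgeDilation {m : WithTop ℕ∞} {K : ℕ} {g : ℝ → ℝ} {gL gR : ℕ → ℝ → ℝ}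
    (hg : ContDiff ℝ m g)
    (hL : ∀ k ∈ Finset.Icc 1 K, ContDiff ℝ m (gL k))
    (hR : ∀ k ∈ Finset.Icc 1 K, ContDiff ℝ m (gR k))
    {j k : ℕ} (hk : k ∈ Finset.Icc 1 (2 ^ j)) : ContDiff ℝ m (edgeDilation K g gL gR j k) := by
  rw [Finset.mem_Icc] at hk
  unfold edgeDilation
  refine contDiff_const.mul ?_
  split_ifs with h1 h2
  · exact (hL k (Finset.mem_Icc.2 ⟨hk.1, h1⟩)).comp (by fun_prop)
  · exact (hR _ (Finset.mem_Icc.2 ⟨by omega, by omega⟩)).comp (by fun_prop)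
  · exact hg.comp (by fun_prop)

/-- The functions at level `j` are of size `O(2 ^ (j/2))`, and the one with index `k` lives within
`O(2 ^ (-j))` of `k / 2 ^ j`. -/
theorem exists_edgeDilation_bound {K : ℕ} {g : ℝ → ℝ} {gL gR : ℕ → ℝ → ℝ}
    (hg : Continuous g) (hgs : HasCompactSupport g)
    (hL : ∀ k ∈ Finset.Icc 1 K, Continuous (gL k))
    (hR : ∀ k ∈ Finset.Icc 1 K, Continuous (gR k))
    (hLs : ∀ k ∈ Finset.Icc 1 K, HasCompactSupport (gL k))
    (hRs : ∀ k ∈ Finset.Icc 1 K, HasCompactSupport (gR k)) :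
    ∃ A : ℝ, 1 ≤ A ∧ ∀ j k : ℕ, k ∈ Finset.Icc 1 (2 ^ j) → ∀ x : ℝ,
      (edgeDilation K g gL gR j k x ≠ 0 → |2 ^ j * x - k| ≤ A) ∧
      |edgeDilation K g gL gR j k x| ≤ A * √(2 ^ j) := by
  have key : ∀ h : ℝ → ℝ, Continuous h → HasCompactSupport h →
      ∃ R : ℝ, 0 ≤ R ∧ ∀ x, (h x ≠ 0 → |x| ≤ R) ∧ |h x| ≤ R := by
    intro h hc hs
    obtain ⟨C, hC⟩ := hc.bounded_above_of_compact_support hs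
    obtain ⟨R, hR⟩ := hs.isBounded.exists_norm_le
    refine ⟨max (max C R) 0, le_max_right _ _, fun x => ⟨fun hx => ?_, ?_⟩⟩
    · exact (hR x (subset_tsupport h hx)).trans ((le_max_right _ _).trans (le_max_left _ _))
    · exact (hC x).trans ((le_max_left _ _).trans (le_max_left _ _))
  obtain ⟨R, hR0, hRb⟩ := key g hg hgs
  choose! RL hRL0 hRLb using fun k (hk : k ∈ Finset.Icc 1 K) => key (gL k) (hL k hk) (hLs k hk)
  choose! RR hRR0 hRRb using fun k (hk : k ∈ Finset.Icc 1 K) => key (gR k) (hR k hk) (hRs k hk)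
  set A : ℝ := 1 + R + ∑ k ∈ Finset.Icc 1 K, RL k + ∑ k ∈ Finset.Icc 1 K, RR k + K with hA
  have hsL : 0 ≤ ∑ k ∈ Finset.Icc 1 K, RL k := Finset.sum_nonneg hRL0
  have hsR : 0 ≤ ∑ k ∈ Finset.Icc 1 K, RR k := Finset.sum_nonneg hRR0
  have hK0 : (0 : ℝ) ≤ K := by positivity
  refine ⟨A, by rw [hA]; linarith, fun j k hk x => ?_⟩
  rw [Finset.mem_Icc] at hk
  unfold edgeDilation
  rw [abs_mul, abs_of_nonneg (Real.sqrt_nonneg _), mul_comm A]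
  have hs : (0 : ℝ) ≤ √(2 ^ j) := Real.sqrt_nonneg _
  split_ifs with h1 h2
  · have hkm : k ∈ Finset.Icc 1 K := Finset.mem_Icc.2 ⟨hk.1, h1⟩
    have hle : RL k ≤ ∑ k ∈ Finset.Icc 1 K, RL k := Finset.single_le_sum hRL0 hkm
    refine ⟨fun hx => ?_, mul_le_mul_of_nonneg_left ?_ hs⟩
    · have h3 := abs_le.1 ((hRLb k hkm _).1 (right_ne_zero_of_mul hx))
      have h4 : (k : ℝ) ≤ K := by exact_mod_cast h1
      have h5 : (0 : ℝ) ≤ k := by positivity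
      rw [abs_le]; constructor <;> linarith [h3.1, h3.2]
    · linarith [(hRLb k hkm (2 ^ j * x)).2]
  · have hkm : 2 ^ j + 1 - k ∈ Finset.Icc 1 K := Finset.mem_Icc.2 ⟨by omega, by omega⟩
    have hle : RR (2 ^ j + 1 - k) ≤ ∑ k ∈ Finset.Icc 1 K, RR k :=
      Finset.single_le_sum hRR0 hkm
    refine ⟨fun hx => ?_, mul_le_mul_of_nonneg_left ?_ hs⟩
    · have h3 := abs_le.1 ((hRRb _ hkm _).1 (right_ne_zero_of_mul hx))
      have h4 : (2 : ℝ) ^ j ≤ k + K := by exact_mod_cast h2.le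
      have h5 : (k : ℝ) ≤ 2 ^ j := by exact_mod_cast hk.2
      rw [abs_le]; constructor <;> linarith [h3.1, h3.2]
    · linarith [(hRRb _ hkm (2 ^ j * (1 - x))).2]
  · refine ⟨fun hx => ?_, mul_le_mul_of_nonneg_left ?_ hs⟩
    · have h3 := (hRb _).1 (right_ne_zero_of_mul hx)
      linarith
    · linarith [(hRb (2 ^ j * x - k)).2]

/-- At most `2 A + 1` integers lie within `A` of a given point. -/
theorem card_near_le {A : ℝ} (hA : 0 ≤ A) (t : ℝ) (s : Finset ℕ)
    (hs : ∀ k ∈ s, |t - k| ≤ A) : (s.card : ℝ) ≤ 2 * A + 1 := by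
  rcases s.eq_empty_or_nonempty with rfl | hne
  · simp; linarith
  have hsub : s ⊆ Finset.Icc (s.min' hne) (s.max' hne) := fun k hk =>
    Finset.mem_Icc.2 ⟨s.min'_le k hk, s.le_max' k hk⟩
  have hc := Finset.card_le_card hsub
  rw [Nat.card_Icc] at hc
  have h1 := abs_le.1 (hs _ (s.min'_mem hne))
  have h2 := abs_le.1 (hs _ (s.max'_mem hne))
  have h3 : s.min' hne ≤ s.max' hne := s.min'_le _ (s.max'_mem hne)
  have hc' : (s.card : ℝ) ≤ (s.max' hne : ℝ) + 1 - s.min' hne := by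
    have : s.card + s.min' hne ≤ s.max' hne + 1 := by omega
    have h4 : (s.card : ℝ) + s.min' hne ≤ s.max' hne + 1 := by exact_mod_cast this
    linarith
  linarith [h1.1, h1.2, h2.1, h2.2]

end Dilations

namespace IntervalWavelets

variable {W : IntervalWavelets}

theorem IsWaveletBasis.hasCompactSupport_ψ (hW : W.IsWaveletBasis) : HasCompactSupport W.ψ :=
  HasCompactSupport.of_support_subset_isCompact isCompact_Icc hW.support_ψ

theorem IsWaveletBasis.hasCompactSupport_φ (hW : W.IsWaveletBasis) : HasCompactSupport W.φ :=
  HasCompactSupport.of_support_subset_isCompact isCompact_Icc hW.support_φ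

theorem IsRegular.contDiff_mother {r : ℕ} (hWr : W.IsRegular r) (hr : 1 ≤ r) {j k : ℕ}
    (hk : k ∈ Finset.Icc 1 (2 ^ j)) : ContDiff ℝ 1 (W.mother j k) := by
  have h1 : (1 : WithTop ℕ∞) ≤ ((r : ℕ∞) : WithTop ℕ∞) := by exact_mod_cast hr
  exact contDiff_edgeDilation (hWr.contDiff_ψ.of_le h1)
    (fun k hk => (hWr.contDiff_ψL k hk).of_le h1) (fun k hk => (hWr.contDiff_ψR k hk).of_le h1) hk

theorem IsRegular.contDiff_father {r : ℕ} (hWr : W.IsRegular r) {k : ℕ}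
    (hk : k ∈ Finset.Icc 1 (2 ^ W.j₀)) : ContDiff ℝ 1 (W.father k) :=
  contDiff_edgeDilation hWr.contDiff_φ hWr.contDiff_φL hWr.contDiff_φR hk

/-- A constant that bounds the size and the localization of all functions of the system:
`A` bounds `|ψ_{j,k}| / 2 ^ (j/2)`, the distance of `2 ^ j x` from `k` when `ψ_{j,k} x ≠ 0`, and
the coarsest functions `φ_{j₀,k}`. -/
structure IsLocalized (W : IntervalWavelets) (A : ℝ) : Prop where
  one_le : 1 ≤ A
  near : ∀ j k : ℕ, k ∈ Finset.Icc 1 (2 ^ j) → ∀ x, W.mother j k x ≠ 0 → |2 ^ j * x - k| ≤ A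
  bound : ∀ j k : ℕ, k ∈ Finset.Icc 1 (2 ^ j) → ∀ x, |W.mother j k x| ≤ A * √(2 ^ j)
  bound_father : ∀ k ∈ Finset.Icc 1 (2 ^ W.j₀), ∀ x, |W.father k x| ≤ A

theorem IsWaveletBasis.exists_isLocalized (hW : W.IsWaveletBasis) {r : ℕ} (hWr : W.IsRegular r) :
    ∃ A, W.IsLocalized A := by
  obtain ⟨A, hA, h⟩ := exists_edgeDilation_bound hWr.contDiff_ψ.continuous hW.hasCompactSupport_ψ
    (fun k hk => (hWr.contDiff_ψL k hk).continuous) (fun k hk => (hWr.contDiff_ψR k hk).continuous)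
    hW.compact_ψL hW.compact_ψR
  obtain ⟨A', hA', h'⟩ := exists_edgeDilation_bound hWr.contDiff_φ.continuous hW.hasCompactSupport_φ
    (fun k hk => (hWr.contDiff_φL k hk).continuous) (fun k hk => (hWr.contDiff_φR k hk).continuous)
    hW.compact_φL hW.compact_φR
  have h0 : 0 ≤ A' * √(2 ^ W.j₀) := by positivity
  refine ⟨A + A' * √(2 ^ W.j₀), by linarith, fun j k hk x hx => ?_, fun j k hk x => ?_,
    fun k hk x => ?_⟩
  · linarith [(h j k hk x).1 hx]
  · have h1 : |W.mother j k x| ≤ A * √(2 ^ j) := (h j k hk x).2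
    refine h1.trans ?_
    gcongr
    linarith
  · have h1 : |W.father k x| ≤ A' * √(2 ^ W.j₀) := (h' _ k hk x).2
    linarith

/-- The wavelet system as one family: `inl k` stands for `φ_{j₀,k}` and `inr ⟨j, k⟩` for
`ψ_{j,k}`. -/
def basisFun (W : IntervalWavelets) : ℕ ⊕ (Σ _ : ℕ, ℕ) → ℝ → ℝ
  | .inl k => W.father k
  | .inr p => W.mother p.1 p.2

/-- The indices of the functions of the system at levels below `J`. -/
def basisIndex (W : IntervalWavelets) (J : ℕ) : Finset (ℕ ⊕ (Σ _ : ℕ, ℕ)) :=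
  (Finset.Icc 1 (2 ^ W.j₀)).disjSum
    ((Finset.Ico W.j₀ J).sigma fun j => Finset.Icc 1 (2 ^ j))

theorem IsWaveletBasis.orthonormal_basisFun (hW : W.IsWaveletBasis) {J : ℕ}
    {p q : ℕ ⊕ (Σ _ : ℕ, ℕ)} (hp : p ∈ W.basisIndex J) (hq : q ∈ W.basisIndex J) :
    ∫ x in (0 : ℝ)..1, W.basisFun p x * W.basisFun q x = if p = q then 1 else 0 := by
  rw [← integral_Icc_eq_intervalIntegral]
  simp only [basisIndex] at hp hq
  rcases p with k | ⟨j, k⟩ <;> rcases q with k' | ⟨j', k'⟩ <;>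
    simp only [Finset.inl_mem_disjSum, Finset.inr_mem_disjSum, Finset.mem_sigma,
      Finset.mem_Ico] at hp hq
  · simp only [basisFun, Sum.inl.injEq]
    exact hW.orthonormal_father k hp k' hq
  · simp only [basisFun, reduceCtorEq, if_false]
    exact hW.orthogonal_father_mother j' hq.1.1 k hp k' hq.2
  · simp only [basisFun, reduceCtorEq, if_false]
    simp_rw [mul_comm (W.mother j k _)]
    exact hW.orthogonal_father_mother j hp.1.1 k' hq k hp.2
  · simp only [basisFun, Sum.inr.injEq, Sigma.mk.injEq, heq_eq_eq]
    exact hW.orthonormal_mother j j' hp.1.1 hq.1.1 k hp.2 k' hq.2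

theorem IsRegular.contDiff_basisFun {r : ℕ} (hWr : W.IsRegular r) (hr : 1 ≤ r) {J : ℕ}
    {p : ℕ ⊕ (Σ _ : ℕ, ℕ)} (hp : p ∈ W.basisIndex J) : ContDiff ℝ 1 (W.basisFun p) := by
  simp only [basisIndex] at hp
  rcases p with k | ⟨j, k⟩ <;>
    simp only [Finset.inl_mem_disjSum, Finset.inr_mem_disjSum, Finset.mem_sigma,
      Finset.mem_Ico] at hp
  · exact hWr.contDiff_father hp
  · exact hWr.contDiff_mother hr hp.2

end IntervalWavelets

/-- Parseval's identity for finite sums over an orthonormal family of continuous functions. -/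
theorem integral_mul_sum_of_orthonormal {ι : Type*} [DecidableEq ι] {s : Finset ι}
    {e : ι → ℝ → ℝ} (he : ∀ i ∈ s, Continuous (e i))
    (horth : ∀ i ∈ s, ∀ k ∈ s, ∫ x in (0 : ℝ)..1, e i x * e k x = if i = k then 1 else 0)
    (c : ι → ℝ) {i : ι} (hi : i ∈ s) :
    ∫ x in (0 : ℝ)..1, e i x * ∑ k ∈ s, c k * e k x = c i := by
  simp_rw [Finset.mul_sum]
  rw [intervalIntegral.integral_finsetSum (f := fun k x => e i x * (c k * e k x)) fun k hk =>
    ((he i hi).mul (continuous_const.mul (he k hk))).intervalIntegrable _ _]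
  have : ∀ k ∈ s, ∫ x in (0 : ℝ)..1, e i x * (c k * e k x) = if i = k then c k else 0 := by
    intro k hk
    simp_rw [mul_left_comm _ (c k)]
    rw [intervalIntegral.integral_const_mul, horth i hi k hk]
    split_ifs <;> simp
  rw [Finset.sum_congr rfl this]
  simp [hi]

theorem integral_sq_sum_of_orthonormal {ι : Type*} [DecidableEq ι] {s : Finset ι}
    {e : ι → ℝ → ℝ} (he : ∀ i ∈ s, Continuous (e i))
    (horth : ∀ i ∈ s, ∀ k ∈ s, ∫ x in (0 : ℝ)..1, e i x * e k x = if i = k then 1 else 0)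
    (c : ι → ℝ) :
    ∫ x in (0 : ℝ)..1, (∑ k ∈ s, c k * e k x) ^ 2 = ∑ k ∈ s, c k ^ 2 := by
  have hc : Continuous fun x => ∑ k ∈ s, c k * e k x :=
    continuous_finsetSum _ fun k hk => continuous_const.mul (he k hk)
  have h1 : ∀ x, (∑ k ∈ s, c k * e k x) ^ 2
      = ∑ i ∈ s, c i * (e i x * ∑ k ∈ s, c k * e k x) := fun x => by
    rw [sq, Finset.sum_mul]
    exact Finset.sum_congr rfl fun i _ => by ring
  simp_rw [h1]
  rw [intervalIntegral.integral_finsetSum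
    (f := fun i x => c i * (e i x * ∑ k ∈ s, c k * e k x)) fun k hk =>
    (continuous_const.mul ((he k hk).mul hc)).intervalIntegrable _ _]
  refine Finset.sum_congr rfl fun i hi => ?_
  rw [intervalIntegral.integral_const_mul, integral_mul_sum_of_orthonormal he horth c hi, sq]

end

/-! ### Taylor expansion and decay of the wavelet coefficients -/

noncomputable section

section Taylor

/-- Taylor's formula with Hölder remainder, for a function `F 0` on `[0, 1]` with successive
derivatives `F 1, …, F k`. -/
theorem abs_sub_taylor_le {k : ℕ} {F : ℕ → ℝ → ℝ} {β M x₁ : ℝ} (hβ : 0 ≤ β) (hM : 0 ≤ M)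
    (hx₁ : x₁ ∈ Set.Icc (0 : ℝ) 1)
    (hF : ∀ i < k, ∀ x ∈ Set.Icc (0 : ℝ) 1,
      HasDerivWithinAt (F i) (F (i + 1) x) (Set.Icc 0 1) x)
    (hk : ∀ x ∈ Set.Icc (0 : ℝ) 1, |F k x - F k x₁| ≤ M * |x - x₁| ^ β) :
    ∀ x ∈ Set.Icc (0 : ℝ) 1,
      |F 0 x - ∑ m ∈ Finset.range (k + 1), F m x₁ / m.factorial * (x - x₁) ^ m|
        ≤ M * |x - x₁| ^ (k + β) := by
  induction k generalizing F with
  | zero => intro x hx; simpa using hk x hx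
  | succ k ih =>
    have ih' := ih (F := fun i => F (i + 1)) (fun i hi => hF (i + 1) (by omega)) hk
    intro x hx
    set h : ℝ → ℝ := fun x =>
      F 0 x - ∑ m ∈ Finset.range (k + 1 + 1), F m x₁ / m.factorial * (x - x₁) ^ m with hh
    set h' : ℝ → ℝ := fun x =>
      F 1 x - ∑ m ∈ Finset.range (k + 1), F (m + 1) x₁ / m.factorial * (x - x₁) ^ m with hh'
    have hsub : Set.uIcc x₁ x ⊆ Set.Icc 0 1 := Set.uIcc_subset_Icc hx₁ hx
    have hd : ∀ y ∈ Set.Icc (0 : ℝ) 1, HasDerivWithinAt h (h' y) (Set.Icc 0 1) y := by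
      intro y hy
      refine (hF 0 (by omega) y hy).sub ?_
      have hs : ∀ y, ∑ m ∈ Finset.range (k + 1 + 1), F m x₁ / m.factorial * (y - x₁) ^ m
          = ∑ m ∈ Finset.range (k + 1), F (m + 1) x₁ / (m + 1).factorial * (y - x₁) ^ (m + 1)
            + F 0 x₁ := fun y => by rw [Finset.sum_range_succ']; simp
      simp_rw [hs]
      refine (HasDerivWithinAt.fun_sum fun m _ => ?_).add_const _
      have h1 : HasDerivAt (fun y => F (m + 1) x₁ / (m + 1).factorial * (y - x₁) ^ (m + 1))
          (F (m + 1) x₁ / (m + 1).factorial * (((m + 1 : ℕ) : ℝ) * (y - x₁) ^ m * 1)) y := by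
        simpa using (((hasDerivAt_id y).sub_const x₁).pow (m + 1)).const_mul
          (F (m + 1) x₁ / (m + 1).factorial)
      refine h1.hasDerivWithinAt.congr_deriv ?_
      rw [Nat.factorial_succ]
      push_cast
      have : (m.factorial : ℝ) ≠ 0 := by positivity
      field_simp
    have hh0 : h x₁ = 0 := by
      rw [hh]
      simp only [sub_self]
      rw [Finset.sum_range_succ']
      simp
    have hbd : ∀ y ∈ Set.uIcc x₁ x, ‖h' y‖ ≤ M * |x - x₁| ^ (k + β) := by
      intro y hy
      refine (ih' y (hsub hy)).trans ?_
      gcongr M * ?_ ^ _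
      exact Set.abs_sub_left_of_mem_uIcc hy
    have := (convex_uIcc x₁ x).norm_image_sub_le_of_norm_hasDerivWithin_le
      (fun y hy => (hd y (hsub hy)).mono hsub) hbd Set.left_mem_uIcc Set.right_mem_uIcc
    rw [hh0, sub_zero] at this
    refine this.trans (le_of_eq ?_)
    rw [show ((k + 1 : ℕ) : ℝ) + β = (k + β) + 1 by push_cast; ring, Real.norm_eq_abs]
    rcases eq_or_ne x x₁ with rfl | hne
    · simp [Real.zero_rpow (show (k : ℝ) + β + 1 ≠ 0 by positivity)]
    · rw [Real.rpow_add_one (abs_pos.2 (sub_ne_zero.2 hne)).ne', mul_assoc]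

variable {α M : ℝ} {f : ℝ → ℝ}

theorem continuousOn_of_mem_holderClass (hf : f ∈ holderClass α M) :
    ContinuousOn f (Set.Icc 0 1) := hf.1.continuousOn

/-- A function of the Hölder class is approximated to order `α` near any point of `[0, 1]` by a
polynomial whose degree is less than `α`. -/
theorem exists_polynomial_of_mem_holderClass (hα : 0 < α) (hM : 0 < M) (hf : f ∈ holderClass α M)
    {x₁ : ℝ} (hx₁ : x₁ ∈ Set.Icc (0 : ℝ) 1) :
    ∃ q : Polynomial ℝ, (q.natDegree : ℝ) < α ∧
      ∀ x ∈ Set.Icc (0 : ℝ) 1, |f x - q.eval x| ≤ M * |x - x₁| ^ α := by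
  set k := ⌈α⌉₊ - 1 with hk
  have hceil : 0 < ⌈α⌉₊ := Nat.ceil_pos.2 hα
  have hkα : (k : ℝ) < α := by
    rw [← Nat.lt_ceil]; omega
  set F : ℕ → ℝ → ℝ := fun i => iteratedDerivWithin i f (Set.Icc 0 1) with hF
  have hu : UniqueDiffOn ℝ (Set.Icc (0 : ℝ) 1) := uniqueDiffOn_Icc zero_lt_one
  have hderiv : ∀ i < k, ∀ x ∈ Set.Icc (0 : ℝ) 1,
      HasDerivWithinAt (F i) (F (i + 1) x) (Set.Icc 0 1) x := by
    intro i hi x hx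
    have h1 := hf.1.differentiableOn_iteratedDerivWithin (m := i) (by exact_mod_cast hi) hu x hx
    have h2 := h1.hasDerivWithinAt
    rwa [← iteratedDerivWithin_succ] at h2
  have hH : ∀ x ∈ Set.Icc (0 : ℝ) 1, |F k x - F k x₁| ≤ M * |x - x₁| ^ (α - k) := by
    intro x hx
    rcases lt_trichotomy x x₁ with h | h | h
    · exact hf.2 x hx x₁ hx₁ h
    · rw [h]; simp; positivity
    · rw [abs_sub_comm, abs_sub_comm x]; exact hf.2 x₁ hx₁ x hx h
  refine ⟨∑ m ∈ Finset.range (k + 1),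
    Polynomial.C (F m x₁ / m.factorial) * (Polynomial.X - Polynomial.C x₁) ^ m, ?_, ?_⟩
  · refine lt_of_le_of_lt ?_ hkα
    norm_cast
    refine Polynomial.natDegree_sum_le_of_forall_le _ _ fun m hm => ?_
    refine (Polynomial.natDegree_C_mul_le _ _).trans (Polynomial.natDegree_pow_le.trans ?_)
    rw [Polynomial.natDegree_X_sub_C, mul_one]
    have := Finset.mem_range.1 hm; omega
  · intro x hx
    have := abs_sub_taylor_le (sub_pos.2 hkα).le hM.le hx₁ hderiv hH x hx
    rw [add_sub_cancel] at this
    simpa [Polynomial.eval_finsetSum, hF] using this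

end Taylor

namespace IntervalWavelets

variable {W : IntervalWavelets} {r : ℕ} {A α M : ℝ} {f : ℝ → ℝ}

/-- The coefficient of `f` with respect to a member of the wavelet system. -/
def coef (W : IntervalWavelets) (f : ℝ → ℝ) (p : ℕ ⊕ (Σ _ : ℕ, ℕ)) : ℝ :=
  ∫ x in (0 : ℝ)..1, W.basisFun p x * f x

theorem IsRegular.integral_mother_mul_polynomial (hWr : W.IsRegular r) (hr : 1 ≤ r) {j k : ℕ}
    (hj : W.j₀ ≤ j) (hk : k ∈ Finset.Icc 1 (2 ^ j)) {q : Polynomial ℝ} (hq : q.natDegree < r) :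
    ∫ x in (0 : ℝ)..1, W.mother j k x * q.eval x = 0 := by
  have hc := (hWr.contDiff_mother hr hk).continuous
  simp_rw [Polynomial.eval_eq_sum_range, Finset.mul_sum]
  rw [intervalIntegral.integral_finsetSum
    (f := fun i x => W.mother j k x * (q.coeff i * x ^ i)) fun i _ =>
    (hc.mul (continuous_const.mul (continuous_pow i))).intervalIntegrable _ _]
  refine Finset.sum_eq_zero fun i hi => ?_
  have h1 := hWr.moment_mother i (by have := Finset.mem_range.1 hi; omega) j hj k hk
  rw [integral_Icc_eq_intervalIntegral] at h1
  have h2 : ∀ x, W.mother j k x * (q.coeff i * x ^ i) = q.coeff i * (x ^ i * W.mother j k x) :=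
    fun x => by ring
  simp_rw [h2]
  rw [intervalIntegral.integral_const_mul, h1, mul_zero]

/-- Wavelet coefficients of a Hölder function decay like `2 ^ (-j (1/2 + α))`: on the support of
`ψ_{j,k}` the function differs by `O(2 ^ (-jα))` from a polynomial that `ψ_{j,k}` annihilates. -/
theorem IsRegular.abs_coef_le (hWr : W.IsRegular r) (hA : W.IsLocalized A)
    (hα : 0 < α) (hαr : α < r) (hM : 0 < M) (hf : f ∈ holderClass α M) {j k : ℕ}
    (hj : W.j₀ ≤ j) (hk : k ∈ Finset.Icc 1 (2 ^ j)) :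
    |W.coef f (.inr ⟨j, k⟩)| ≤
      4 * A ^ 2 * M * (2 * A) ^ α * ((2 : ℝ) ^ j) ^ (-(1 / 2 + α)) := by
  have hr : 1 ≤ r := by
    have : (0 : ℝ) < r := hα.trans hαr
    exact_mod_cast this
  have hA0 : 0 < A := by linarith [hA.one_le]
  have h2j : (0 : ℝ) < 2 ^ j := by positivity
  have hc := (hWr.contDiff_mother hr hk).continuous
  have hrhs : 0 ≤ 4 * A ^ 2 * M * (2 * A) ^ α * ((2 : ℝ) ^ j) ^ (-(1 / 2 + α)) := by positivity
  by_cases hne : ∃ x₁ ∈ Set.Icc (0 : ℝ) 1, W.mother j k x₁ ≠ 0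
  swap
  · push Not at hne
    have : W.coef f (.inr ⟨j, k⟩) = 0 := by
      rw [coef, intervalIntegral.integral_congr (g := fun _ => 0), intervalIntegral.integral_zero]
      intro x hx
      rw [Set.uIcc_of_le zero_le_one] at hx
      simp [basisFun, hne x hx]
    rw [this]; simpa using hrhs
  obtain ⟨x₁, hx₁, hx₁0⟩ := hne
  obtain ⟨q, hq, hfq⟩ := exists_polynomial_of_mem_holderClass hα hM hf hx₁
  have hqr : q.natDegree < r := by exact_mod_cast hq.trans hαr
  have hfc := continuousOn_of_mem_holderClass hf
  have heq : W.coef f (.inr ⟨j, k⟩) = ∫ x in (0 : ℝ)..1, W.mother j k x * (f x - q.eval x) := by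
    simp_rw [mul_sub]
    rw [intervalIntegral.integral_sub, hWr.integral_mother_mul_polynomial hr hj hk hqr, sub_zero]
    · rfl
    · exact ContinuousOn.intervalIntegrable
        (by rw [Set.uIcc_of_le zero_le_one]; exact hc.continuousOn.mul hfc)
    · exact (hc.mul q.continuous).intervalIntegrable _ _
  set ρ : ℝ := 2 * A / 2 ^ j with hρ
  have hρ0 : 0 < ρ := by positivity
  set C : ℝ := A * √(2 ^ j) * (M * ρ ^ α) with hC
  have hC0 : 0 ≤ C := by positivity
  have hbound : ∀ x ∈ Set.Icc (0 : ℝ) 1, ‖W.mother j k x * (f x - q.eval x)‖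
      ≤ (Metric.closedBall x₁ ρ).indicator (fun _ => C) x := by
    intro x hx
    by_cases hx0 : W.mother j k x = 0
    · rw [hx0, zero_mul, norm_zero]
      exact Set.indicator_nonneg (fun _ _ => hC0) _
    · have h1 := abs_le.1 (hA.near j k hk x hx0)
      have h2 := abs_le.1 (hA.near j k hk x₁ hx₁0)
      have hdist : |x - x₁| ≤ ρ := by
        have habs : |x - x₁| * 2 ^ j = |(x - x₁) * 2 ^ j| := by rw [abs_mul, abs_of_pos h2j]
        rw [hρ, le_div_iff₀ h2j, habs, abs_le]
        constructor <;> nlinarith [h1.1, h1.2, h2.1, h2.2]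
      rw [Set.indicator_of_mem (by rwa [Metric.mem_closedBall, Real.dist_eq]), norm_mul]
      refine mul_le_mul (hA.bound j k hk x) ((hfq x hx).trans ?_) (norm_nonneg _) (by positivity)
      gcongr
  rw [heq, ← integral_Icc_eq_intervalIntegral]
  have hfin : volume (Metric.closedBall x₁ ρ) ≠ ⊤ := measure_closedBall_lt_top.ne
  have hind : Integrable ((Metric.closedBall x₁ ρ).indicator fun _ => C) volume :=
    (integrable_indicator_iff Metric.isClosed_closedBall.measurableSet).2
      (integrableOn_const hfin)
  calc |∫ x in Set.Icc (0 : ℝ) 1, W.mother j k x * (f x - q.eval x)|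
      ≤ ∫ x in Set.Icc (0 : ℝ) 1, (Metric.closedBall x₁ ρ).indicator (fun _ => C) x := by
        rw [← Real.norm_eq_abs]
        refine norm_integral_le_of_norm_le hind.integrableOn ?_
        exact (ae_restrict_mem measurableSet_Icc).mono fun x hx => hbound x hx
    _ ≤ ∫ x, (Metric.closedBall x₁ ρ).indicator (fun _ => C) x :=
        setIntegral_le_integral hind
          (ae_of_all _ fun x => Set.indicator_nonneg (fun _ _ => hC0) _)
    _ = 2 * ρ * C := by
        rw [integral_indicator Metric.isClosed_closedBall.measurableSet, setIntegral_const,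
          Measure.real, Real.volume_closedBall, ENNReal.toReal_ofReal (by positivity), smul_eq_mul]
    _ = _ := by
        rw [hC, hρ, Real.div_rpow (by positivity) h2j.le, Real.sqrt_eq_rpow,
          neg_add, Real.rpow_add h2j, Real.rpow_neg h2j.le α,
          show (-(1 / 2) : ℝ) = 1 / 2 - 1 by norm_num, Real.rpow_sub h2j, Real.rpow_one]
        field_simp
        ring

end IntervalWavelets

end

/-! ### Uniform convergence of the wavelet series -/

noncomputable section

theorem two_pow_rpow (j : ℕ) (a : ℝ) : ((2 : ℝ) ^ j) ^ a = ((2 : ℝ) ^ a) ^ j := by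
  rw [← Real.rpow_natCast, ← Real.rpow_mul zero_le_two, mul_comm, Real.rpow_mul zero_le_two,
    Real.rpow_natCast]

namespace IntervalWavelets

variable {W : IntervalWavelets} {r : ℕ} {A α M : ℝ} {f : ℝ → ℝ}

/-- The indices at level `j` whose functions may be nonzero at `x`. -/
def nearIndex (A : ℝ) (j : ℕ) (x : ℝ) : Finset ℕ :=
  (Finset.Icc 1 (2 ^ j)).filter fun k => |2 ^ j * x - k| ≤ A

theorem nearIndex_subset (A : ℝ) (j : ℕ) (x : ℝ) : nearIndex A j x ⊆ Finset.Icc 1 (2 ^ j) :=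
  Finset.filter_subset _ _

theorem card_nearIndex_le (hA : 0 ≤ A) (j : ℕ) (x : ℝ) :
    ((nearIndex A j x).card : ℝ) ≤ 2 * A + 1 :=
  card_near_le hA (2 ^ j * x) _ fun _ hk => (Finset.mem_filter.1 hk).2

theorem IsLocalized.sum_eq_sum_nearIndex (hA : W.IsLocalized A) (c : ℕ → ℝ) (j : ℕ) (x : ℝ) :
    ∑ k ∈ Finset.Icc 1 (2 ^ j), c k * W.mother j k x
      = ∑ k ∈ nearIndex A j x, c k * W.mother j k x := by
  refine (Finset.sum_subset (nearIndex_subset A j x) fun k hk hk' => ?_).symm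
  by_contra hne
  exact hk' (Finset.mem_filter.2 ⟨hk, hA.near j k hk x (right_ne_zero_of_mul hne)⟩)

/-- The part of the wavelet series of `f` at level `j`. -/
def levelSum (W : IntervalWavelets) (f : ℝ → ℝ) (j : ℕ) (x : ℝ) : ℝ :=
  ∑ k ∈ Finset.Icc 1 (2 ^ j), W.coef f (.inr ⟨j, k⟩) * W.mother j k x

/-- The partial sum of the wavelet series of `f` over the levels below `J`. -/
def partialSum (W : IntervalWavelets) (f : ℝ → ℝ) (J : ℕ) (x : ℝ) : ℝ :=
  ∑ p ∈ W.basisIndex J, W.coef f p * W.basisFun p x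

theorem sum_basisIndex (W : IntervalWavelets) (J : ℕ) (c : ℕ ⊕ (Σ _ : ℕ, ℕ) → ℝ) :
    ∑ p ∈ W.basisIndex J, c p = ∑ k ∈ Finset.Icc 1 (2 ^ W.j₀), c (.inl k)
      + ∑ j ∈ Finset.Ico W.j₀ J, ∑ k ∈ Finset.Icc 1 (2 ^ j), c (.inr ⟨j, k⟩) := by
  rw [basisIndex, Finset.sum_disjSum, Finset.sum_sigma]

theorem partialSum_eq (W : IntervalWavelets) (f : ℝ → ℝ) (J : ℕ) (x : ℝ) :
    W.partialSum f J x = ∑ k ∈ Finset.Icc 1 (2 ^ W.j₀), W.coef f (.inl k) * W.father k x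
      + ∑ j ∈ Finset.Ico W.j₀ J, W.levelSum f j x :=
  W.sum_basisIndex J _

theorem IsRegular.abs_levelSum_le (hWr : W.IsRegular r) (hA : W.IsLocalized A)
    (hα : 0 < α) (hαr : α < r) (hM : 0 < M) (hf : f ∈ holderClass α M) {j : ℕ}
    (hj : W.j₀ ≤ j) (x : ℝ) :
    |W.levelSum f j x| ≤
      (2 * A + 1) * (4 * A ^ 2 * M * (2 * A) ^ α) * A * ((2 : ℝ) ^ (-α)) ^ j := by
  have hA0 : 0 < A := by linarith [hA.one_le]
  rw [levelSum, hA.sum_eq_sum_nearIndex (fun k => W.coef f (.inr ⟨j, k⟩))]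
  refine (Finset.abs_sum_le_sum_abs _ _).trans ?_
  have hterm : ∀ k ∈ nearIndex A j x, |W.coef f (.inr ⟨j, k⟩) * W.mother j k x|
      ≤ (4 * A ^ 2 * M * (2 * A) ^ α) * A * ((2 : ℝ) ^ (-α)) ^ j := by
    intro k hk
    have hk' := nearIndex_subset A j x hk
    rw [abs_mul]
    refine (mul_le_mul (hWr.abs_coef_le hA hα hαr hM hf hj hk') (hA.bound j k hk' x)
      (abs_nonneg _) (by positivity)).trans (le_of_eq ?_)
    have h2j : (0 : ℝ) < 2 ^ j := by positivity
    rw [← two_pow_rpow, Real.sqrt_eq_rpow, neg_add, Real.rpow_add h2j, Real.rpow_neg h2j.le (1 / 2)]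
    field_simp
  refine (Finset.sum_le_sum hterm).trans ?_
  rw [Finset.sum_const, nsmul_eq_mul]
  have := card_nearIndex_le hA0.le j x
  calc ((nearIndex A j x).card : ℝ) * ((4 * A ^ 2 * M * (2 * A) ^ α) * A * ((2 : ℝ) ^ (-α)) ^ j)
      ≤ (2 * A + 1) * ((4 * A ^ 2 * M * (2 * A) ^ α) * A * ((2 : ℝ) ^ (-α)) ^ j) := by gcongr
    _ = _ := by ring

theorem basisIndex_mono {J J' : ℕ} (h : J ≤ J') : W.basisIndex J ⊆ W.basisIndex J' := by
  refine Finset.disjSum_mono subset_rfl (Finset.sigma_mono ?_ fun _ => subset_rfl)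
  exact Finset.Ico_subset_Ico_right h

theorem IsRegular.continuous_levelSum (hWr : W.IsRegular r) (hr : 1 ≤ r) (f : ℝ → ℝ) (j : ℕ) :
    Continuous (W.levelSum f j) :=
  continuous_finsetSum _ fun _ hk => continuous_const.mul (hWr.contDiff_mother hr hk).continuous

theorem IsRegular.continuous_partialSum (hWr : W.IsRegular r) (hr : 1 ≤ r) (f : ℝ → ℝ) (J : ℕ) :
    Continuous (W.partialSum f J) :=
  continuous_finsetSum _ fun _ hp => continuous_const.mul (hWr.contDiff_basisFun hr hp).continuous

/-- The wavelet series of a Hölder function converges to it uniformly on `[0, 1]`, at the rate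
`2 ^ (-Jα)`. The series converges uniformly by the decay of the coefficients; its sum has the same
coefficients as `f`, hence equals `f` by completeness and continuity. -/
theorem IsWaveletBasis.abs_sub_partialSum_le (hW : W.IsWaveletBasis) (hWr : W.IsRegular r)
    (hA : W.IsLocalized A) (hα : 0 < α) (hαr : α < r) (hM : 0 < M) (hf : f ∈ holderClass α M)
    {J : ℕ} (hJ : W.j₀ ≤ J) {x : ℝ} (hx : x ∈ Set.Icc (0 : ℝ) 1) :
    |f x - W.partialSum f J x| ≤
      (2 * A + 1) * (4 * A ^ 2 * M * (2 * A) ^ α) * A / (1 - (2 : ℝ) ^ (-α))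
        * ((2 : ℝ) ^ (-α)) ^ J := by
  have hr : 1 ≤ r := by
    have : (0 : ℝ) < r := hα.trans hαr
    exact_mod_cast this
  have hA0 : 0 < A := by linarith [hA.one_le]
  set q : ℝ := (2 : ℝ) ^ (-α) with hq
  have hq0 : 0 < q := by positivity
  have hq1 : q < 1 := Real.rpow_lt_one_of_one_lt_of_neg one_lt_two (by linarith)
  set D : ℝ := (2 * A + 1) * (4 * A ^ 2 * M * (2 * A) ^ α) * A with hD
  have hD0 : 0 ≤ D := by positivity
  have hlev : ∀ {j : ℕ}, W.j₀ ≤ j → ∀ x, ‖W.levelSum f j x‖ ≤ D * q ^ j := fun hj x =>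
    hWr.abs_levelSum_le hA hα hαr hM hf hj x
  have hgeo : ∀ J : ℕ, HasSum (fun i : ℕ => D * q ^ (i + J)) (D / (1 - q) * q ^ J) := fun J => by
    have := ((hasSum_geometric_of_lt_one hq0.le hq1).mul_right (q ^ J)).mul_left D
    simp_rw [← pow_add] at this
    rwa [div_eq_mul_inv, mul_assoc]
  have hsum : ∀ x, Summable fun i => W.levelSum f (i + W.j₀) x := fun x =>
    Summable.of_norm_bounded (hgeo W.j₀).summable fun i => hlev (by omega) x
  set G : ℝ → ℝ := fun x => ∑ k ∈ Finset.Icc 1 (2 ^ W.j₀), W.coef f (.inl k) * W.father k x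
      + ∑' i, W.levelSum f (i + W.j₀) x with hG
  have hGc : Continuous G := by
    refine Continuous.add (continuous_finsetSum _ fun k hk =>
      continuous_const.mul (hWr.contDiff_father hk).continuous) ?_
    exact continuous_tsum (fun i => hWr.continuous_levelSum hr f _) (hgeo W.j₀).summable
      fun i x => hlev (by omega) x
  have htail : ∀ J, W.j₀ ≤ J → ∀ x, |G x - W.partialSum f J x| ≤ D / (1 - q) * q ^ J := by
    intro J hJ x
    have h1 := (hsum x).sum_add_tsum_nat_add (J - W.j₀)
    have h2 : ∑ j ∈ Finset.Ico W.j₀ J, W.levelSum f j x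
        = ∑ i ∈ Finset.range (J - W.j₀), W.levelSum f (i + W.j₀) x := by
      rw [Finset.sum_Ico_eq_sum_range]
      exact Finset.sum_congr rfl fun i _ => by rw [add_comm]
    have h3 : G x - W.partialSum f J x = ∑' i, W.levelSum f (i + (J - W.j₀) + W.j₀) x := by
      rw [hG, partialSum_eq, h2]
      simp only
      rw [← h1]; ring
    rw [h3, ← Real.norm_eq_abs]
    refine tsum_of_norm_bounded (hgeo J) fun i => ?_
    have := hlev (j := i + (J - W.j₀) + W.j₀) (by omega) x
    rwa [show i + (J - W.j₀) + W.j₀ = i + J by omega] at this ⊢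
  have hfc := continuousOn_of_mem_holderClass hf
  have hII : ∀ {h : ℝ → ℝ}, ContinuousOn h (Set.Icc 0 1) → IntervalIntegrable h volume 0 1 :=
    fun hh => ContinuousOn.intervalIntegrable (by rwa [Set.uIcc_of_le zero_le_one])
  -- `f` and the sum `G` of the series have the same coefficients
  have horth : ∀ J₀, W.j₀ ≤ J₀ → ∀ p ∈ W.basisIndex J₀,
      ∫ x in (0 : ℝ)..1, (f x - G x) * W.basisFun p x = 0 := by
    intro J₀ hJ₀ p hp
    have hpc := (hWr.contDiff_basisFun hr hp).continuous
    obtain ⟨b, hb⟩ := (isCompact_Icc (a := (0 : ℝ)) (b := 1)).exists_bound_of_continuousOn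
      hpc.continuousOn
    have hb0 : 0 ≤ b := (norm_nonneg _).trans (hb 0 (by simp))
    have hle : ∀ J, J₀ ≤ J → |∫ x in (0 : ℝ)..1, (f x - G x) * W.basisFun p x|
        ≤ D / (1 - q) * q ^ J * b := by
      intro J hJ
      have hpJ : p ∈ W.basisIndex J := basisIndex_mono hJ hp
      have hSc := hWr.continuous_partialSum hr f J
      have h1 : ∫ x in (0 : ℝ)..1, W.basisFun p x * W.partialSum f J x = W.coef f p :=
        integral_mul_sum_of_orthonormal
          (fun i hi => (hWr.contDiff_basisFun hr hi).continuous)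
          (fun i hi k hk => hW.orthonormal_basisFun hi hk) _ hpJ
      have h2 : ∫ x in (0 : ℝ)..1, (f x - G x) * W.basisFun p x
          = ∫ x in (0 : ℝ)..1, (W.partialSum f J x - G x) * W.basisFun p x := by
        have h3 : ∫ x in (0 : ℝ)..1, (W.basisFun p x * f x - W.basisFun p x * W.partialSum f J x)
            = 0 := by
          rw [intervalIntegral.integral_sub (f := fun x => W.basisFun p x * f x)
            (g := fun x => W.basisFun p x * W.partialSum f J x) (hII (hpc.continuousOn.mul hfc))
            ((hpc.mul hSc).intervalIntegrable _ _), h1, coef, sub_self]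
        rw [← sub_eq_zero, ← intervalIntegral.integral_sub
          (f := fun x => (f x - G x) * W.basisFun p x)
          (g := fun x => (W.partialSum f J x - G x) * W.basisFun p x)
          (hII ((hfc.sub hGc.continuousOn).mul hpc.continuousOn))
          (((hSc.sub hGc).mul hpc).intervalIntegrable _ _)]
        refine (intervalIntegral.integral_congr fun x _ => ?_).trans h3
        ring
      rw [h2]
      have h4 := intervalIntegral.norm_integral_le_of_norm_le_const (E := ℝ) (a := 0) (b := 1)
        (f := fun x => (W.partialSum f J x - G x) * W.basisFun p x)
        (C := D / (1 - q) * q ^ J * b) ?_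
      · simpa using h4
      · intro x hx
        rw [Set.uIoc_of_le zero_le_one] at hx
        rw [norm_mul, norm_sub_rev]
        have h5 := htail J (hJ₀.trans hJ) x
        exact mul_le_mul h5 (hb x ⟨hx.1.le, hx.2⟩) (norm_nonneg _) ((abs_nonneg _).trans h5)
    have hlim : Tendsto (fun J => D / (1 - q) * q ^ J * b) atTop (nhds 0) := by
      have := ((tendsto_pow_atTop_nhds_zero_of_lt_one hq0.le hq1).const_mul
        (D / (1 - q))).mul_const b
      simpa using this
    have := ge_of_tendsto hlim ((eventually_ge_atTop J₀).mono hle)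
    exact abs_eq_zero.1 (le_antisymm this (abs_nonneg _))
  have hfG : ContinuousOn (fun x => f x - G x) (Set.Icc 0 1) := hfc.sub hGc.continuousOn
  have hmem : MemLp (fun x => f x - G x) 2 (volume.restrict (Set.Icc 0 1)) := by
    obtain ⟨b, hb⟩ := (isCompact_Icc (a := (0 : ℝ)) (b := 1)).exists_bound_of_continuousOn hfG
    exact MemLp.of_bound (hfG.aestronglyMeasurable measurableSet_Icc) b
      ((ae_restrict_mem measurableSet_Icc).mono hb)
  have hae : (fun x => f x - G x) =ᵐ[volume.restrict (Set.Icc 0 1)] 0 := by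
    refine hW.complete _ hmem (fun k hk => ?_) (fun j hj k hk => ?_)
    · rw [integral_Icc_eq_intervalIntegral]
      exact horth W.j₀ le_rfl (.inl k) (by simpa [basisIndex] using hk)
    · rw [integral_Icc_eq_intervalIntegral]
      refine horth (j + 1) (by omega) (.inr ⟨j, k⟩) ?_
      simpa [basisIndex, hj] using hk
  have heq := Measure.eqOn_Icc_of_ae_eq volume zero_ne_one hae hfG continuousOn_const hx
  have : f x = G x := by
    have h : f x - G x = 0 := heq
    linarith
  rw [this]
  exact htail J hJ x

end IntervalWavelets

end

/-! ### Risk bounds for single coefficients and blocks -/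

noncomputable section

open ProbabilityTheory

variable {Ω : Type*} [MeasurableSpace Ω] {P : Measure Ω} {B : ℝ≥0 → Ω → ℝ}
  {W : IntervalWavelets} {r : ℕ} {f : ℝ → ℝ}

/-- The error of BlockJS in the wavelet coefficient with index `(j, k)`. -/
def coefErr (B : ℝ≥0 → Ω → ℝ) (W : IntervalWavelets) (lam : ℝ) (L n : ℕ) (f : ℝ → ℝ) (j k : ℕ)
    (ω : Ω) : ℝ :=
  blockJSCoeff W lam L n (observedPath n f fun t => B t ω) j k - W.coef f (.inr ⟨j, k⟩)

theorem IntervalWavelets.IsWaveletBasis.orthonormal_mother_level (hW : W.IsWaveletBasis) {j : ℕ}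
    (hj : W.j₀ ≤ j) {i k : ℕ} (hi : i ∈ Finset.Icc 1 (2 ^ j)) (hk : k ∈ Finset.Icc 1 (2 ^ j)) :
    ∫ x in (0 : ℝ)..1, W.mother j i x * W.mother j k x = if i = k then 1 else 0 := by
  rw [← integral_Icc_eq_intervalIntegral, hW.orthonormal_mother j j hj hj i hi k hk]
  simp

theorem aemeasurable_coefErr (hB : IsBrownianReal B P) (hWr : W.IsRegular r) (hr : 1 ≤ r)
    (hf : ContinuousOn f (Set.Icc 0 1)) (lam : ℝ) (L n : ℕ) {j k : ℕ}
    (hk : k ∈ Finset.Icc 1 (2 ^ j)) : AEMeasurable (coefErr B W lam L n f j k) P := by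
  have hm : ∀ i ∈ Finset.Icc 1 (2 ^ j), AEMeasurable
      (fun ω => pathIntegral (W.mother j i) (observedPath n f fun t => B t ω)) P := fun i hi =>
    aemeasurable_pathIntegral_observedPath hB (hWr.contDiff_mother hr hi) hf n
  have hQ : AEMeasurable (fun ω => ∑ i ∈ jsBlock L j (jsBlockIndex L k),
      pathIntegral (W.mother j i) (observedPath n f fun t => B t ω) ^ 2) P :=
    Finset.aemeasurable_fun_sum _ fun i hi => (hm i (jsBlock_subset _ _ _ hi)).pow_const 2
  exact ((aemeasurable_const.max ((aemeasurable_const.div hQ).const_sub 1)).mul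
    (hm k hk)).sub_const _

variable {lam : ℝ} {L n : ℕ}

/-- The risk over a block is at most of the order of the threshold. -/
theorem lintegral_sum_sq_coefErr_le (hB : IsBrownianReal B P) (hW : W.IsWaveletBasis)
    (hWr : W.IsRegular r) (hr : 1 ≤ r) (hf : ContinuousOn f (Set.Icc 0 1))
    (hlam : 0 ≤ lam) {j : ℕ} (hj : W.j₀ ≤ j) (b : ℕ) :
    ∫⁻ ω, ENNReal.ofReal (∑ k ∈ jsBlock L j b, coefErr B W lam L n f j k ω ^ 2) ∂P
      ≤ ENNReal.ofReal (2 * (lam + 1) * (L / n)) := by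
  have hP := IsBrownianReal.isProbabilityMeasure hB
  set S := jsBlock L j b with hS
  set y : ℕ → Ω → ℝ := fun k ω => pathIntegral (W.mother j k) (observedPath n f fun t => B t ω)
    with hy
  set θ : ℕ → ℝ := fun k => W.coef f (.inr ⟨j, k⟩) with hθ
  have hT : 0 ≤ lam * L * (n : ℝ)⁻¹ := by positivity
  have hsub : ∀ k ∈ S, k ∈ Finset.Icc 1 (2 ^ j) := fun k hk => jsBlock_subset _ _ _ hk
  calc _ ≤ ∫⁻ ω, (ENNReal.ofReal (2 * (lam * L * (n : ℝ)⁻¹))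
        + ENNReal.ofReal (∑ k ∈ S, 2 * (y k ω - θ k) ^ 2)) ∂P := by
        refine lintegral_mono fun ω => ?_
        rw [← ENNReal.ofReal_add (by positivity)
          (Finset.sum_nonneg fun k _ => by positivity)]
        refine ENNReal.ofReal_le_ofReal ?_
        have h := sum_sq_shrink_sub_le (S := S) (y := fun k => y k ω) (θ := θ) hT
        rw [← Finset.mul_sum]
        refine le_trans (le_of_eq (Finset.sum_congr rfl fun k hk => ?_)) h
        rw [coefErr, blockJSCoeff, jsBlockIndex_eq_of_mem hk]
    _ ≤ ENNReal.ofReal (2 * (lam * L * (n : ℝ)⁻¹)) + ENNReal.ofReal (∑ k ∈ S, 2 * (1 / n)) := by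
        rw [lintegral_add_left measurable_const, lintegral_const, measure_univ, mul_one]
        gcongr
        refine lintegral_ofReal_sum_le (fun _ _ => by norm_num) (fun _ _ => by positivity)
          (fun k hk => ?_) (fun _ _ _ => sq_nonneg _) fun k hk => ?_
        · exact ((aemeasurable_pathIntegral_observedPath hB
            (hWr.contDiff_mother hr (hsub k hk)) hf n).sub_const _).pow_const 2
        · refine (lintegral_sq_noise hB (hWr.contDiff_mother hr (hsub k hk)) ?_ hf n).le
          rw [hW.orthonormal_mother_level hj (hsub k hk) (hsub k hk), if_pos rfl]
    _ ≤ _ := by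
        rw [← ENNReal.ofReal_add (by positivity)
          (Finset.sum_nonneg fun k _ => by positivity)]
        refine ENNReal.ofReal_le_ofReal ?_
        rw [Finset.sum_const, nsmul_eq_mul]
        have h1 : (S.card : ℝ) ≤ L := by exact_mod_cast card_jsBlock_le L j b
        have h2 : (S.card : ℝ) * (2 * (1 / n)) ≤ L * (2 * (1 / n)) := by gcongr
        refine (add_le_add_right h2 _).trans (le_of_eq ?_)
        rw [← one_div]; ring

/-- The risk of a single coefficient is at most the signal plus the noise. -/
theorem lintegral_sq_coefErr_le (hB : IsBrownianReal B P) (hW : W.IsWaveletBasis)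
    (hWr : W.IsRegular r) (hr : 1 ≤ r) (hf : ContinuousOn f (Set.Icc 0 1))
    (hlam : 0 ≤ lam) {j : ℕ} (hj : W.j₀ ≤ j) {k : ℕ} (hk : k ∈ Finset.Icc 1 (2 ^ j)) :
    ∫⁻ ω, ENNReal.ofReal (coefErr B W lam L n f j k ω ^ 2) ∂P
      ≤ ENNReal.ofReal (W.coef f (.inr ⟨j, k⟩) ^ 2 + 1 / n) := by
  have hP := IsBrownianReal.isProbabilityMeasure hB
  calc _ ≤ ∫⁻ ω, (ENNReal.ofReal (W.coef f (.inr ⟨j, k⟩) ^ 2)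
        + ENNReal.ofReal ((pathIntegral (W.mother j k) (observedPath n f fun t => B t ω)
            - W.coef f (.inr ⟨j, k⟩)) ^ 2)) ∂P := by
        refine lintegral_mono fun ω => ?_
        rw [← ENNReal.ofReal_add (sq_nonneg _) (sq_nonneg _)]
        refine ENNReal.ofReal_le_ofReal ?_
        rw [coefErr, blockJSCoeff]
        exact sq_shrink_sub_le (shrink_mem_Icc (by positivity)
          (Finset.sum_nonneg fun i _ => sq_nonneg _))
    _ = _ := by
        rw [lintegral_add_left measurable_const, lintegral_const, measure_univ, mul_one,
          ENNReal.ofReal_add (sq_nonneg _) (by positivity)]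
        congr 1
        refine lintegral_sq_noise hB (hWr.contDiff_mother hr hk) ?_ hf n
        rw [hW.orthonormal_mother_level hj hk hk, if_pos rfl]

/-- The risk of a single coefficient in a block with small signal energy: the noise enters only
through a large deviation of the noise energy of the block. -/
theorem lintegral_sq_coefErr_le_of_small (hB : IsBrownianReal B P) (hW : W.IsWaveletBasis)
    (hWr : W.IsRegular r) (hr : 1 ≤ r) (hf : ContinuousOn f (Set.Icc 0 1))
    (hlam_one : 1 < lam) (hlam : lam - Real.log lam - 1 = 2) (hn : 1 ≤ n) (hL1 : 1 ≤ L)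
    {δ : ℝ} (hδ0 : 0 < δ) (hδ1 : δ < 1) (hL : 1 ≤ L * (1 - δ) ^ 2)
    {j : ℕ} (hj : W.j₀ ≤ j) {k : ℕ} (hk : k ∈ Finset.Icc 1 (2 ^ j))
    (hθ : ∑ i ∈ jsBlock L j (jsBlockIndex L k), W.coef f (.inr ⟨j, i⟩) ^ 2
      ≤ δ ^ 2 * (lam * L * (n : ℝ)⁻¹)) :
    ∫⁻ ω, ENNReal.ofReal (coefErr B W lam L n f j k ω ^ 2) ∂P
      ≤ ENNReal.ofReal (W.coef f (.inr ⟨j, k⟩) ^ 2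
        + lam * (L / n) * Real.exp (-(1 - (lam - 1) * δ) * L)) := by
  have hP := IsBrownianReal.isProbabilityMeasure hB
  have hn0 : (0 : ℝ) < n := by exact_mod_cast hn
  set S := jsBlock L j (jsBlockIndex L k) with hS
  have hsub : ∀ k ∈ S, k ∈ Finset.Icc 1 (2 ^ j) := fun k hk => jsBlock_subset _ _ _ hk
  set Q : Ω → ℝ := fun ω => ∑ i ∈ S, wienerIntegral B (W.mother j i) ω ^ 2 with hQ
  have hT : 0 ≤ lam * L * (n : ℝ)⁻¹ := by positivity
  have hy : ∀ᵐ ω ∂P, ∀ i ∈ S, pathIntegral (W.mother j i) (observedPath n f fun t => B t ω)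
      - W.coef f (.inr ⟨j, i⟩) = (√n)⁻¹ * wienerIntegral B (W.mother j i) ω := by
    refine (ae_ball_iff S.countable_toSet).2 fun i hi => ?_
    filter_upwards [ae_pathIntegral_observedPath hB (hWr.contDiff_mother hr (hsub i hi)) hf n]
      with ω hω
    rw [hω]
    simp [IntervalWavelets.coef, IntervalWavelets.basisFun]
  calc _ ≤ ∫⁻ ω, (ENNReal.ofReal (W.coef f (.inr ⟨j, k⟩) ^ 2) + ENNReal.ofReal (1 / n) *
        ENNReal.ofReal (if (1 - δ) ^ 2 * (lam * L) < Q ω then Q ω else 0)) ∂P := by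
        refine lintegral_mono_ae ?_
        filter_upwards [hy] with ω hω
        have hQ0 : 0 ≤ Q ω := Finset.sum_nonneg fun i _ => sq_nonneg _
        rw [← ENNReal.ofReal_mul (by positivity), ← ENNReal.ofReal_add (sq_nonneg _)
          (mul_nonneg (by positivity) (by split_ifs; exacts [hQ0, le_rfl]))]
        refine ENNReal.ofReal_le_ofReal ?_
        have h := sq_shrink_sub_le_of_small
          (y := fun i => pathIntegral (W.mother j i) (observedPath n f fun t => B t ω))
          (θ := fun i => W.coef f (.inr ⟨j, i⟩)) hT hδ0 hδ1 hθ (mem_jsBlock_jsBlockIndex hL1 hk)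
        have hsum : ∑ i ∈ S, (pathIntegral (W.mother j i) (observedPath n f fun t => B t ω)
            - W.coef f (.inr ⟨j, i⟩)) ^ 2 = 1 / n * Q ω := by
          rw [hQ, Finset.mul_sum]
          refine Finset.sum_congr rfl fun i hi => ?_
          rw [hω i hi, mul_pow, inv_pow, Real.sq_sqrt hn0.le, one_div]
        rw [hsum] at h
        rw [coefErr, blockJSCoeff]
        refine h.trans (le_of_eq ?_)
        have hiff : (1 - δ) ^ 2 * (lam * L * (n : ℝ)⁻¹) < 1 / n * Q ω
            ↔ (1 - δ) ^ 2 * (lam * L) < Q ω := by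
          rw [show (1 - δ) ^ 2 * (lam * L * (n : ℝ)⁻¹) = 1 / n * ((1 - δ) ^ 2 * (lam * L)) by
            rw [one_div]; ring]
          exact mul_lt_mul_iff_right₀ (by positivity)
        by_cases hc : (1 - δ) ^ 2 * (lam * L) < Q ω
        · rw [if_pos hc, if_pos (hiff.2 hc)]
        · rw [if_neg hc, if_neg (mt hiff.1 hc), mul_zero]
    _ ≤ ENNReal.ofReal (W.coef f (.inr ⟨j, k⟩) ^ 2) + ENNReal.ofReal (1 / n) *
          ENNReal.ofReal (((1 - δ) ^ 2 * (lam * L)) * Real.exp (-(1 - (lam - 1) * δ) * L)) := by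
        rw [lintegral_add_left measurable_const, lintegral_const, measure_univ, mul_one,
          lintegral_const_mul' _ _ ENNReal.ofReal_ne_top]
        gcongr
        exact lintegral_truncated_sum_sq_le hB (fun i hi => hWr.contDiff_mother hr (hsub i hi))
          (fun i hi k hk => hW.orthonormal_mother_level hj (hsub i hi) (hsub k hk)) hlam_one hlam
          (card_jsBlock_le _ _ _) hL
    _ ≤ _ := by
        rw [← ENNReal.ofReal_mul (by positivity), ← ENNReal.ofReal_add (sq_nonneg _)
          (by positivity)]
        refine ENNReal.ofReal_le_ofReal (add_le_add_right ?_ _)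
        have h1 : (1 - δ) ^ 2 ≤ 1 := by nlinarith
        calc 1 / (n : ℝ) * ((1 - δ) ^ 2 * (lam * L) * Real.exp (-(1 - (lam - 1) * δ) * L))
            = (1 - δ) ^ 2 * (lam * (L / n) * Real.exp (-(1 - (lam - 1) * δ) * L)) := by ring
          _ ≤ 1 * (lam * (L / n) * Real.exp (-(1 - (lam - 1) * δ) * L)) := by gcongr
          _ = _ := one_mul _

end

/-! ### The estimation error at a point -/

noncomputable section

open ProbabilityTheory

/-- The error of BlockJS at level `j`. -/
def levelErr {Ω : Type*} (B : ℝ≥0 → Ω → ℝ) (W : IntervalWavelets) (lam : ℝ) (L n : ℕ)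
    (f : ℝ → ℝ) (j : ℕ) (x : ℝ) (ω : Ω) : ℝ :=
  ∑ k ∈ Finset.Icc 1 (2 ^ j), coefErr B W lam L n f j k ω * W.mother j k x

/-- The error of BlockJS in the coarse part of the series. -/
def coarseErr {Ω : Type*} (B : ℝ≥0 → Ω → ℝ) (W : IntervalWavelets) (n : ℕ) (f : ℝ → ℝ)
    (x : ℝ) (ω : Ω) : ℝ :=
  ∑ k ∈ Finset.Icc 1 (2 ^ W.j₀), (pathIntegral (W.father k) (observedPath n f fun t => B t ω)
    - W.coef f (.inl k)) * W.father k x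

/-- The estimation error is the sum of the errors in the coarse part and at the single levels, minus
the tail of the wavelet series. -/
theorem blockJS_sub_eq {Ω : Type*} {B : ℝ≥0 → Ω → ℝ} {W : IntervalWavelets} {f : ℝ → ℝ} {lam : ℝ}
    {L n : ℕ} (x : ℝ) (ω : Ω) :
    blockJS W lam L n (observedPath n f fun t => B t ω) x - f x
      = coarseErr B W n f x ω
        + ∑ j ∈ Finset.Ico W.j₀ (Nat.clog 2 n), levelErr B W lam L n f j x ω
        - (f x - W.partialSum f (Nat.clog 2 n) x) := by
  simp only [blockJS, coarseErr, levelErr, coefErr, IntervalWavelets.partialSum_eq,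
    IntervalWavelets.levelSum, sub_mul, Finset.sum_sub_distrib]
  ring

variable {Ω : Type*} [MeasurableSpace Ω] {P : Measure Ω} {B : ℝ≥0 → Ω → ℝ}
  {W : IntervalWavelets} {r : ℕ} {f : ℝ → ℝ} {A : ℝ} {lam : ℝ} {L n : ℕ}

/-- Minkowski's inequality for the `L²` norm of a finite sum of random variables. -/
theorem lintegral_sq_sum_le {ι : Type*} {s : Finset ι} {e : ι → Ω → ℝ} {w : ι → ℝ}
    (hw : ∀ i ∈ s, 0 < w i) (he : ∀ i ∈ s, AEMeasurable (e i) P)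
    (h : ∀ i ∈ s, ∫⁻ ω, ENNReal.ofReal (e i ω ^ 2) ∂P ≤ ENNReal.ofReal (w i ^ 2)) :
    ∫⁻ ω, ENNReal.ofReal ((∑ i ∈ s, e i ω) ^ 2) ∂P ≤ ENNReal.ofReal ((∑ i ∈ s, w i) ^ 2) := by
  have hW0 : 0 ≤ ∑ i ∈ s, w i := Finset.sum_nonneg fun i hi => (hw i hi).le
  -- the Cauchy–Schwarz inequality with the weights `w`
  calc _ ≤ ∫⁻ ω, ENNReal.ofReal (∑ i ∈ s, ((∑ i ∈ s, w i) / w i) * e i ω ^ 2) ∂P := by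
        refine lintegral_mono fun ω => ENNReal.ofReal_le_ofReal ?_
        refine (Finset.sum_sq_le_sum_mul_sum_of_sq_le_mul s (f := w)
          (g := fun i => e i ω ^ 2 / w i) (fun i hi => (hw i hi).le)
          (fun i hi => div_nonneg (sq_nonneg _) (hw i hi).le) fun i hi => ?_).trans (le_of_eq ?_)
        · have := (hw i hi).ne'
          refine le_of_eq ?_
          field_simp
        · rw [Finset.mul_sum]
          exact Finset.sum_congr rfl fun i hi => by ring
    _ ≤ ENNReal.ofReal (∑ i ∈ s, ((∑ i ∈ s, w i) / w i) * w i ^ 2) :=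
        lintegral_ofReal_sum_le (fun i hi => div_nonneg hW0 (hw i hi).le)
          (fun i _ => sq_nonneg _) (fun i hi => (he i hi).pow_const 2)
          (fun i _ ω => sq_nonneg _) h
    _ = _ := by
        congr 1
        rw [sq, Finset.mul_sum]
        refine Finset.sum_congr rfl fun i hi => ?_
        have := (hw i hi).ne'
        field_simp

theorem aemeasurable_levelErr (hB : IsBrownianReal B P) (hWr : W.IsRegular r) (hr : 1 ≤ r)
    (hf : ContinuousOn f (Set.Icc 0 1)) (lam : ℝ) (L n j : ℕ) (x : ℝ) :
    AEMeasurable (levelErr B W lam L n f j x) P :=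
  Finset.aemeasurable_fun_sum _ fun _ hk =>
    (aemeasurable_coefErr hB hWr hr hf lam L n hk).mul_const _

theorem aemeasurable_coarseErr (hB : IsBrownianReal B P) (hWr : W.IsRegular r)
    (hf : ContinuousOn f (Set.Icc 0 1)) (n : ℕ) (x : ℝ) :
    AEMeasurable (coarseErr B W n f x) P :=
  Finset.aemeasurable_fun_sum _ fun _ hk =>
    ((aemeasurable_pathIntegral_observedPath hB (hWr.contDiff_father hk) hf n).sub_const
      _).mul_const _

/-- Only a bounded number of functions of a level overlap at a point, so the error of the level is
controlled by the errors of single coefficients. -/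
theorem lintegral_sq_levelErr_le (hB : IsBrownianReal B P)
    (hWr : W.IsRegular r) (hr : 1 ≤ r) (hA : W.IsLocalized A) (hf : ContinuousOn f (Set.Icc 0 1))
    {j : ℕ} {s : ℝ} (hs : 0 ≤ s)
    (h : ∀ k ∈ Finset.Icc 1 (2 ^ j),
      ∫⁻ ω, ENNReal.ofReal (coefErr B W lam L n f j k ω ^ 2) ∂P ≤ ENNReal.ofReal s) (x : ℝ) :
    ∫⁻ ω, ENNReal.ofReal (levelErr B W lam L n f j x ω ^ 2) ∂P
      ≤ ENNReal.ofReal (((2 * A + 1) * A * √(2 ^ j * s)) ^ 2) := by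
  have hA0 : 0 < A := by linarith [hA.one_le]
  have hcard := IntervalWavelets.card_nearIndex_le hA0.le j x
  calc _ ≤ ∫⁻ ω, ENNReal.ofReal (∑ k ∈ IntervalWavelets.nearIndex A j x,
        ((2 * A + 1) * (A * √(2 ^ j)) ^ 2) * coefErr B W lam L n f j k ω ^ 2) ∂P := by
        refine lintegral_mono fun ω => ENNReal.ofReal_le_ofReal ?_
        rw [levelErr, hA.sum_eq_sum_nearIndex (fun k => coefErr B W lam L n f j k ω)]
        refine sq_sum_le_card_mul_sum_sq.trans ?_
        rw [← Finset.mul_sum, mul_assoc]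
        refine mul_le_mul hcard ?_ (Finset.sum_nonneg fun _ _ => sq_nonneg _) (by positivity)
        rw [Finset.mul_sum]
        refine Finset.sum_le_sum fun k hk => ?_
        rw [mul_pow, mul_comm]
        refine mul_le_mul_of_nonneg_right ?_ (sq_nonneg _)
        rw [← sq_abs (W.mother j k x)]
        have := hA.bound j k (IntervalWavelets.nearIndex_subset A j x hk) x
        gcongr
    _ ≤ ENNReal.ofReal (∑ k ∈ IntervalWavelets.nearIndex A j x,
        ((2 * A + 1) * (A * √(2 ^ j)) ^ 2) * s) :=
        lintegral_ofReal_sum_le (fun _ _ => by positivity) (fun _ _ => hs)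
          (fun k hk => (aemeasurable_coefErr hB hWr hr hf lam L n
            (IntervalWavelets.nearIndex_subset A j x hk)).pow_const 2)
          (fun _ _ _ => sq_nonneg _)
          (fun k hk => h k (IntervalWavelets.nearIndex_subset A j x hk))
    _ ≤ _ := by
        refine ENNReal.ofReal_le_ofReal ?_
        rw [Finset.sum_const, nsmul_eq_mul, mul_pow _ (√(2 ^ j * s)), Real.sq_sqrt (by positivity),
          mul_pow A, Real.sq_sqrt (by positivity)]
        calc _ ≤ (2 * A + 1) * ((2 * A + 1) * (A ^ 2 * 2 ^ j) * s) := by gcongr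
          _ = _ := by ring

theorem lintegral_sq_coarseErr_le (hB : IsBrownianReal B P) (hW : W.IsWaveletBasis)
    (hWr : W.IsRegular r) (hA : W.IsLocalized A) (hf : ContinuousOn f (Set.Icc 0 1)) (x : ℝ) :
    ∫⁻ ω, ENNReal.ofReal (coarseErr B W n f x ω ^ 2) ∂P
      ≤ ENNReal.ofReal ((2 ^ W.j₀ * A) ^ 2 * (1 / n)) := by
  have hA0 : 0 < A := by linarith [hA.one_le]
  set s := Finset.Icc 1 (2 ^ W.j₀) with hs
  have hcard : (s.card : ℝ) = 2 ^ W.j₀ := by simp [hs]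
  calc _ ≤ ∫⁻ ω, ENNReal.ofReal (∑ k ∈ s, (2 ^ W.j₀ * A ^ 2) *
        (pathIntegral (W.father k) (observedPath n f fun t => B t ω)
          - W.coef f (.inl k)) ^ 2) ∂P := by
        refine lintegral_mono fun ω => ENNReal.ofReal_le_ofReal ?_
        refine sq_sum_le_card_mul_sum_sq.trans ?_
        rw [hcard, ← Finset.mul_sum, mul_assoc]
        refine mul_le_mul_of_nonneg_left ?_ (by positivity)
        rw [Finset.mul_sum]
        refine Finset.sum_le_sum fun k hk => ?_
        rw [mul_pow, mul_comm]
        refine mul_le_mul_of_nonneg_right ?_ (sq_nonneg _)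
        rw [← sq_abs (W.father k x)]
        have := hA.bound_father k hk x
        gcongr
    _ ≤ ENNReal.ofReal (∑ k ∈ s, (2 ^ W.j₀ * A ^ 2) * (1 / n)) := by
        refine lintegral_ofReal_sum_le (fun _ _ => by positivity) (fun _ _ => by positivity)
          (fun k hk => ?_) (fun _ _ _ => sq_nonneg _) (fun k hk => ?_)
        · exact ((aemeasurable_pathIntegral_observedPath hB
            (hWr.contDiff_father hk) hf n).sub_const _).pow_const 2
        · refine (lintegral_sq_noise hB (hWr.contDiff_father hk) ?_ hf n).le
          rw [← integral_Icc_eq_intervalIntegral, hW.orthonormal_father k hk k hk, if_pos rfl]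
    _ = _ := by
        rw [Finset.sum_const, nsmul_eq_mul, hcard]
        congr 1; ring

/-- The mean squared error at a point of the part of the estimation error that comes from the
coarse coefficients, the levels in `S`, and a deterministic remainder. -/
theorem lintegral_sq_partialErr_le (hB : IsBrownianReal B P) (hW : W.IsWaveletBasis)
    (hWr : W.IsRegular r) (hr : 1 ≤ r) (hA : W.IsLocalized A) (hf : ContinuousOn f (Set.Icc 0 1))
    {S : Finset ℕ} {s : ℕ → ℝ} (hs : ∀ j ∈ S, 0 < s j)
    (h : ∀ j ∈ S, ∀ k ∈ Finset.Icc 1 (2 ^ j),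
      ∫⁻ ω, ENNReal.ofReal (coefErr B W lam L n f j k ω ^ 2) ∂P ≤ ENNReal.ofReal (s j))
    (x R : ℝ) :
    ∫⁻ ω, ENNReal.ofReal ((coarseErr B W n f x ω + ∑ j ∈ S, levelErr B W lam L n f j x ω - R) ^ 2)
        ∂P
      ≤ ENNReal.ofReal (3 * ((2 ^ W.j₀ * A) ^ 2 * (1 / n)
        + ((2 * A + 1) * A) ^ 2 * (∑ j ∈ S, √(2 ^ j * s j)) ^ 2 + R ^ 2)) := by
  have hP := IsBrownianReal.isProbabilityMeasure hB
  have hA0 : 0 < A := by linarith [hA.one_le]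
  have hlev : ∫⁻ ω, ENNReal.ofReal ((∑ j ∈ S, levelErr B W lam L n f j x ω) ^ 2) ∂P
      ≤ ENNReal.ofReal (((2 * A + 1) * A) ^ 2 * (∑ j ∈ S, √(2 ^ j * s j)) ^ 2) := by
    rw [← mul_pow, Finset.mul_sum]
    refine lintegral_sq_sum_le (fun j hj => ?_)
      (fun j _ => aemeasurable_levelErr hB hWr hr hf lam L n j x) fun j hj =>
      lintegral_sq_levelErr_le hB hWr hr hA hf (hs j hj).le (h j hj) x
    have := hs j hj
    positivity
  calc _ ≤ ∫⁻ ω, (ENNReal.ofReal (3 * (coarseErr B W n f x ω ^ 2))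
        + ENNReal.ofReal (3 * ((∑ j ∈ S, levelErr B W lam L n f j x ω) ^ 2))
        + ENNReal.ofReal (3 * R ^ 2)) ∂P := by
        refine lintegral_mono fun ω => ?_
        rw [← ENNReal.ofReal_add (by positivity) (by positivity),
          ← ENNReal.ofReal_add (by positivity) (by positivity)]
        refine ENNReal.ofReal_le_ofReal ?_
        nlinarith [sq_nonneg (coarseErr B W n f x ω - ∑ j ∈ S, levelErr B W lam L n f j x ω),
          sq_nonneg (coarseErr B W n f x ω + R),
          sq_nonneg ((∑ j ∈ S, levelErr B W lam L n f j x ω) + R)]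
    _ ≤ ENNReal.ofReal (3 * ((2 ^ W.j₀ * A) ^ 2 * (1 / n)))
        + ENNReal.ofReal (3 * (((2 * A + 1) * A) ^ 2 * (∑ j ∈ S, √(2 ^ j * s j)) ^ 2))
        + ENNReal.ofReal (3 * R ^ 2) := by
        have hm1 := ((aemeasurable_coarseErr hB hWr hf n x).pow_const 2).const_mul 3
        have hm2 := (((Finset.aemeasurable_fun_sum S fun j _ =>
          aemeasurable_levelErr hB hWr hr hf lam L n j x)).pow_const 2).const_mul 3
        rw [lintegral_add_right _ measurable_const,
          lintegral_add_left' hm1.ennreal_ofReal, lintegral_const, measure_univ, mul_one]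
        have h3 : (0 : ℝ) ≤ 3 := by norm_num
        simp_rw [ENNReal.ofReal_mul h3]
        rw [lintegral_const_mul' _ _ ENNReal.ofReal_ne_top,
          lintegral_const_mul' _ _ ENNReal.ofReal_ne_top]
        gcongr
        exact (lintegral_sq_coarseErr_le hB hW hWr hA hf x)
    _ = _ := by
        rw [← ENNReal.ofReal_add (by positivity) (by positivity),
          ← ENNReal.ofReal_add (by positivity) (by positivity)]
        congr 1; ring

end

/-! ### The estimation error over a window -/

noncomputable section

open ProbabilityTheory

/-- The indices at level `j` whose functions may be nonzero somewhere on `[x₀ - c, x₀ + c]`. -/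
def hitIndex (A : ℝ) (j : ℕ) (x₀ c : ℝ) : Finset ℕ :=
  IntervalWavelets.nearIndex (2 ^ j * c + A) j x₀

/-- The part of `[x₀ - c, x₀ + c]` in `[0, 1]`. -/
def localWindow (x₀ c : ℝ) : Set ℝ := Set.Icc (x₀ - c) (x₀ + c) ∩ Set.Icc 0 1

theorem volume_localWindow_le (x₀ c : ℝ) : volume (localWindow x₀ c) ≤ ENNReal.ofReal (2 * c) := by
  refine (measure_mono Set.inter_subset_left).trans (le_of_eq ?_)
  rw [Real.volume_Icc]
  congr 1; ring

theorem measurableSet_localWindow (x₀ c : ℝ) : MeasurableSet (localWindow x₀ c) :=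
  measurableSet_Icc.inter measurableSet_Icc

theorem IntervalWavelets.IsLocalized.sum_eq_sum_hitIndex {W : IntervalWavelets} {A : ℝ}
    (hA : W.IsLocalized A) (a : ℕ → ℝ) (j : ℕ) {x₀ c x : ℝ}
    (hx : x ∈ localWindow x₀ c) :
    ∑ k ∈ Finset.Icc 1 (2 ^ j), a k * W.mother j k x
      = ∑ k ∈ hitIndex A j x₀ c, a k * W.mother j k x := by
  refine (Finset.sum_subset (IntervalWavelets.nearIndex_subset _ j x₀) fun k hk hk' => ?_).symm
  by_contra hne
  refine hk' (Finset.mem_filter.2 ⟨hk, ?_⟩)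
  have h1 := abs_le.1 (hA.near j k hk x (right_ne_zero_of_mul hne))
  have h2 := hx.1
  have h2j : (0 : ℝ) < 2 ^ j := by positivity
  have h3 : 2 ^ j * (x₀ - c) ≤ 2 ^ j * x := mul_le_mul_of_nonneg_left h2.1 h2j.le
  have h4 : 2 ^ j * x ≤ 2 ^ j * (x₀ + c) := mul_le_mul_of_nonneg_left h2.2 h2j.le
  rw [abs_le]
  constructor <;> nlinarith [h1.1, h1.2]

/-- A local form of Bessel's inequality: the energy of a wavelet sum in a window is at most the
energy of those coefficients whose functions meet the window. -/
theorem lintegral_localWindow_sq_le {W : IntervalWavelets} {A : ℝ} {r : ℕ}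
    (hW : W.IsWaveletBasis) (hWr : W.IsRegular r) (hr : 1 ≤ r)
    (hA : W.IsLocalized A) {S : Finset ℕ} (hS : ∀ j ∈ S, W.j₀ ≤ j) (a : ℕ → ℕ → ℝ) (x₀ c : ℝ) :
    ∫⁻ x in localWindow x₀ c,
        ENNReal.ofReal ((∑ j ∈ S, ∑ k ∈ Finset.Icc 1 (2 ^ j), a j k * W.mother j k x) ^ 2)
      ≤ ENNReal.ofReal (∑ j ∈ S, ∑ k ∈ hitIndex A j x₀ c, a j k ^ 2) := by
  set T : Finset (Σ _ : ℕ, ℕ) := S.sigma fun j => hitIndex A j x₀ c with hT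
  have hmem : ∀ p ∈ T, W.j₀ ≤ p.1 ∧ p.2 ∈ Finset.Icc 1 (2 ^ p.1) := fun p hp => by
    rw [hT, Finset.mem_sigma] at hp
    exact ⟨hS _ hp.1, IntervalWavelets.nearIndex_subset _ _ _ hp.2⟩
  have hcont : ∀ p ∈ T, Continuous (W.mother p.1 p.2) := fun p hp =>
    (hWr.contDiff_mother hr (hmem p hp).2).continuous
  have hgc : Continuous fun x => ∑ p ∈ T, a p.1 p.2 * W.mother p.1 p.2 x :=
    continuous_finsetSum _ fun p hp => continuous_const.mul (hcont p hp)
  have horth : ∀ p ∈ T, ∀ q ∈ T,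
      ∫ x in (0 : ℝ)..1, W.mother p.1 p.2 x * W.mother q.1 q.2 x = if p = q then 1 else 0 := by
    intro p hp q hq
    rw [← integral_Icc_eq_intervalIntegral, hW.orthonormal_mother p.1 q.1 (hmem p hp).1
      (hmem q hq).1 p.2 (hmem p hp).2 q.2 (hmem q hq).2]
    have : (p.1 = q.1 ∧ p.2 = q.2) ↔ p = q := by
      rw [Sigma.ext_iff, heq_eq_eq]
    simp only [this]
  calc _ = ∫⁻ x in localWindow x₀ c,
        ENNReal.ofReal ((∑ p ∈ T, a p.1 p.2 * W.mother p.1 p.2 x) ^ 2) := by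
        refine setLIntegral_congr_fun (measurableSet_localWindow x₀ c) fun x hx => ?_
        congr 2
        rw [hT, Finset.sum_sigma]
        exact Finset.sum_congr rfl fun j _ => hA.sum_eq_sum_hitIndex (a j) j hx
    _ ≤ ∫⁻ x in Set.Icc (0 : ℝ) 1,
        ENNReal.ofReal ((∑ p ∈ T, a p.1 p.2 * W.mother p.1 p.2 x) ^ 2) :=
        lintegral_mono_set Set.inter_subset_right
    _ = ENNReal.ofReal (∫ x in Set.Icc (0 : ℝ) 1,
        (∑ p ∈ T, a p.1 p.2 * W.mother p.1 p.2 x) ^ 2) := by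
        rw [ofReal_integral_eq_lintegral_ofReal]
        · exact (hgc.pow 2).continuousOn.integrableOn_Icc
        · exact ae_of_all _ fun x => sq_nonneg _
    _ = _ := by
        rw [integral_Icc_eq_intervalIntegral,
          integral_sq_sum_of_orthonormal (s := T) (e := fun p => W.mother p.1 p.2) hcont horth
            (fun p => a p.1 p.2), hT, Finset.sum_sigma]

theorem card_hitIndex_le {A : ℝ} (hA : 0 ≤ A) (j : ℕ) (x₀ : ℝ) {c : ℝ} (hc : 0 ≤ c) :
    ((hitIndex A j x₀ c).card : ℝ) ≤ 2 * (2 ^ j * c + A) + 1 :=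
  IntervalWavelets.card_nearIndex_le (by positivity) j x₀

/-- Indices in a window of length `2 R` belong to at most `2 R / L + 2` blocks. -/
theorem card_image_jsBlockIndex_le {R t : ℝ} (hR : 0 ≤ R) {L : ℕ} (hL : 1 ≤ L) {T : Finset ℕ}
    (hT1 : ∀ k ∈ T, 1 ≤ k) (hT : ∀ k ∈ T, |t - k| ≤ R) :
    ((T.image (jsBlockIndex L)).card : ℝ) ≤ 2 * R / L + 2 := by
  have hL0 : (0 : ℝ) < L := by exact_mod_cast hL
  have h := card_near_le (A := R / L + 1 / 2) (by positivity) (t / L + 1 / 2)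
    (T.image (jsBlockIndex L)) ?_
  · refine h.trans (le_of_eq ?_); ring
  · intro b hb
    obtain ⟨k, hk, rfl⟩ := Finset.mem_image.1 hb
    have h1 := abs_le.1 (hT k hk)
    have hk1 := hT1 k hk
    have h2 : k ≤ jsBlockIndex L k * L := by
      rw [jsBlockIndex, add_mul, one_mul]
      have := Nat.lt_div_mul_add (a := k - 1) (b := L) hL
      omega
    have h3 : jsBlockIndex L k * L ≤ k + L := by
      rw [jsBlockIndex, add_mul, one_mul]
      have := Nat.div_mul_le_self (k - 1) L
      omega
    have h2' : (k : ℝ) ≤ jsBlockIndex L k * L := by exact_mod_cast h2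
    have h3' : (jsBlockIndex L k : ℝ) * L ≤ k + L := by exact_mod_cast h3
    have e : (t / L + 1 / 2 - jsBlockIndex L k) = (t + L / 2 - jsBlockIndex L k * L) / L := by
      field_simp
    have e2 : R / L + 1 / 2 = (R + L / 2) / L := by field_simp
    rw [e, e2, abs_div, abs_of_pos hL0]
    gcongr
    rw [abs_le]
    constructor <;> linarith [h1.1, h1.2]

variable {Ω : Type*} [MeasurableSpace Ω] {P : Measure Ω} {B : ℝ≥0 → Ω → ℝ}
  {W : IntervalWavelets} {r : ℕ} {f : ℝ → ℝ} {A : ℝ} {lam : ℝ} {L n : ℕ}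

/-- The risk over a window of one level, counted in blocks. -/
theorem lintegral_sum_hitIndex_le_block (hB : IsBrownianReal B P) (hW : W.IsWaveletBasis)
    (hWr : W.IsRegular r) (hr : 1 ≤ r) (hA : 0 ≤ A) (hf : ContinuousOn f (Set.Icc 0 1))
    (hlam : 0 ≤ lam) (hL : 1 ≤ L) {j : ℕ} (hj : W.j₀ ≤ j) (x₀ : ℝ) {c : ℝ} (hc : 0 ≤ c) :
    ∫⁻ ω, ENNReal.ofReal (∑ k ∈ hitIndex A j x₀ c, coefErr B W lam L n f j k ω ^ 2) ∂P
      ≤ ENNReal.ofReal (4 * (lam + 1) * ((2 ^ j * c + A + L) / n)) := by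
  set T := hitIndex A j x₀ c with hT
  have hTsub : ∀ k ∈ T, k ∈ Finset.Icc 1 (2 ^ j) := fun k hk =>
    IntervalWavelets.nearIndex_subset _ _ _ hk
  have hL0 : (0 : ℝ) < L := by exact_mod_cast hL
  have hR : 0 ≤ 2 ^ j * c + A := by positivity
  have hcard := card_image_jsBlockIndex_le hR hL
    (fun k hk => (Finset.mem_Icc.1 (hTsub k hk)).1)
    (fun k (hk : k ∈ T) => (Finset.mem_filter.1 hk).2)
  calc _ ≤ ∫⁻ ω, ENNReal.ofReal (∑ b ∈ T.image (jsBlockIndex L),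
        1 * ∑ k ∈ jsBlock L j b, coefErr B W lam L n f j k ω ^ 2) ∂P := by
        refine lintegral_mono fun ω => ENNReal.ofReal_le_ofReal ?_
        rw [← Finset.sum_fiberwise_of_maps_to (s := T) (t := T.image (jsBlockIndex L))
          (g := jsBlockIndex L) (fun k hk => Finset.mem_image_of_mem _ hk)]
        refine Finset.sum_le_sum fun b _ => ?_
        rw [one_mul]
        refine Finset.sum_le_sum_of_subset_of_nonneg (fun k hk => ?_) fun _ _ _ => sq_nonneg _
        obtain ⟨hk', rfl⟩ := Finset.mem_filter.1 hk
        exact mem_jsBlock_jsBlockIndex hL (hTsub k hk')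
    _ ≤ ENNReal.ofReal (∑ b ∈ T.image (jsBlockIndex L), 1 * (2 * (lam + 1) * (L / n))) :=
        lintegral_ofReal_sum_le (fun _ _ => zero_le_one) (fun _ _ => by positivity)
          (fun b _ => Finset.aemeasurable_fun_sum _ fun k hk =>
            (aemeasurable_coefErr hB hWr hr hf lam L n (jsBlock_subset _ _ _ hk)).pow_const 2)
          (fun _ _ _ => Finset.sum_nonneg fun _ _ => sq_nonneg _)
          fun b _ => lintegral_sum_sq_coefErr_le hB hW hWr hr hf hlam hj b
    _ ≤ _ := by
        refine ENNReal.ofReal_le_ofReal ?_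
        rw [Finset.sum_const, nsmul_eq_mul, one_mul]
        calc _ ≤ (2 * (2 ^ j * c + A) / L + 2) * (2 * (lam + 1) * (L / n)) := by gcongr
          _ = _ := by field_simp; ring

/-- The risk over a window of one level, counted in single coefficients. -/
theorem lintegral_sum_hitIndex_le_single (hB : IsBrownianReal B P)
    (hWr : W.IsRegular r) (hr : 1 ≤ r) (hA : 0 ≤ A) (hf : ContinuousOn f (Set.Icc 0 1))
    {j : ℕ} {s : ℝ} (hs : 0 ≤ s)
    (h : ∀ k ∈ Finset.Icc 1 (2 ^ j),
      ∫⁻ ω, ENNReal.ofReal (coefErr B W lam L n f j k ω ^ 2) ∂P ≤ ENNReal.ofReal s)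
    (x₀ : ℝ) {c : ℝ} (hc : 0 ≤ c) :
    ∫⁻ ω, ENNReal.ofReal (∑ k ∈ hitIndex A j x₀ c, coefErr B W lam L n f j k ω ^ 2) ∂P
      ≤ ENNReal.ofReal ((2 * (2 ^ j * c + A) + 1) * s) := by
  have hTsub : ∀ k ∈ hitIndex A j x₀ c, k ∈ Finset.Icc 1 (2 ^ j) := fun k hk =>
    IntervalWavelets.nearIndex_subset _ _ _ hk
  have h1 := lintegral_ofReal_sum_le (s := hitIndex A j x₀ c) (P := P) (a := fun _ => 1)
    (u := fun k ω => coefErr B W lam L n f j k ω ^ 2)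
    (fun _ _ => zero_le_one) (fun _ _ => hs)
    (fun k hk => (aemeasurable_coefErr hB hWr hr hf lam L n (hTsub k hk)).pow_const 2)
    (fun _ _ _ => sq_nonneg _) fun k hk => h k (hTsub k hk)
  simp only [one_mul] at h1
  refine h1.trans (ENNReal.ofReal_le_ofReal ?_)
  rw [Finset.sum_const, nsmul_eq_mul]
  have := card_hitIndex_le hA j x₀ hc
  gcongr

/-- The average over a window of a mean squared error that is uniformly bounded. -/
theorem lintegral_localWindow_le [SFinite P] {G : Ω → ℝ → ℝ} {x₀ c a : ℝ}
    (hG : AEMeasurable (Function.uncurry G) (P.prod (volume.restrict (localWindow x₀ c))))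
    (h : ∀ x ∈ Set.Icc (0 : ℝ) 1, ∫⁻ ω, ENNReal.ofReal (G ω x ^ 2) ∂P ≤ ENNReal.ofReal a) :
    ∫⁻ ω, (∫⁻ x in localWindow x₀ c, ENNReal.ofReal (G ω x ^ 2)) ∂P
      ≤ ENNReal.ofReal (2 * c) * ENNReal.ofReal a := by
  rw [lintegral_lintegral_swap (f := fun ω x => ENNReal.ofReal (G ω x ^ 2))
    (hG.pow_const 2).ennreal_ofReal]
  calc _ ≤ ∫⁻ _x in localWindow x₀ c, ENNReal.ofReal a :=
        setLIntegral_mono measurable_const fun x hx => h x hx.2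
    _ = ENNReal.ofReal a * volume (localWindow x₀ c) := setLIntegral_const _ _
    _ ≤ _ := by
        rw [mul_comm]
        exact mul_le_mul_left (volume_localWindow_le x₀ c) _

theorem aemeasurable_uncurry_partialErr (hB : IsBrownianReal B P)
    (hWr : W.IsRegular r) (hr : 1 ≤ r) (hf : ContinuousOn f (Set.Icc 0 1)) (S : Finset ℕ) (J : ℕ)
    (lam : ℝ) (L n : ℕ) (x₀ c : ℝ) :
    AEMeasurable (Function.uncurry fun ω x => coarseErr B W n f x ω
      + ∑ j ∈ S, levelErr B W lam L n f j x ω - (f x - W.partialSum f J x))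
      (P.prod (volume.restrict (localWindow x₀ c))) := by
  have hP := IsBrownianReal.isProbabilityMeasure hB
  refine ((Finset.aemeasurable_fun_sum _ fun k hk => ?_).add
    (Finset.aemeasurable_fun_sum _ fun j _ => Finset.aemeasurable_fun_sum _ fun k hk => ?_)).sub
    (AEMeasurable.sub ?_ ?_)
  · exact ((aemeasurable_pathIntegral_observedPath hB (hWr.contDiff_father hk) hf n).sub_const
      _).comp_fst.mul ((hWr.contDiff_father hk).continuous.measurable.comp
        measurable_snd).aemeasurable
  · exact (aemeasurable_coefErr hB hWr hr hf lam L n hk).comp_fst.mul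
      ((hWr.contDiff_mother hr hk).continuous.measurable.comp measurable_snd).aemeasurable
  · have h1 : AEMeasurable f (volume.restrict (localWindow x₀ c)) :=
      (hf.mono Set.inter_subset_right).aemeasurable (measurableSet_localWindow x₀ c)
    exact h1.comp_snd
  · exact ((hWr.continuous_partialSum hr f J).measurable.comp measurable_snd).aemeasurable

/-- The local risk of BlockJS, split at the levels: the levels in `S₁` are estimated pointwise,
those in `S₂` in `L²` over the window. -/
theorem localRisk_blockJS_le (hB : IsBrownianReal B P) (hW : W.IsWaveletBasis)
    (hWr : W.IsRegular r) (hr : 1 ≤ r) (hA : W.IsLocalized A) (hf : ContinuousOn f (Set.Icc 0 1))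
    {S₁ S₂ : Finset ℕ} (hdisj : Disjoint S₁ S₂)
    (hunion : S₁ ∪ S₂ = Finset.Ico W.j₀ (Nat.clog 2 n)) {x₀ c a b : ℝ} (hc : 0 < c)
    (ha0 : 0 ≤ a) (hb0 : 0 ≤ b)
    (ha : ∀ x ∈ Set.Icc (0 : ℝ) 1, ∫⁻ ω, ENNReal.ofReal ((coarseErr B W n f x ω
      + ∑ j ∈ S₁, levelErr B W lam L n f j x ω
        - (f x - W.partialSum f (Nat.clog 2 n) x)) ^ 2) ∂P ≤ ENNReal.ofReal a)
    (hb : ∫⁻ ω, ENNReal.ofReal (∑ j ∈ S₂, ∑ k ∈ hitIndex A j x₀ c,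
      coefErr B W lam L n f j k ω ^ 2) ∂P ≤ ENNReal.ofReal b) :
    localRisk P (fun ω => blockJS W lam L n (observedPath n f fun t => B t ω)) f x₀ c
      ≤ ENNReal.ofReal (2 * a + b / c) := by
  have hP := IsBrownianReal.isProbabilityMeasure hB
  rw [localRisk, if_neg hc.ne']
  set G : Ω → ℝ → ℝ := fun ω x => coarseErr B W n f x ω
      + ∑ j ∈ S₁, levelErr B W lam L n f j x ω - (f x - W.partialSum f (Nat.clog 2 n) x) with hG
  have hS₂ : ∀ j ∈ S₂, W.j₀ ≤ j := fun j hj => by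
    have : j ∈ Finset.Ico W.j₀ (Nat.clog 2 n) := hunion ▸ Finset.mem_union_right _ hj
    exact (Finset.mem_Ico.1 this).1
  have hGm := aemeasurable_uncurry_partialErr hB hWr hr hf S₁ (Nat.clog 2 n) lam L n x₀ c
  have h2 : (0 : ℝ) ≤ 2 := zero_le_two
  have hinner : ∀ ω, ∫⁻ x in localWindow x₀ c,
      ENNReal.ofReal ((blockJS W lam L n (observedPath n f fun t => B t ω) x - f x) ^ 2)
      ≤ ENNReal.ofReal 2 * (∫⁻ x in localWindow x₀ c, ENNReal.ofReal (G ω x ^ 2))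
        + ENNReal.ofReal 2 * ENNReal.ofReal (∑ j ∈ S₂, ∑ k ∈ hitIndex A j x₀ c,
          coefErr B W lam L n f j k ω ^ 2) := by
    intro ω
    have hcont : Continuous fun x => ∑ j ∈ S₂, levelErr B W lam L n f j x ω :=
      continuous_finsetSum _ fun j _ => continuous_finsetSum _ fun k hk =>
        continuous_const.mul (hWr.contDiff_mother hr hk).continuous
    calc _ ≤ ∫⁻ x in localWindow x₀ c, (ENNReal.ofReal 2 * ENNReal.ofReal (G ω x ^ 2)
          + ENNReal.ofReal 2
            * ENNReal.ofReal ((∑ j ∈ S₂, levelErr B W lam L n f j x ω) ^ 2)) := by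
          refine lintegral_mono fun x => ?_
          rw [← ENNReal.ofReal_mul h2, ← ENNReal.ofReal_mul h2,
            ← ENNReal.ofReal_add (by positivity) (by positivity)]
          refine ENNReal.ofReal_le_ofReal ?_
          rw [blockJS_sub_eq, ← hunion, Finset.sum_union hdisj]
          simp only [hG]
          nlinarith [sq_nonneg (coarseErr B W n f x ω
            + ∑ j ∈ S₁, levelErr B W lam L n f j x ω - (f x - W.partialSum f (Nat.clog 2 n) x)
            - ∑ j ∈ S₂, levelErr B W lam L n f j x ω)]
      _ = ENNReal.ofReal 2 * (∫⁻ x in localWindow x₀ c, ENNReal.ofReal (G ω x ^ 2))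
          + ENNReal.ofReal 2 * ∫⁻ x in localWindow x₀ c,
            ENNReal.ofReal ((∑ j ∈ S₂, levelErr B W lam L n f j x ω) ^ 2) := by
          rw [lintegral_add_right _ ((hcont.measurable.pow_const 2).ennreal_ofReal.const_mul _),
            lintegral_const_mul' _ _ ENNReal.ofReal_ne_top,
            lintegral_const_mul' _ _ ENNReal.ofReal_ne_top]
      _ ≤ _ := by
          gcongr
          exact lintegral_localWindow_sq_le hW hWr hr hA hS₂
            (fun j k => coefErr B W lam L n f j k ω) x₀ c
  have hm : AEMeasurable (fun ω => ENNReal.ofReal (∑ j ∈ S₂, ∑ k ∈ hitIndex A j x₀ c,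
      coefErr B W lam L n f j k ω ^ 2)) P :=
    (Finset.aemeasurable_fun_sum _ fun j _ => Finset.aemeasurable_fun_sum _ fun k hk =>
      (aemeasurable_coefErr hB hWr hr hf lam L n
        (IntervalWavelets.nearIndex_subset _ _ _ hk)).pow_const 2).ennreal_ofReal
  have h2c : ENNReal.ofReal (2 * c) ≠ 0 := by
    rw [ne_eq, ENNReal.ofReal_eq_zero, not_le]; positivity
  calc _ ≤ (ENNReal.ofReal (2 * c))⁻¹ * (ENNReal.ofReal 2 *
          (ENNReal.ofReal (2 * c) * ENNReal.ofReal a) + ENNReal.ofReal 2 * ENNReal.ofReal b) := by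
        refine mul_le_mul_right ((lintegral_mono hinner).trans ?_) _
        rw [lintegral_add_right' _ (hm.const_mul _), lintegral_const_mul' _ _ ENNReal.ofReal_ne_top,
          lintegral_const_mul' _ _ ENNReal.ofReal_ne_top]
        gcongr
        exact lintegral_localWindow_le hGm ha
    _ = _ := by
        rw [← ENNReal.ofReal_inv_of_pos (by positivity), ← ENNReal.ofReal_mul (by positivity),
          ← ENNReal.ofReal_mul h2, ← ENNReal.ofReal_mul h2,
          ← ENNReal.ofReal_add (by positivity) (by positivity),
          ← ENNReal.ofReal_mul (by positivity)]
        congr 1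
        field_simp

end

/-! ### Dyadic sums and the risk of a coefficient over the Hölder class -/

noncomputable section

section DyadicSums

/-- Sums of positive powers over dyadic scales are dominated by the largest scale. -/
theorem sum_two_pow_rpow_le {a X : ℝ} (ha : 0 < a) (hX : 0 ≤ X) {S : Finset ℕ}
    (hS : ∀ j ∈ S, (2 : ℝ) ^ j ≤ X) :
    ∑ j ∈ S, ((2 : ℝ) ^ j) ^ a ≤ (2 : ℝ) ^ a / ((2 : ℝ) ^ a - 1) * X ^ a := by
  have ht : 1 < (2 : ℝ) ^ a := Real.one_lt_rpow one_lt_two ha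
  have ht' : 0 < (2 : ℝ) ^ a - 1 := by linarith
  rcases S.eq_empty_or_nonempty with rfl | hne
  · simp; positivity
  set m := S.max' hne with hm
  have hsub : S ⊆ Finset.range (m + 1) := fun j hj =>
    Finset.mem_range.2 (Nat.lt_succ_of_le (S.le_max' j hj))
  calc ∑ j ∈ S, ((2 : ℝ) ^ j) ^ a ≤ ∑ j ∈ Finset.range (m + 1), ((2 : ℝ) ^ a) ^ j := by
        simp_rw [two_pow_rpow]
        exact Finset.sum_le_sum_of_subset_of_nonneg hsub fun _ _ _ => by positivity
    _ ≤ (2 : ℝ) ^ a / ((2 : ℝ) ^ a - 1) * ((2 : ℝ) ^ m) ^ a := by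
        rw [geom_sum_eq ht.ne', two_pow_rpow, div_mul_eq_mul_div, ← pow_succ']
        gcongr
        linarith
    _ ≤ _ := by
        have := hS m (S.max'_mem hne)
        gcongr

/-- Sums of negative powers over dyadic scales are dominated by the smallest scale. -/
theorem sum_two_pow_rpow_neg_le {a X : ℝ} (ha : 0 < a) (hX : 0 < X) {S : Finset ℕ}
    (hS : ∀ j ∈ S, X ≤ (2 : ℝ) ^ j) :
    ∑ j ∈ S, ((2 : ℝ) ^ j) ^ (-a) ≤ 1 / (1 - (2 : ℝ) ^ (-a)) * X ^ (-a) := by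
  have ht : (2 : ℝ) ^ (-a) < 1 := Real.rpow_lt_one_of_one_lt_of_neg one_lt_two (by linarith)
  have ht' : 0 < 1 - (2 : ℝ) ^ (-a) := by linarith
  rcases S.eq_empty_or_nonempty with rfl | hne
  · simp; positivity
  set m := S.min' hne with hm
  set M := S.max' hne with hM
  have hsub : S ⊆ Finset.Ico m (M + 1) := fun j hj =>
    Finset.mem_Ico.2 ⟨S.min'_le j hj, Nat.lt_succ_of_le (S.le_max' j hj)⟩
  calc ∑ j ∈ S, ((2 : ℝ) ^ j) ^ (-a) ≤ ∑ j ∈ Finset.Ico m (M + 1), ((2 : ℝ) ^ (-a)) ^ j := by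
        simp_rw [two_pow_rpow]
        exact Finset.sum_le_sum_of_subset_of_nonneg hsub fun _ _ _ => by positivity
    _ ≤ ((2 : ℝ) ^ (-a)) ^ m / (1 - (2 : ℝ) ^ (-a)) :=
        geom_sum_Ico_le_of_lt_one (by positivity) ht
    _ = 1 / (1 - (2 : ℝ) ^ (-a)) * ((2 : ℝ) ^ m) ^ (-a) := by rw [two_pow_rpow]; ring
    _ ≤ _ := by
        have h1 := hS m (S.min'_mem hne)
        have h2 : ((2 : ℝ) ^ m) ^ (-a) ≤ X ^ (-a) :=
          Real.rpow_le_rpow_of_nonpos hX h1 (by linarith)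
        gcongr

/-- The number of dyadic scales in an interval. -/
theorem card_dyadic_le {l u : ℝ} (hl : 0 < l) {S : Finset ℕ} (hne : S.Nonempty)
    (hS : ∀ j ∈ S, l ≤ (2 : ℝ) ^ j ∧ (2 : ℝ) ^ j ≤ u) :
    (S.card : ℝ) ≤ Real.log (u / l) / Real.log 2 + 1 := by
  set m := S.min' hne with hm
  set M := S.max' hne with hM
  have hmM : m ≤ M := S.min'_le _ (S.max'_mem hne)
  have hsub : S ⊆ Finset.Icc m M := fun j hj =>
    Finset.mem_Icc.2 ⟨S.min'_le j hj, S.le_max' j hj⟩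
  have hc := Finset.card_le_card hsub
  rw [Nat.card_Icc] at hc
  have hlog2 : 0 < Real.log 2 := Real.log_pos one_lt_two
  have h1 : (2 : ℝ) ^ (M - m) ≤ u / l := by
    rw [le_div_iff₀ hl]
    calc (2 : ℝ) ^ (M - m) * l ≤ (2 : ℝ) ^ (M - m) * 2 ^ m := by
          have := (hS m (S.min'_mem hne)).1
          gcongr
      _ = 2 ^ M := by rw [← pow_add, Nat.sub_add_cancel hmM]
      _ ≤ u := (hS M (S.max'_mem hne)).2
  have h2 : ((M - m : ℕ) : ℝ) ≤ Real.log (u / l) / Real.log 2 := by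
    rw [le_div_iff₀ hlog2, ← Real.log_pow]
    exact Real.log_le_log (by positivity) h1
  have h3 : (S.card : ℝ) ≤ ((M - m : ℕ) : ℝ) + 1 := by
    have : S.card ≤ (M - m) + 1 := by omega
    exact_mod_cast this
  linarith

end DyadicSums

open ProbabilityTheory

variable {Ω : Type*} [MeasurableSpace Ω] {P : Measure Ω} {B : ℝ≥0 → Ω → ℝ}
  {W : IntervalWavelets} {r : ℕ} {f : ℝ → ℝ} {A : ℝ} {lam : ℝ} {L n : ℕ} {α M : ℝ}

/-- The constant in the decay of the wavelet coefficients over `F(α, M)`. -/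
def decayConst (A α M : ℝ) : ℝ := 4 * A ^ 2 * M * (2 * A) ^ α

theorem IntervalWavelets.IsRegular.sq_coef_le (hWr : W.IsRegular r) (hA : W.IsLocalized A)
    (hα : 0 < α) (hαr : α < r) (hM : 0 < M) (hf : f ∈ holderClass α M) {j k : ℕ}
    (hj : W.j₀ ≤ j) (hk : k ∈ Finset.Icc 1 (2 ^ j)) :
    W.coef f (.inr ⟨j, k⟩) ^ 2 ≤ decayConst A α M ^ 2 * ((2 : ℝ) ^ j) ^ (-(1 + 2 * α)) := by
  have h := hWr.abs_coef_le hA hα hαr hM hf hj hk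
  have h2j : (0 : ℝ) < 2 ^ j := by positivity
  rw [← sq_abs]
  calc |W.coef f (.inr ⟨j, k⟩)| ^ 2
      ≤ (decayConst A α M * ((2 : ℝ) ^ j) ^ (-(1 / 2 + α))) ^ 2 := by
        have h0 := abs_nonneg (W.coef f (.inr ⟨j, k⟩))
        gcongr
        exact h
    _ = _ := by
        rw [mul_pow, ← Real.rpow_natCast (((2 : ℝ) ^ j) ^ (-(1 / 2 + α))) 2,
          ← Real.rpow_mul h2j.le]
        congr 2
        push_cast
        ring

theorem one_le_of_pos_of_lt_natCast (hα : 0 < α) (hαr : α < r) : 1 ≤ r := by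
  have : (0 : ℝ) < r := hα.trans hαr
  exact_mod_cast this

/-- At every level the risk of a coefficient is at most the risk of its block. -/
theorem lintegral_sq_coefErr_le_threshold (hB : IsBrownianReal B P) (hW : W.IsWaveletBasis)
    (hWr : W.IsRegular r) (hr : 1 ≤ r) (hf : ContinuousOn f (Set.Icc 0 1))
    (hlam : 0 ≤ lam) (hL : 1 ≤ L) {j : ℕ} (hj : W.j₀ ≤ j) {k : ℕ}
    (hk : k ∈ Finset.Icc 1 (2 ^ j)) :
    ∫⁻ ω, ENNReal.ofReal (coefErr B W lam L n f j k ω ^ 2) ∂P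
      ≤ ENNReal.ofReal (2 * (lam + 1) * (L / n)) :=
  (lintegral_mono fun ω => ENNReal.ofReal_le_ofReal
    (Finset.single_le_sum (f := fun k => coefErr B W lam L n f j k ω ^ 2)
      (fun _ _ => sq_nonneg _) (mem_jsBlock_jsBlockIndex hL hk))).trans
    (lintegral_sum_sq_coefErr_le hB hW hWr hr hf hlam hj _)

theorem lintegral_sq_coefErr_le_decay (hB : IsBrownianReal B P) (hW : W.IsWaveletBasis)
    (hWr : W.IsRegular r) (hA : W.IsLocalized A)
    (hα : 0 < α) (hαr : α < r) (hM : 0 < M) (hf : f ∈ holderClass α M)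
    (hlam : 0 ≤ lam) {j : ℕ} (hj : W.j₀ ≤ j) {k : ℕ} (hk : k ∈ Finset.Icc 1 (2 ^ j)) :
    ∫⁻ ω, ENNReal.ofReal (coefErr B W lam L n f j k ω ^ 2) ∂P
      ≤ ENNReal.ofReal (decayConst A α M ^ 2 * ((2 : ℝ) ^ j) ^ (-(1 + 2 * α)) + 1 / n) := by
  refine (lintegral_sq_coefErr_le hB hW hWr (one_le_of_pos_of_lt_natCast hα hαr)
    (continuousOn_of_mem_holderClass hf) hlam hj hk).trans (ENNReal.ofReal_le_ofReal ?_)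
  gcongr
  exact hWr.sq_coef_le hA hα hαr hM hf hj hk

/-- Risk of a coefficient at the high levels: those where the signal energy of every block is
below the fraction `((1 - κ) / (lam - 1)) ^ 2` of the threshold. -/
theorem lintegral_sq_coefErr_le_high (hB : IsBrownianReal B P) (hW : W.IsWaveletBasis)
    (hWr : W.IsRegular r) (hA : W.IsLocalized A)
    (hα : 0 < α) (hαr : α < r) (hM : 0 < M) (hf : f ∈ holderClass α M)
    (hlam_one : 1 < lam) (hlam : lam - Real.log lam - 1 = 2) (hn : 1 ≤ n) (hL2 : 2 ≤ L)
    (hLn : Real.log n - 1 ≤ L)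
    {κ : ℝ} (hκ0 : 1 / 2 ≤ κ) (hκ1 : κ < 1) {j : ℕ} (hj : W.j₀ ≤ j)
    (hhigh : decayConst A α M ^ 2 / (((1 - κ) / (lam - 1)) ^ 2 * lam) * n
      ≤ ((2 : ℝ) ^ j) ^ (1 + 2 * α)) {k : ℕ} (hk : k ∈ Finset.Icc 1 (2 ^ j)) :
    ∫⁻ ω, ENNReal.ofReal (coefErr B W lam L n f j k ω ^ 2) ∂P
      ≤ ENNReal.ofReal (decayConst A α M ^ 2 * ((2 : ℝ) ^ j) ^ (-(1 + 2 * α))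
        + 3 * lam * (L * (n : ℝ) ^ (-(1 + κ)))) := by
  have hlam3 : 3 < lam := by
    have := Real.log_pos hlam_one
    linarith
  have hn0 : (0 : ℝ) < n := by exact_mod_cast hn
  have hL2' : (2 : ℝ) ≤ L := by exact_mod_cast hL2
  set δ : ℝ := (1 - κ) / (lam - 1) with hδ
  have hl1 : 0 < lam - 1 := by linarith
  have hδ0 : 0 < δ := div_pos (by linarith) hl1
  have hδ4 : δ ≤ 1 / 4 := by rw [hδ, div_le_iff₀ hl1]; linarith
  have hL1 : 1 ≤ (L : ℝ) * (1 - δ) ^ 2 := by nlinarith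
  have h2j : (0 : ℝ) < 2 ^ j := by positivity
  have hv : (0 : ℝ) < ((2 : ℝ) ^ j) ^ (1 + 2 * α) := by positivity
  have hθ : ∑ i ∈ jsBlock L j (jsBlockIndex L k), W.coef f (.inr ⟨j, i⟩) ^ 2
      ≤ δ ^ 2 * (lam * L * (n : ℝ)⁻¹) := by
    calc _ ≤ ∑ _i ∈ jsBlock L j (jsBlockIndex L k),
          decayConst A α M ^ 2 * ((2 : ℝ) ^ j) ^ (-(1 + 2 * α)) :=
          Finset.sum_le_sum fun i hi => hWr.sq_coef_le hA hα hαr hM hf hj (jsBlock_subset _ _ _ hi)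
      _ ≤ L * (decayConst A α M ^ 2 * ((2 : ℝ) ^ j) ^ (-(1 + 2 * α))) := by
          rw [Finset.sum_const, nsmul_eq_mul]
          have : ((jsBlock L j (jsBlockIndex L k)).card : ℝ) ≤ L := by
            exact_mod_cast card_jsBlock_le L j _
          gcongr
      _ ≤ L * (δ ^ 2 * lam * (n : ℝ)⁻¹) := by
          refine mul_le_mul_of_nonneg_left ?_ (by positivity)
          rw [Real.rpow_neg h2j.le, ← div_eq_mul_inv, ← div_eq_mul_inv, div_le_div_iff₀ hv hn0]
          rw [div_mul_eq_mul_div, div_le_iff₀ (by positivity)] at hhigh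
          linarith
      _ = _ := by ring
  refine (lintegral_sq_coefErr_le_of_small hB hW hWr (one_le_of_pos_of_lt_natCast hα hαr)
    (continuousOn_of_mem_holderClass hf) hlam_one hlam hn (by omega) hδ0 (by linarith) hL1 hj hk
    hθ).trans (ENNReal.ofReal_le_ofReal ?_)
  refine add_le_add (hWr.sq_coef_le hA hα hαr hM hf hj hk) ?_
  have hexp : Real.exp (-(1 - (lam - 1) * δ) * L) ≤ 3 * (n : ℝ) ^ (-κ) := by
    have e1 : 1 - (lam - 1) * δ = κ := by rw [hδ]; field_simp; ring
    rw [e1, Real.rpow_def_of_pos hn0]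
    calc Real.exp (-κ * L) ≤ Real.exp (1 + Real.log n * -κ) := by
          refine Real.exp_le_exp.2 ?_
          nlinarith
      _ = Real.exp 1 * Real.exp (Real.log n * -κ) := Real.exp_add _ _
      _ ≤ _ := by
          gcongr
          linarith [Real.exp_one_lt_d9]
  calc lam * (L / n) * Real.exp (-(1 - (lam - 1) * δ) * L)
      ≤ lam * (L / n) * (3 * (n : ℝ) ^ (-κ)) := by gcongr
    _ = _ := by
        rw [neg_add, Real.rpow_add hn0, Real.rpow_neg_one]
        ring

/-- The remainder of the wavelet series beyond the last level of BlockJS. -/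
theorem IntervalWavelets.IsWaveletBasis.sq_sub_partialSum_le (hW : W.IsWaveletBasis)
    (hWr : W.IsRegular r) (hA : W.IsLocalized A)
    (hα : 0 < α) (hαr : α < r) (hM : 0 < M) (hf : f ∈ holderClass α M) (hn : 1 ≤ n)
    (hJ : 2 ^ W.j₀ ≤ n) {x : ℝ} (hx : x ∈ Set.Icc (0 : ℝ) 1) :
    (f x - W.partialSum f (Nat.clog 2 n) x) ^ 2
      ≤ ((2 * A + 1) * decayConst A α M * A / (1 - (2 : ℝ) ^ (-α))) ^ 2 * (n : ℝ) ^ (-(2 * α)) := by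
  have hn0 : (0 : ℝ) < n := by exact_mod_cast hn
  have hA0 : 0 < A := by linarith [hA.one_le]
  have hj : W.j₀ ≤ Nat.clog 2 n := by
    rw [← Nat.clog_pow 2 W.j₀ one_lt_two]
    exact Nat.clog_mono_right 2 hJ
  have h := hW.abs_sub_partialSum_le hWr hA hα hαr hM hf hj hx
  have hq1 : (2 : ℝ) ^ (-α) < 1 := Real.rpow_lt_one_of_one_lt_of_neg one_lt_two (by linarith)
  have hD : 0 < decayConst A α M := by unfold decayConst; positivity
  have h1q : 0 < 1 - (2 : ℝ) ^ (-α) := by linarith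
  have h2 : ((2 : ℝ) ^ (-α)) ^ Nat.clog 2 n ≤ (n : ℝ) ^ (-α) := by
    rw [← two_pow_rpow]
    refine Real.rpow_le_rpow_of_nonpos hn0 ?_ (by linarith)
    exact_mod_cast Nat.le_pow_clog one_lt_two n
  rw [← sq_abs]
  calc |f x - W.partialSum f (Nat.clog 2 n) x| ^ 2
      ≤ ((2 * A + 1) * decayConst A α M * A / (1 - (2 : ℝ) ^ (-α)) * (n : ℝ) ^ (-α)) ^ 2 := by
        refine pow_le_pow_left₀ (abs_nonneg _) (h.trans ?_) 2
        exact mul_le_mul_of_nonneg_left h2 (by positivity)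
    _ = _ := by
        rw [mul_pow, ← Real.rpow_natCast ((n : ℝ) ^ (-α)) 2, ← Real.rpow_mul hn0.le]
        congr 2
        push_cast; ring

end

/-! ### Summation of the risk bounds over the levels at a point -/

noncomputable section

section Numerics

theorem sqrt_add_le_add_sqrt {a b : ℝ} (ha : 0 ≤ a) (hb : 0 ≤ b) : √(a + b) ≤ √a + √b := by
  rw [Real.sqrt_le_left (by positivity)]
  nlinarith [Real.sq_sqrt ha, Real.sq_sqrt hb, Real.sqrt_nonneg a, Real.sqrt_nonneg b]

theorem le_rpow_inv_of_rpow_le {v Z ν : ℝ} (hv : 0 ≤ v) (hν : 0 < ν) (h : v ^ ν ≤ Z) :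
    v ≤ Z ^ (1 / ν) := by
  calc v = (v ^ ν) ^ (1 / ν) := by
        rw [← Real.rpow_mul hv, mul_one_div_cancel hν.ne', Real.rpow_one]
    _ ≤ _ := Real.rpow_le_rpow (by positivity) h (by positivity)

theorem rpow_inv_le_of_le_rpow {v Z ν : ℝ} (hv : 0 ≤ v) (hν : 0 < ν) (hZ : 0 ≤ Z)
    (h : Z ≤ v ^ ν) : Z ^ (1 / ν) ≤ v := by
  calc Z ^ (1 / ν) ≤ (v ^ ν) ^ (1 / ν) := Real.rpow_le_rpow hZ h (by positivity)
    _ = v := by rw [← Real.rpow_mul hv, mul_one_div_cancel hν.ne', Real.rpow_one]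

/-- The bound used for the risk of a coefficient at a scale `v = 2 ^ j`, with noise level `1 / n`
and block length `l`. The exponent `1 + κ` of the last case, with `κ = 1 - 1 / (2 (1 + 2 α))`,
leaves a factor `n ^ (-1 / (2 (1 + 2 α)))` that absorbs `l`. -/
def riskProfile (α K₁ K₃ D C₁ l n v : ℝ) : ℝ :=
  if v ^ (1 + 2 * α) ≤ n / l then K₁ * (l / n)
  else if v ^ (1 + 2 * α) < C₁ * n then D ^ 2 * v ^ (-(1 + 2 * α)) + 1 / n
  else D ^ 2 * v ^ (-(1 + 2 * α)) + K₃ * (l * n ^ (-(1 + (1 - 1 / (2 * (1 + 2 * α))))))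

theorem riskProfile_pos {α K₁ K₃ D C₁ l n v : ℝ} (hK₁ : 0 < K₁) (hK₃ : 0 ≤ K₃) (hD : 0 < D)
    (hl : 0 < l) (hn : 0 < n) (hv : 0 < v) : 0 < riskProfile α K₁ K₃ D C₁ l n v := by
  unfold riskProfile
  split_ifs <;> positivity

theorem sqrt_mul_decay {α D v : ℝ} (hD : 0 ≤ D) (hv : 0 < v) :
    √(v * (D ^ 2 * v ^ (-(1 + 2 * α)))) = D * v ^ (-α) := by
  have : v * (D ^ 2 * v ^ (-(1 + 2 * α))) = (D * v ^ (-α)) ^ 2 := by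
    rw [mul_pow, ← Real.rpow_natCast (v ^ (-α)) 2, ← Real.rpow_mul hv.le, mul_left_comm]
    congr 1
    nth_rw 1 [← Real.rpow_one v]
    rw [← Real.rpow_add hv]
    congr 1
    push_cast; ring
  rw [this, Real.sqrt_sq (by positivity)]

/-- Summation of the risk bounds over the levels at a point: the sum is dominated by the scales
near `(n / l) ^ (1 / (1 + 2 α))`. -/
theorem exists_sum_sqrt_riskProfile_le {α K₁ K₃ D C₁ : ℝ} (hα : 0 < α) (hK₁ : 0 < K₁)
    (hK₃ : 0 ≤ K₃) (hD : 0 < D) (hC₁ : 0 < C₁) :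
    ∃ C : ℝ, 0 ≤ C ∧ ∀ (l n : ℝ) (S : Finset ℕ), 1 ≤ n → 1 ≤ l →
      l ≤ n ^ (1 / (2 * (1 + 2 * α))) → (∀ j ∈ S, (2 : ℝ) ^ j ≤ n) →
      ∑ j ∈ S, √(2 ^ j * riskProfile α K₁ K₃ D C₁ l n (2 ^ j))
        ≤ C * (l / n) ^ (α / (1 + 2 * α)) := by
  set ν : ℝ := 1 + 2 * α with hν
  have hν0 : 0 < ν := by positivity
  set G : ℝ := (2 : ℝ) ^ (1 / 2 : ℝ) / ((2 : ℝ) ^ (1 / 2 : ℝ) - 1) with hG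
  set H : ℝ := 1 / (1 - (2 : ℝ) ^ (-α)) with hH
  have hG0 : 0 ≤ G := by
    have : 1 < (2 : ℝ) ^ (1 / 2 : ℝ) := Real.one_lt_rpow one_lt_two (by norm_num)
    exact div_nonneg (by positivity) (by linarith)
  have hH0 : 0 ≤ H := by
    have : (2 : ℝ) ^ (-α) < 1 := Real.rpow_lt_one_of_one_lt_of_neg one_lt_two (by linarith)
    exact div_nonneg zero_le_one (by linarith)
  refine ⟨√K₁ * G + D * H + G * C₁ ^ (1 / (2 * ν)) + √K₃ * G, by positivity, ?_⟩
  intro l n S hn hl hln hS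
  have hn0 : 0 < n := by linarith
  have hl0 : 0 < l := by linarith
  set q : ℝ := l / n with hq
  have hq0 : 0 < q := by positivity
  have hnq : n / l = q⁻¹ := by rw [hq, inv_div]
  set X : ℝ := (n / l) ^ (1 / ν) with hX
  have hX0 : 0 < X := by positivity
  set Y : ℝ := (C₁ * n) ^ (1 / ν) with hY
  have hY0 : 0 < Y := by positivity
  set κ : ℝ := 1 - 1 / (2 * ν) with hκ
  -- the sums behind the four summands are dominated by the scales `X`, `X`, `Y` and `n`
  have hterm : ∀ j ∈ S, √(2 ^ j * riskProfile α K₁ K₃ D C₁ l n (2 ^ j))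
      ≤ (if (2 : ℝ) ^ j ≤ X then √K₁ * √q * ((2 : ℝ) ^ j) ^ (1 / 2 : ℝ) else 0)
        + (if X ≤ (2 : ℝ) ^ j then D * ((2 : ℝ) ^ j) ^ (-α) else 0)
        + (if (2 : ℝ) ^ j ≤ Y then √(1 / n) * ((2 : ℝ) ^ j) ^ (1 / 2 : ℝ) else 0)
        + √K₃ * √(l * n ^ (-(1 + κ))) * ((2 : ℝ) ^ j) ^ (1 / 2 : ℝ) := by
    intro j _
    have hv : (0 : ℝ) < 2 ^ j := by positivity
    generalize (2 : ℝ) ^ j = v at hv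
    have hsq : √v = v ^ (1 / 2 : ℝ) := Real.sqrt_eq_rpow v
    have p1 : 0 ≤ (if v ≤ X then √K₁ * √q * v ^ (1 / 2 : ℝ) else 0) := by
      split_ifs <;> positivity
    have p2 : 0 ≤ (if X ≤ v then D * v ^ (-α) else 0) := by split_ifs <;> positivity
    have p3 : 0 ≤ (if v ≤ Y then √(1 / n) * v ^ (1 / 2 : ℝ) else 0) := by
      split_ifs <;> positivity
    have p4 : 0 ≤ √K₃ * √(l * n ^ (-(1 + κ))) * v ^ (1 / 2 : ℝ) := by positivity
    by_cases h1 : v ^ (1 + 2 * α) ≤ n / l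
    · rw [riskProfile, if_pos h1]
      have hvX : v ≤ X := le_rpow_inv_of_rpow_le hv.le hν0 h1
      rw [if_pos hvX] at p1 ⊢
      have e : √(v * (K₁ * (l / n))) = √K₁ * √q * v ^ (1 / 2 : ℝ) := by
        rw [Real.sqrt_mul hv.le, Real.sqrt_mul hK₁.le, hsq, ← hq]; ring
      rw [e]; linarith
    have hXv : X ≤ v := rpow_inv_le_of_le_rpow hv.le hν0 (by positivity) (not_le.1 h1).le
    by_cases h2 : v ^ (1 + 2 * α) < C₁ * n
    · rw [riskProfile, if_neg h1, if_pos h2, ← hν]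
      have hvY : v ≤ Y := le_rpow_inv_of_rpow_le hv.le hν0 h2.le
      rw [if_pos hXv] at p2 ⊢
      rw [if_pos hvY] at p3 ⊢
      have e : √(v * (D ^ 2 * v ^ (-ν) + 1 / n))
          ≤ D * v ^ (-α) + √(1 / n) * v ^ (1 / 2 : ℝ) := by
        rw [mul_add]
        refine (sqrt_add_le_add_sqrt (by positivity) (by positivity)).trans ?_
        rw [hν, sqrt_mul_decay hD.le hv, Real.sqrt_mul hv.le, hsq, mul_comm (v ^ (1 / 2 : ℝ))]
      linarith
    · rw [riskProfile, if_neg h1, if_neg h2, ← hν, ← hκ]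
      rw [if_pos hXv] at p2 ⊢
      have e : √(v * (D ^ 2 * v ^ (-ν) + K₃ * (l * n ^ (-(1 + κ)))))
          ≤ D * v ^ (-α) + √K₃ * √(l * n ^ (-(1 + κ))) * v ^ (1 / 2 : ℝ) := by
        rw [mul_add]
        refine (sqrt_add_le_add_sqrt (by positivity) (by positivity)).trans ?_
        rw [hν, sqrt_mul_decay hD.le hv, Real.sqrt_mul hv.le, Real.sqrt_mul hK₃, hsq,
          mul_comm (v ^ (1 / 2 : ℝ))]
      linarith
  refine (Finset.sum_le_sum hterm).trans ?_
  simp only [Finset.sum_add_distrib, ← Finset.sum_filter, ← Finset.mul_sum]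
  have half : (0 : ℝ) < 1 / 2 := by norm_num
  have s1 := sum_two_pow_rpow_le half hX0.le (S := S.filter fun j => (2 : ℝ) ^ j ≤ X)
    fun j hj => (Finset.mem_filter.1 hj).2
  have s2 := sum_two_pow_rpow_neg_le hα hX0 (S := S.filter fun j => X ≤ (2 : ℝ) ^ j)
    fun j hj => (Finset.mem_filter.1 hj).2
  have s3 := sum_two_pow_rpow_le half hY0.le (S := S.filter fun j => (2 : ℝ) ^ j ≤ Y)
    fun j hj => (Finset.mem_filter.1 hj).2
  have s4 := sum_two_pow_rpow_le half hn0.le hS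
  rw [← hG] at s1 s3 s4
  rw [← hH] at s2
  have hninv : n⁻¹ ≤ q := by
    rw [hq, ← one_div]; gcongr
  have hρ : 0 ≤ α / ν := by positivity
  have hnρ : n ^ (-(α / ν)) ≤ q ^ (α / ν) := by
    rw [Real.rpow_neg hn0.le, ← Real.inv_rpow hn0.le]
    exact Real.rpow_le_rpow (by positivity) hninv hρ
  have hXq : X = q ^ (-(1 / ν)) := by
    rw [hX, hnq, Real.inv_rpow hq0.le, Real.rpow_neg hq0.le]
  have t1 : √q * X ^ (1 / 2 : ℝ) = q ^ (α / ν) := by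
    rw [hXq, Real.sqrt_eq_rpow, ← Real.rpow_mul hq0.le, ← Real.rpow_add hq0]
    congr 1
    rw [hν]; field_simp; ring
  have t2 : X ^ (-α) = q ^ (α / ν) := by
    rw [hXq, ← Real.rpow_mul hq0.le]
    congr 1
    field_simp
  have t3 : √(1 / n) * Y ^ (1 / 2 : ℝ) = C₁ ^ (1 / (2 * ν)) * n ^ (-(α / ν)) := by
    rw [hY, Real.mul_rpow hC₁.le hn0.le, Real.mul_rpow (by positivity) (by positivity),
      ← Real.rpow_mul hC₁.le, ← Real.rpow_mul hn0.le, one_div n, Real.sqrt_eq_rpow,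
      Real.inv_rpow hn0.le, ← Real.rpow_neg hn0.le, mul_left_comm, ← Real.rpow_add hn0]
    congr 2
    · field_simp
    · rw [hν]; field_simp; ring
  have t4 : √(l * n ^ (-(1 + κ))) * n ^ (1 / 2 : ℝ) ≤ n ^ (-(α / ν)) := by
    rw [← Real.sqrt_eq_rpow, ← Real.sqrt_mul (by positivity)]
    refine Real.sqrt_le_iff.2 ⟨by positivity, ?_⟩
    calc l * n ^ (-(1 + κ)) * n ≤ n ^ (1 / (2 * ν)) * n ^ (-(1 + κ)) * n ^ (1 : ℝ) := by
          rw [Real.rpow_one]; gcongr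
      _ = (n ^ (-(α / ν))) ^ 2 := by
          rw [← Real.rpow_add hn0, ← Real.rpow_add hn0, ← Real.rpow_natCast (n ^ (-(α / ν))) 2,
            ← Real.rpow_mul hn0.le]
          congr 1
          rw [hκ, hν]; push_cast; field_simp; ring
  calc _ ≤ √K₁ * √q * (G * X ^ (1 / 2 : ℝ)) + D * (H * X ^ (-α))
        + √(1 / n) * (G * Y ^ (1 / 2 : ℝ))
        + √K₃ * √(l * n ^ (-(1 + κ))) * (G * n ^ (1 / 2 : ℝ)) := by gcongr
    _ = √K₁ * G * (√q * X ^ (1 / 2 : ℝ)) + D * H * X ^ (-α)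
        + G * (√(1 / n) * Y ^ (1 / 2 : ℝ))
        + √K₃ * G * (√(l * n ^ (-(1 + κ))) * n ^ (1 / 2 : ℝ)) := by ring
    _ ≤ √K₁ * G * q ^ (α / ν) + D * H * q ^ (α / ν)
        + G * (C₁ ^ (1 / (2 * ν)) * q ^ (α / ν)) + √K₃ * G * q ^ (α / ν) := by
        rw [t1, t2, t3]
        have := t4.trans hnρ
        gcongr
    _ = _ := by ring

end Numerics

end

/-! ### The pointwise risk -/

noncomputable section

open ProbabilityTheory

variable {Ω : Type*} [MeasurableSpace Ω] {P : Measure Ω} {B : ℝ≥0 → Ω → ℝ}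
  {W : IntervalWavelets} {r : ℕ} {f : ℝ → ℝ} {A : ℝ} {lam : ℝ} {L n : ℕ} {α M : ℝ}

/-- The conditions under which the finite sample bounds hold: `n` is large and the block length
`L` is comparable to `log n`. -/
structure IsLargeSample (W : IntervalWavelets) (α : ℝ) (L n : ℕ) : Prop where
  two_pow_le : 2 ^ W.j₀ ≤ n
  two_le : 2 ≤ L
  log_sub_one_le : Real.log n - 1 ≤ L
  le_two_mul_log : (L : ℝ) ≤ 2 * Real.log n
  le_rpow : (L : ℝ) ≤ (n : ℝ) ^ (1 / (2 * (1 + 2 * α)))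

theorem IsLargeSample.one_le (h : IsLargeSample W α L n) : 1 ≤ n :=
  Nat.one_le_two_pow.trans h.two_pow_le

theorem eventually_isLargeSample (W : IntervalWavelets) (hα : 0 < α) {L : ℕ → ℕ}
    (hL : ∀ n : ℕ, |(L n : ℝ) - Real.log n| ≤ 1) :
    ∀ᶠ n in atTop, IsLargeSample W α (L n) n := by
  have ha : 0 < 1 / (2 * (1 + 2 * α)) := by positivity
  have hcast := tendsto_natCast_atTop_atTop (R := ℝ)
  have h1 := hcast.eventually ((isLittleO_log_rpow_atTop ha).bound (c := 1 / 2) (by norm_num))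
  have h2 := (Real.tendsto_log_atTop.comp hcast).eventually_ge_atTop 3
  filter_upwards [h1, h2, eventually_ge_atTop (2 ^ W.j₀)] with n h1 h2 h3
  have h2 : 3 ≤ Real.log n := h2
  obtain ⟨h4, h5⟩ := abs_le.1 (hL n)
  rw [Real.norm_of_nonneg (by linarith), Real.norm_of_nonneg (by positivity)] at h1
  refine ⟨h3, ?_, by linarith, by linarith, by linarith⟩
  have : (2 : ℝ) ≤ L n := by linarith
  exact_mod_cast this

/-- The high levels are those with `2 ^ (j (1 + 2 α)) ≥ highLevelConst A α M lam * n`. There the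
signal energy of a block over `F(α, M)` is at most the fraction of the threshold that
`lintegral_sq_coefErr_le_high` needs for `κ = 1 - 1 / (2 (1 + 2 α))`. -/
def highLevelConst (A α M lam : ℝ) : ℝ :=
  decayConst A α M ^ 2
    / (((1 - (1 - 1 / (2 * (1 + 2 * α)))) / (lam - 1)) ^ 2 * lam)

theorem decayConst_pos (hA : 1 ≤ A) (hM : 0 < M) : 0 < decayConst A α M := by
  unfold decayConst; positivity

theorem highLevelConst_pos (hA : 1 ≤ A) (hα : 0 < α) (hM : 0 < M) (hlam : 1 < lam) :
    0 < highLevelConst A α M lam := by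
  have h1 := decayConst_pos (α := α) hA hM
  have h2 : 0 < lam - 1 := by linarith
  have h3 : 0 < 1 - (1 - 1 / (2 * (1 + 2 * α))) := by
    have : 0 < 1 / (2 * (1 + 2 * α)) := by positivity
    linarith
  unfold highLevelConst
  positivity

/-- Three bounds for the risk of a coefficient: of the order of the threshold at the coarse levels,
signal plus noise at the intermediate ones, signal plus a large deviation term at the high ones. -/
theorem lintegral_sq_coefErr_le_riskProfile (hB : IsBrownianReal B P) (hW : W.IsWaveletBasis)
    (hWr : W.IsRegular r) (hA : W.IsLocalized A)
    (hα : 0 < α) (hαr : α < r) (hM : 0 < M) (hf : f ∈ holderClass α M)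
    (hlam_one : 1 < lam) (hlam : lam - Real.log lam - 1 = 2) (hn : IsLargeSample W α L n)
    {j : ℕ} (hj : W.j₀ ≤ j) {k : ℕ} (hk : k ∈ Finset.Icc 1 (2 ^ j)) :
    ∫⁻ ω, ENNReal.ofReal (coefErr B W lam L n f j k ω ^ 2) ∂P
      ≤ ENNReal.ofReal (riskProfile α (2 * (lam + 1)) (3 * lam) (decayConst A α M)
        (highLevelConst A α M lam) L n (2 ^ j)) := by
  have hlam0 : 0 ≤ lam := by linarith
  unfold riskProfile
  split_ifs with h1 h2
  · exact lintegral_sq_coefErr_le_threshold hB hW hWr (one_le_of_pos_of_lt_natCast hα hαr)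
      (continuousOn_of_mem_holderClass hf) hlam0 (one_le_two.trans hn.two_le) hj hk
  · exact lintegral_sq_coefErr_le_decay hB hW hWr hA hα hαr hM hf hlam0 hj hk
  · have h3 : 1 / (2 * (1 + 2 * α)) ≤ 1 / 2 := by
      apply one_div_le_one_div_of_le <;> linarith
    have h4 : 0 < 1 / (2 * (1 + 2 * α)) := by positivity
    exact lintegral_sq_coefErr_le_high hB hW hWr hA hα hαr hM hf hlam_one hlam hn.one_le
      hn.two_le hn.log_sub_one_le (by linarith) (by linarith) hj (not_lt.1 h2) hk

theorem two_pow_le_of_mem_Ico_clog {a j : ℕ} (hj : j ∈ Finset.Ico a (Nat.clog 2 n)) :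
    (2 : ℝ) ^ j ≤ n := by
  exact_mod_cast (Nat.pow_lt_of_lt_clog (Finset.mem_Ico.1 hj).2).le

theorem rpow_neg_le_div_rpow {a b : ℝ} {l n : ℝ} (hn : 1 ≤ n) (hl : 1 ≤ l) (hb : 0 ≤ b)
    (hab : b ≤ a) : n ^ (-a) ≤ (l / n) ^ b := by
  have hn0 : 0 < n := by linarith
  calc n ^ (-a) ≤ n ^ (-b) := Real.rpow_le_rpow_of_exponent_le hn (by linarith)
    _ = (1 / n) ^ b := by rw [Real.rpow_neg hn0.le, one_div, Real.inv_rpow hn0.le]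
    _ ≤ _ := by gcongr

/-- The pointwise risk of BlockJS is of the adaptive order `(L / n) ^ (2 α / (1 + 2 α))`. -/
theorem exists_lintegral_sq_sub_le (hB : IsBrownianReal B P) (hW : W.IsWaveletBasis)
    (hWr : W.IsRegular r) (hα : 0 < α) (hαr : α < r) (hM : 0 < M)
    (hlam_one : 1 < lam) (hlam : lam - Real.log lam - 1 = 2) :
    ∃ C : ℝ, 0 ≤ C ∧ ∀ L n : ℕ, IsLargeSample W α L n → ∀ f ∈ holderClass α M,
      ∀ x ∈ Set.Icc (0 : ℝ) 1,
      ∫⁻ ω, ENNReal.ofReal ((coarseErr B W n f x ω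
        + ∑ j ∈ Finset.Ico W.j₀ (Nat.clog 2 n), levelErr B W lam L n f j x ω
        - (f x - W.partialSum f (Nat.clog 2 n) x)) ^ 2) ∂P
        ≤ ENNReal.ofReal (C * ((L : ℝ) / n) ^ (2 * α / (1 + 2 * α))) := by
  obtain ⟨A, hA⟩ := hW.exists_isLocalized hWr
  have hD := decayConst_pos (α := α) hA.one_le hM
  have hC₁ := highLevelConst_pos hA.one_le hα hM hlam_one
  have hK₁ : 0 < 2 * (lam + 1) := by linarith
  have hK₃ : 0 ≤ 3 * lam := by linarith
  obtain ⟨C, hC0, hC⟩ := exists_sum_sqrt_riskProfile_le hα hK₁ hK₃ hD hC₁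
  set T : ℝ := (2 * A + 1) * decayConst A α M * A / (1 - (2 : ℝ) ^ (-α)) with hT
  refine ⟨3 * ((2 ^ W.j₀ * A) ^ 2 + ((2 * A + 1) * A) ^ 2 * C ^ 2 + T ^ 2), by positivity, ?_⟩
  intro L n hn f hf x hx
  have hn1 : (1 : ℝ) ≤ n := by exact_mod_cast hn.one_le
  have hL1 : (1 : ℝ) ≤ L := by exact_mod_cast one_le_two.trans hn.two_le
  have hn0 : (0 : ℝ) < n := by linarith
  have hL0 : (0 : ℝ) < L := by linarith
  have h := lintegral_sq_partialErr_le hB hW hWr (one_le_of_pos_of_lt_natCast hα hαr) hA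
    (continuousOn_of_mem_holderClass hf) (S := Finset.Ico W.j₀ (Nat.clog 2 n))
    (fun j _ => riskProfile_pos (v := 2 ^ j) hK₁ hK₃ hD hL0 hn0 (by positivity))
    (fun j hj k hk => lintegral_sq_coefErr_le_riskProfile hB hW hWr hA hα hαr hM hf hlam_one hlam
      hn (Finset.mem_Ico.1 hj).1 hk) x (f x - W.partialSum f (Nat.clog 2 n) x)
  refine h.trans (ENNReal.ofReal_le_ofReal ?_)
  have hS := hC L n (Finset.Ico W.j₀ (Nat.clog 2 n)) hn1 hL1 hn.le_rpow
    fun j hj => two_pow_le_of_mem_Ico_clog hj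
  have hR := hW.sq_sub_partialSum_le hWr hA hα hαr hM hf hn.one_le hn.two_pow_le hx
  rw [← hT] at hR
  have hρ0 : 0 ≤ 2 * α / (1 + 2 * α) := by positivity
  have hρ1 : 2 * α / (1 + 2 * α) ≤ 1 := by rw [div_le_one (by positivity)]; linarith
  have hρ2 : 2 * α / (1 + 2 * α) ≤ 2 * α := div_le_self (by positivity) (by linarith)
  have h1 : 1 / (n : ℝ) ≤ ((L : ℝ) / n) ^ (2 * α / (1 + 2 * α)) := by
    rw [one_div, ← Real.rpow_neg_one]
    exact rpow_neg_le_div_rpow hn1 hL1 hρ0 hρ1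
  have h2 := rpow_neg_le_div_rpow hn1 hL1 hρ0 hρ2
  have h3 : (C * ((L : ℝ) / n) ^ (α / (1 + 2 * α))) ^ 2
      = C ^ 2 * ((L : ℝ) / n) ^ (2 * α / (1 + 2 * α)) := by
    rw [mul_pow, ← Real.rpow_natCast (((L : ℝ) / n) ^ (α / (1 + 2 * α))) 2,
      ← Real.rpow_mul (by positivity)]
    congr 2
    push_cast; ring
  have h4 : (∑ j ∈ Finset.Ico W.j₀ (Nat.clog 2 n), √(2 ^ j * riskProfile α (2 * (lam + 1))
      (3 * lam) (decayConst A α M) (highLevelConst A α M lam) L n (2 ^ j))) ^ 2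
      ≤ C ^ 2 * ((L : ℝ) / n) ^ (2 * α / (1 + 2 * α)) := by
    rw [← h3]
    exact pow_le_pow_left₀ (Finset.sum_nonneg fun _ _ => Real.sqrt_nonneg _) hS 2
  have h5 := hR.trans (mul_le_mul_of_nonneg_left h2 (sq_nonneg T))
  calc _ ≤ 3 * ((2 ^ W.j₀ * A) ^ 2 * ((L : ℝ) / n) ^ (2 * α / (1 + 2 * α))
        + ((2 * A + 1) * A) ^ 2 * (C ^ 2 * ((L : ℝ) / n) ^ (2 * α / (1 + 2 * α)))
        + T ^ 2 * ((L : ℝ) / n) ^ (2 * α / (1 + 2 * α))) := by gcongr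
    _ = _ := by ring

/-- The local risk of BlockJS never exceeds the order of its pointwise risk. -/
theorem exists_localRisk_le_pointwise (hB : IsBrownianReal B P) (hW : W.IsWaveletBasis)
    (hWr : W.IsRegular r) (hα : 0 < α) (hαr : α < r) (hM : 0 < M)
    (hlam_one : 1 < lam) (hlam : lam - Real.log lam - 1 = 2) {x₀ : ℝ}
    (hx₀ : x₀ ∈ Set.Icc (0 : ℝ) 1) :
    ∃ C : ℝ, 0 ≤ C ∧ ∀ L n : ℕ, IsLargeSample W α L n → ∀ f ∈ holderClass α M, ∀ c : ℝ, 0 ≤ c →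
      localRisk P (fun ω => blockJS W lam L n (observedPath n f fun t => B t ω)) f x₀ c
        ≤ ENNReal.ofReal (C * ((L : ℝ) / n) ^ (2 * α / (1 + 2 * α))) := by
  obtain ⟨A, hA⟩ := hW.exists_isLocalized hWr
  obtain ⟨C, hC0, hC⟩ := exists_lintegral_sq_sub_le hB hW hWr hα hαr hM hlam_one hlam
  refine ⟨2 * C, by positivity, fun L n hn f hf c hc => ?_⟩
  have hp : 0 ≤ C * ((L : ℝ) / n) ^ (2 * α / (1 + 2 * α)) := by positivity
  rcases hc.eq_or_lt with rfl | hc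
  · rw [localRisk, if_pos rfl]
    simp_rw [blockJS_sub_eq]
    exact (hC L n hn f hf x₀ hx₀).trans (ENNReal.ofReal_le_ofReal (by linarith))
  · have := localRisk_blockJS_le hB hW hWr (one_le_of_pos_of_lt_natCast hα hαr) hA
      (continuousOn_of_mem_holderClass hf) (S₁ := Finset.Ico W.j₀ (Nat.clog 2 n)) (S₂ := ∅)
      (lam := lam) (L := L) (x₀ := x₀)
      (Finset.disjoint_empty_right _) (Finset.union_empty _) hc hp le_rfl
      (hC L n hn f hf) (by simp)
    refine this.trans (ENNReal.ofReal_le_ofReal ?_)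
    rw [zero_div]; linarith

end

/-! ### Summation of the risk bounds over the levels in a window -/

noncomputable section

section Numerics

/-- The bound used for the total risk of the coefficients at a scale `v = 2 ^ j ≥ 1 / c` that are
relevant in a window of half-width `c`: below the high levels the coefficients are counted in
blocks, at the high levels one by one. -/
def windowProfile (α K₃ K₄ A D C₁ c l n v : ℝ) : ℝ :=
  if v ^ (1 + 2 * α) < C₁ * n then K₄ * ((v * c + A + l) / n)
  else (2 * (v * c + A) + 1)
    * (D ^ 2 * v ^ (-(1 + 2 * α)) + K₃ * (l * n ^ (-(1 + (1 - 1 / (2 * (1 + 2 * α)))))))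

theorem windowProfile_nonneg {α K₃ K₄ A D C₁ c l n v : ℝ} (hK₃ : 0 ≤ K₃) (hK₄ : 0 ≤ K₄)
    (hA : 0 ≤ A) (hc : 0 ≤ c) (hl : 0 ≤ l) (hn : 0 ≤ n) (hv : 0 ≤ v) :
    0 ≤ windowProfile α K₃ K₄ A D C₁ c l n v := by
  unfold windowProfile
  split_ifs <;> positivity

theorem mul_rpow_neg_inv {α n : ℝ} (hα : 0 < α) (hn : 0 < n) :
    n * n ^ (-(1 / (1 + 2 * α))) = n ^ (2 * α / (1 + 2 * α)) := by
  nth_rw 1 [← Real.rpow_one n]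
  rw [← Real.rpow_add hn]
  congr 1
  field_simp
  ring

/-- `(l / n) / c = n ^ (-2 α / (1 + 2 α)) (l / d)` for `c = d n ^ (-1 / (1 + 2 α))`. -/
theorem div_mul_rpow_neg_inv {α d l n : ℝ} (hα : 0 < α) (hn : 0 < n) :
    l / n / (d * n ^ (-(1 / (1 + 2 * α)))) = n ^ (-(2 * α / (1 + 2 * α))) * (l / d) := by
  rw [div_div, mul_left_comm, mul_rpow_neg_inv hα hn, Real.rpow_neg hn.le, mul_comm d,
    ← div_div, div_eq_mul_inv l, div_eq_mul_inv (l * _), div_eq_mul_inv l]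
  ring

/-- Summation of the risk bounds over the levels that are finer than the window. The window
half-width is `d n ^ (-1 / (1 + 2 α))`, and the term `l (1 + log d) / d` counts the levels
between the scale of the window and the high levels. -/
theorem exists_sum_windowProfile_le {α K₃ K₄ A D C₁ : ℝ} (hα : 0 < α) (hK₃ : 0 ≤ K₃)
    (hK₄ : 0 ≤ K₄) (hA : 0 ≤ A) (hC₁ : 0 < C₁) :
    ∃ C : ℝ, 0 ≤ C ∧ ∀ (l n d c : ℝ) (S : Finset ℕ), 1 ≤ n → 1 ≤ l → 1 ≤ d →
      c = d * n ^ (-(1 / (1 + 2 * α))) → l ≤ n ^ (1 / (2 * (1 + 2 * α))) →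
      (∀ j ∈ S, 1 ≤ (2 : ℝ) ^ j * c ∧ (2 : ℝ) ^ j ≤ n) →
      ∑ j ∈ S, windowProfile α K₃ K₄ A D C₁ c l n (2 ^ j)
        ≤ c * (C * n ^ (-(2 * α / (1 + 2 * α))) * (1 + l * (1 + Real.log d) / d)) := by
  set ν : ℝ := 1 + 2 * α with hν
  have hν0 : 0 < ν := by positivity
  set H : ℝ := 1 / (1 - (2 : ℝ) ^ (-(2 * α))) with hH
  have hH0 : 0 ≤ H := by
    have : (2 : ℝ) ^ (-(2 * α)) < 1 := Real.rpow_lt_one_of_one_lt_of_neg one_lt_two (by linarith)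
    exact div_nonneg zero_le_one (by linarith)
  have hlog2 : 0 < Real.log 2 := Real.log_pos one_lt_two
  set E : ℝ := C₁ ^ (1 / ν) with hE
  have hE0 : 0 < E := by positivity
  set N₀ : ℝ := |Real.log E| / Real.log 2 + 1 / Real.log 2 + 1 with hN₀
  refine ⟨K₄ * (2 * E) + K₄ * (A + 1) * N₀ + (3 + 2 * A) * D ^ 2 * (H * C₁ ^ (-(2 * α / ν)))
    + (3 + 2 * A) * K₃ * 2, by positivity, ?_⟩
  intro l n d c S hn hl hd hc hln hS
  have hn0 : 0 < n := by linarith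
  have hl0 : 0 < l := by linarith
  have hd0 : 0 < d := by linarith
  have hc0 : 0 < c := by rw [hc]; positivity
  set Y : ℝ := (C₁ * n) ^ (1 / ν) with hY
  have hY0 : 0 < Y := by positivity
  have hYE : Y = E * n ^ (1 / ν) := Real.mul_rpow hC₁.le hn0.le
  set κ : ℝ := 1 - 1 / (2 * ν) with hκ
  set ρ : ℝ := 2 * α / ν with hρ
  -- the number of summands in the second sum is the number of scales between `1 / c` and `Y`
  have hterm : ∀ j ∈ S, windowProfile α K₃ K₄ A D C₁ c l n (2 ^ j)
      ≤ c * ((if (2 : ℝ) ^ j ≤ Y then K₄ * (1 / n) * ((2 : ℝ) ^ j) ^ (1 : ℝ) else 0)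
        + (if (2 : ℝ) ^ j ≤ Y then K₄ * (A + 1) * (l / n / c) else 0)
        + (if Y ≤ (2 : ℝ) ^ j then (3 + 2 * A) * D ^ 2 * ((2 : ℝ) ^ j) ^ (-(2 * α)) else 0)
        + (3 + 2 * A) * K₃ * (l * n ^ (-(1 + κ))) * ((2 : ℝ) ^ j) ^ (1 : ℝ)) := by
    intro j hj
    have hv : (0 : ℝ) < 2 ^ j := by positivity
    have hvc := (hS j hj).1
    generalize (2 : ℝ) ^ j = v at hv hvc
    simp only [Real.rpow_one]
    have p3 : 0 ≤ (if Y ≤ v then (3 + 2 * A) * D ^ 2 * v ^ (-(2 * α)) else 0) := by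
      split_ifs <;> positivity
    have p4 : 0 ≤ (3 + 2 * A) * K₃ * (l * n ^ (-(1 + κ))) * v := by positivity
    by_cases h2 : v ^ (1 + 2 * α) < C₁ * n
    · have hvY : v ≤ Y := le_rpow_inv_of_rpow_le hv.le hν0 h2.le
      rw [windowProfile, if_pos h2, if_pos hvY, if_pos hvY]
      calc K₄ * ((v * c + A + l) / n) ≤ K₄ * ((v * c + (A + 1) * l) / n) := by
            have : A ≤ A * l := le_mul_of_one_le_right hA hl
            refine mul_le_mul_of_nonneg_left (div_le_div_of_nonneg_right ?_ hn0.le) hK₄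
            linarith
        _ = c * (K₄ * (1 / n) * v + K₄ * (A + 1) * (l / n / c)) := by field_simp
        _ ≤ _ := mul_le_mul_of_nonneg_left (by linarith) hc0.le
    · have hYv : Y ≤ v := rpow_inv_le_of_le_rpow hv.le hν0 (by positivity) (not_lt.1 h2)
      have p1 : 0 ≤ (if v ≤ Y then K₄ * (1 / n) * v else 0) := by split_ifs <;> positivity
      have p2 : 0 ≤ (if v ≤ Y then K₄ * (A + 1) * (l / n / c) else 0) := by
        split_ifs <;> positivity
      rw [windowProfile, if_neg h2, if_pos hYv, ← hν, ← hκ]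
      have hvν : v * v ^ (-ν) = v ^ (-(2 * α)) := by
        nth_rw 1 [← Real.rpow_one v]
        rw [← Real.rpow_add hv]
        congr 1
        rw [hν]; ring
      calc (2 * (v * c + A) + 1) * (D ^ 2 * v ^ (-ν) + K₃ * (l * n ^ (-(1 + κ))))
          ≤ ((3 + 2 * A) * (v * c)) * (D ^ 2 * v ^ (-ν) + K₃ * (l * n ^ (-(1 + κ)))) := by
            refine mul_le_mul_of_nonneg_right ?_ (by positivity)
            nlinarith
        _ = c * ((3 + 2 * A) * D ^ 2 * (v * v ^ (-ν))
            + (3 + 2 * A) * K₃ * (l * n ^ (-(1 + κ))) * v) := by ring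
        _ ≤ _ := by
            rw [hvν]
            exact mul_le_mul_of_nonneg_left (by linarith) hc0.le
  refine (Finset.sum_le_sum hterm).trans ?_
  rw [← Finset.mul_sum]
  refine mul_le_mul_of_nonneg_left ?_ hc0.le
  simp only [Finset.sum_add_distrib, ← Finset.sum_filter, Finset.sum_const, nsmul_eq_mul]
  simp only [← Finset.mul_sum]
  have two : (2 : ℝ) ^ (1 : ℝ) / ((2 : ℝ) ^ (1 : ℝ) - 1) = 2 := by norm_num
  have s1 := sum_two_pow_rpow_le one_pos hY0.le (S := S.filter fun j => (2 : ℝ) ^ j ≤ Y)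
    fun j hj => (Finset.mem_filter.1 hj).2
  have s3 := sum_two_pow_rpow_neg_le (mul_pos two_pos hα) hY0
    (S := S.filter fun j => Y ≤ (2 : ℝ) ^ j) fun j hj => (Finset.mem_filter.1 hj).2
  have s4 := sum_two_pow_rpow_le one_pos hn0.le fun j hj => (hS j hj).2
  rw [two] at s1 s4
  rw [← hH] at s3
  have hlogd : 0 ≤ Real.log d := Real.log_nonneg hd
  have s2 : ((S.filter fun j => (2 : ℝ) ^ j ≤ Y).card : ℝ) ≤ N₀ * (1 + Real.log d) := by
    rcases (S.filter fun j => (2 : ℝ) ^ j ≤ Y).eq_empty_or_nonempty with h | h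
    · rw [h, Finset.card_empty, Nat.cast_zero]; positivity
    · have := card_dyadic_le (l := 1 / c) (u := Y) (by positivity) h fun j hj =>
        ⟨by rw [div_le_iff₀ hc0]; exact (hS j (Finset.mem_filter.1 hj).1).1,
          (Finset.mem_filter.1 hj).2⟩
      have e : Y / (1 / c) = E * d := by
        rw [div_div_eq_mul_div, div_one, hYE, hc]
        rw [Real.rpow_neg hn0.le]
        field_simp
      rw [e, Real.log_mul hE0.ne' hd0.ne'] at this
      calc _ ≤ (Real.log E + Real.log d) / Real.log 2 + 1 := this
        _ ≤ (|Real.log E| + Real.log d) / Real.log 2 + 1 := by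
            gcongr; exact le_abs_self _
        _ = |Real.log E| / Real.log 2 * 1 + 1 / Real.log 2 * Real.log d + 1 := by ring
        _ ≤ |Real.log E| / Real.log 2 * (1 + Real.log d) + 1 / Real.log 2 * (1 + Real.log d)
            + 1 * (1 + Real.log d) := by
            gcongr <;> linarith
        _ = _ := by rw [hN₀]; ring
  have t1 : 1 / n * Y = E * n ^ (-ρ) := by
    rw [hYE, mul_left_comm]
    congr 1
    rw [one_div n, ← Real.rpow_neg_one, ← Real.rpow_add hn0]
    congr 1
    rw [hρ, hν]; field_simp; ring
  have t2 : l / n / c = n ^ (-ρ) * (l / d) := by rw [hc]; exact div_mul_rpow_neg_inv hα hn0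
  have t3 : Y ^ (-(2 * α)) = C₁ ^ (-ρ) * n ^ (-ρ) := by
    rw [hY, ← Real.rpow_mul (by positivity), Real.mul_rpow hC₁.le hn0.le]
    congr 2 <;> (rw [hρ]; ring)
  have t4 : l * n ^ (-(1 + κ)) * n ≤ n ^ (-ρ) := by
    calc l * n ^ (-(1 + κ)) * n ≤ n ^ (1 / (2 * ν)) * n ^ (-(1 + κ)) * n ^ (1 : ℝ) := by
          rw [Real.rpow_one]; gcongr
      _ = n ^ (-ρ) := by
          rw [← Real.rpow_add hn0, ← Real.rpow_add hn0]
          congr 1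
          rw [hκ, hρ, hν]; field_simp; ring
  have hQ : 0 ≤ l * (1 + Real.log d) / d := by positivity
  set Q : ℝ := l * (1 + Real.log d) / d with hQdef
  set m : ℝ := n ^ (-ρ) with hm
  have hm0 : 0 < m := by positivity
  rw [Real.rpow_one] at s1 s4
  calc _ ≤ K₄ * (1 / n) * (2 * Y)
        + N₀ * (1 + Real.log d) * (K₄ * (A + 1) * (l / n / c))
        + (3 + 2 * A) * D ^ 2 * (H * Y ^ (-(2 * α)))
        + (3 + 2 * A) * K₃ * (l * n ^ (-(1 + κ))) * (2 * n) := by gcongr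
    _ = K₄ * 2 * (1 / n * Y)
        + N₀ * (1 + Real.log d) * (K₄ * (A + 1) * (l / n / c))
        + (3 + 2 * A) * D ^ 2 * (H * Y ^ (-(2 * α)))
        + (3 + 2 * A) * K₃ * 2 * (l * n ^ (-(1 + κ)) * n) := by ring
    _ ≤ K₄ * 2 * (E * m)
        + N₀ * (1 + Real.log d) * (K₄ * (A + 1) * (m * (l / d)))
        + (3 + 2 * A) * D ^ 2 * (H * (C₁ ^ (-ρ) * m))
        + (3 + 2 * A) * K₃ * 2 * m := by rw [t1, t2, t3]; gcongr
    _ = (K₄ * (2 * E)) * m * 1 + (K₄ * (A + 1) * N₀) * m * Q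
        + ((3 + 2 * A) * D ^ 2 * (H * C₁ ^ (-ρ))) * m * 1 + ((3 + 2 * A) * K₃ * 2) * m * 1 := by
        rw [hQdef]; ring
    _ ≤ (K₄ * (2 * E)) * m * (1 + Q) + (K₄ * (A + 1) * N₀) * m * (1 + Q)
        + ((3 + 2 * A) * D ^ 2 * (H * C₁ ^ (-ρ))) * m * (1 + Q)
        + ((3 + 2 * A) * K₃ * 2) * m * (1 + Q) := by gcongr <;> linarith
    _ = _ := by ring

/-- The square of the sum of the noise levels over the levels coarser than the window. -/
theorem sq_sum_sqrt_threshold_le {α K d l n c : ℝ} (hα : 0 < α) (hK : 0 ≤ K) (hn : 0 < n)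
    (hl : 0 ≤ l) (hd : 0 < d) (hc : c = d * n ^ (-(1 / (1 + 2 * α)))) {S : Finset ℕ}
    (hS : ∀ j ∈ S, (2 : ℝ) ^ j * c ≤ 1) :
    (∑ j ∈ S, √(2 ^ j * (K * (l / n)))) ^ 2
      ≤ K * ((2 : ℝ) ^ (1 / 2 : ℝ) / ((2 : ℝ) ^ (1 / 2 : ℝ) - 1)) ^ 2
        * (n ^ (-(2 * α / (1 + 2 * α))) * (l / d)) := by
  have hc0 : 0 < c := by rw [hc]; positivity
  have half : (0 : ℝ) < 1 / 2 := by norm_num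
  have h := sum_two_pow_rpow_le half (by positivity : 0 ≤ 1 / c)
    fun j hj => by rw [le_div_iff₀ hc0]; exact hS j hj
  set G : ℝ := (2 : ℝ) ^ (1 / 2 : ℝ) / ((2 : ℝ) ^ (1 / 2 : ℝ) - 1) with hG
  have e : ∑ j ∈ S, √((2 : ℝ) ^ j * (K * (l / n)))
      = √(K * (l / n)) * ∑ j ∈ S, ((2 : ℝ) ^ j) ^ (1 / 2 : ℝ) := by
    rw [Finset.mul_sum]
    refine Finset.sum_congr rfl fun j _ => ?_
    rw [Real.sqrt_mul (by positivity), mul_comm, Real.sqrt_eq_rpow ((2 : ℝ) ^ j)]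
  have h0 : 0 ≤ ∑ j ∈ S, ((2 : ℝ) ^ j) ^ (1 / 2 : ℝ) := Finset.sum_nonneg fun _ _ => by positivity
  rw [e, mul_pow, Real.sq_sqrt (by positivity)]
  calc K * (l / n) * (∑ j ∈ S, ((2 : ℝ) ^ j) ^ (1 / 2 : ℝ)) ^ 2
      ≤ K * (l / n) * (G * (1 / c) ^ (1 / 2 : ℝ)) ^ 2 := by gcongr
    _ = K * G ^ 2 * (l / n / c) := by
        rw [← Real.sqrt_eq_rpow, mul_pow, Real.sq_sqrt (by positivity)]
        ring
    _ = _ := by rw [hc, div_mul_rpow_neg_inv hα hn]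

end Numerics

end

/-! ### The local risk -/

noncomputable section

open ProbabilityTheory

variable {Ω : Type*} [MeasurableSpace Ω] {P : Measure Ω} {B : ℝ≥0 → Ω → ℝ}
  {W : IntervalWavelets} {r : ℕ} {f : ℝ → ℝ} {A : ℝ} {lam : ℝ} {L n : ℕ} {α M : ℝ}

theorem lintegral_sum_hitIndex_le_windowProfile (hB : IsBrownianReal B P) (hW : W.IsWaveletBasis)
    (hWr : W.IsRegular r) (hA : W.IsLocalized A)
    (hα : 0 < α) (hαr : α < r) (hM : 0 < M) (hf : f ∈ holderClass α M)
    (hlam_one : 1 < lam) (hlam : lam - Real.log lam - 1 = 2) (hn : IsLargeSample W α L n)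
    {j : ℕ} (hj : W.j₀ ≤ j) (x₀ : ℝ) {c : ℝ} (hc : 0 ≤ c) :
    ∫⁻ ω, ENNReal.ofReal (∑ k ∈ hitIndex A j x₀ c, coefErr B W lam L n f j k ω ^ 2) ∂P
      ≤ ENNReal.ofReal (windowProfile α (3 * lam) (4 * (lam + 1)) A (decayConst A α M)
        (highLevelConst A α M lam) c L n (2 ^ j)) := by
  have hr := one_le_of_pos_of_lt_natCast hα hαr
  have hfc := continuousOn_of_mem_holderClass hf
  have hA0 : 0 ≤ A := zero_le_one.trans hA.one_le
  unfold windowProfile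
  split_ifs with h2
  · exact lintegral_sum_hitIndex_le_block hB hW hWr hr hA0 hfc (by linarith)
      (one_le_two.trans hn.two_le) hj x₀ hc
  · have h3 : 1 / (2 * (1 + 2 * α)) ≤ 1 / 2 := by
      apply one_div_le_one_div_of_le <;> linarith
    have h4 : 0 < 1 / (2 * (1 + 2 * α)) := by positivity
    exact lintegral_sum_hitIndex_le_single hB hWr hr hA0 hfc (by positivity)
      (fun k hk => lintegral_sq_coefErr_le_high hB hW hWr hA hα hαr hM hf hlam_one hlam hn.one_le
        hn.two_le hn.log_sub_one_le (by linarith) (by linarith) hj (not_lt.1 h2) hk) x₀ hc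

/-- The local risk of BlockJS over a window of half-width `d n ^ (-1 / (1 + 2 α))`, `d ≥ 1`. -/
theorem exists_localRisk_le (hB : IsBrownianReal B P) (hW : W.IsWaveletBasis)
    (hWr : W.IsRegular r) (hα : 0 < α) (hαr : α < r) (hM : 0 < M)
    (hlam_one : 1 < lam) (hlam : lam - Real.log lam - 1 = 2) (x₀ : ℝ) :
    ∃ C : ℝ, 0 ≤ C ∧ ∀ L n : ℕ, IsLargeSample W α L n → ∀ f ∈ holderClass α M, ∀ d c : ℝ, 1 ≤ d →
      c = d * (n : ℝ) ^ (-(1 / (1 + 2 * α))) →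
      localRisk P (fun ω => blockJS W lam L n (observedPath n f fun t => B t ω)) f x₀ c
        ≤ ENNReal.ofReal
          (C * (n : ℝ) ^ (-(2 * α / (1 + 2 * α))) * (1 + L * (1 + Real.log d) / d)) := by
  obtain ⟨A, hA⟩ := hW.exists_isLocalized hWr
  have hA0 : 0 ≤ A := zero_le_one.trans hA.one_le
  have hr := one_le_of_pos_of_lt_natCast hα hαr
  have hC₁ := highLevelConst_pos hA.one_le hα hM hlam_one
  have hK₁ : 0 < 2 * (lam + 1) := by linarith
  have hK₃ : 0 ≤ 3 * lam := by linarith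
  have hK₄ : 0 ≤ 4 * (lam + 1) := by linarith
  obtain ⟨C, hC0, hC⟩ := exists_sum_windowProfile_le (D := decayConst A α M) hα hK₃ hK₄ hA0 hC₁
  set T : ℝ := (2 * A + 1) * decayConst A α M * A / (1 - (2 : ℝ) ^ (-α)) with hT
  set G : ℝ := (2 : ℝ) ^ (1 / 2 : ℝ) / ((2 : ℝ) ^ (1 / 2 : ℝ) - 1) with hG
  set ρ : ℝ := 2 * α / (1 + 2 * α) with hρ
  refine ⟨6 * ((2 ^ W.j₀ * A) ^ 2 + ((2 * A + 1) * A) ^ 2 * (2 * (lam + 1) * G ^ 2) + T ^ 2) + C,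
    by positivity, ?_⟩
  intro L n hn f hf d c hd hc
  have hn1 : (1 : ℝ) ≤ n := by exact_mod_cast hn.one_le
  have hL1 : (1 : ℝ) ≤ L := by exact_mod_cast one_le_two.trans hn.two_le
  have hn0 : (0 : ℝ) < n := by linarith
  have hL0 : (0 : ℝ) < L := by linarith
  have hd0 : 0 < d := by linarith
  have hc0 : 0 < c := by rw [hc]; positivity
  have hfc := continuousOn_of_mem_holderClass hf
  have hlogd : 0 ≤ Real.log d := Real.log_nonneg hd
  have hρ0 : 0 ≤ ρ := by positivity
  have hρ1 : ρ ≤ 1 := by rw [hρ, div_le_one (by positivity)]; linarith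
  have hρ2 : ρ ≤ 2 * α := div_le_self (by positivity) (by linarith)
  set m : ℝ := (n : ℝ) ^ (-ρ) with hm
  have hm0 : 0 < m := by positivity
  set Q : ℝ := L * (1 + Real.log d) / d with hQ
  have hQ0 : 0 ≤ Q := by positivity
  set I := Finset.Ico W.j₀ (Nat.clog 2 n) with hI
  set S₁ := I.filter fun j => (2 : ℝ) ^ j * c ≤ 1 with hS₁
  set S₂ := I.filter fun j => ¬ (2 : ℝ) ^ j * c ≤ 1 with hS₂
  have hI1 : ∀ j ∈ S₁, W.j₀ ≤ j := fun j hj => (Finset.mem_Ico.1 (Finset.mem_filter.1 hj).1).1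
  have hI2 : ∀ j ∈ S₂, W.j₀ ≤ j := fun j hj => (Finset.mem_Ico.1 (Finset.mem_filter.1 hj).1).1
  have h1 : 1 / (n : ℝ) ≤ m := by
    rw [one_div, ← Real.rpow_neg_one]
    exact Real.rpow_le_rpow_of_exponent_le hn1 (by linarith)
  have h2 : (n : ℝ) ^ (-(2 * α)) ≤ m := Real.rpow_le_rpow_of_exponent_le hn1 (by linarith)
  have h3 : L / d ≤ Q := by
    rw [hQ]; gcongr
    exact le_mul_of_one_le_right hL0.le (by linarith)
  set a : ℝ := 3 * ((2 ^ W.j₀ * A) ^ 2 + ((2 * A + 1) * A) ^ 2 * (2 * (lam + 1) * G ^ 2) + T ^ 2)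
    * m * (1 + Q) with ha
  -- the levels coarser than the window contribute at every point
  have hpoint : ∀ x ∈ Set.Icc (0 : ℝ) 1, ∫⁻ ω, ENNReal.ofReal ((coarseErr B W n f x ω
      + ∑ j ∈ S₁, levelErr B W lam L n f j x ω
        - (f x - W.partialSum f (Nat.clog 2 n) x)) ^ 2) ∂P ≤ ENNReal.ofReal a := by
    intro x hx
    refine (lintegral_sq_partialErr_le hB hW hWr hr hA hfc
      (s := fun _ => 2 * (lam + 1) * ((L : ℝ) / n)) (fun _ _ => by positivity)
      (fun j hj k hk => lintegral_sq_coefErr_le_threshold hB hW hWr hr hfc (by linarith)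
        (one_le_two.trans hn.two_le) (hI1 j hj) hk) x _).trans (ENNReal.ofReal_le_ofReal ?_)
    have hs := sq_sum_sqrt_threshold_le hα hK₁.le hn0 hL0.le hd0 hc (S := S₁)
      fun j hj => (Finset.mem_filter.1 hj).2
    have hR := hW.sq_sub_partialSum_le hWr hA hα hαr hM hf hn.one_le hn.two_pow_le hx
    rw [← hT] at hR
    rw [← hG, ← hρ, ← hm] at hs
    calc _ ≤ 3 * ((2 ^ W.j₀ * A) ^ 2 * m + ((2 * A + 1) * A) ^ 2
            * (2 * (lam + 1) * G ^ 2 * (m * Q)) + T ^ 2 * m) := by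
          have := hR.trans (mul_le_mul_of_nonneg_left h2 (sq_nonneg T))
          have := hs.trans (mul_le_mul_of_nonneg_left
            (mul_le_mul_of_nonneg_left h3 hm0.le) (by positivity))
          gcongr
      _ = 3 * ((2 ^ W.j₀ * A) ^ 2 * m * 1 + ((2 * A + 1) * A) ^ 2
            * (2 * (lam + 1) * G ^ 2 * (m * Q)) + T ^ 2 * m * 1) := by ring
      _ ≤ 3 * ((2 ^ W.j₀ * A) ^ 2 * m * (1 + Q) + ((2 * A + 1) * A) ^ 2
            * (2 * (lam + 1) * G ^ 2 * (m * (1 + Q))) + T ^ 2 * m * (1 + Q)) := by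
          gcongr <;> linarith
      _ = a := by rw [ha]; ring
  -- the finer levels contribute through the indices whose wavelets meet the window
  have hwindow : ∫⁻ ω, ENNReal.ofReal (∑ j ∈ S₂, ∑ k ∈ hitIndex A j x₀ c,
      coefErr B W lam L n f j k ω ^ 2) ∂P ≤ ENNReal.ofReal (c * (C * m * (1 + Q))) := by
    have h := lintegral_ofReal_sum_le (P := P) (s := S₂) (a := fun _ => 1)
      (c := fun j => windowProfile α (3 * lam) (4 * (lam + 1)) A (decayConst A α M)
        (highLevelConst A α M lam) c L n (2 ^ j))
      (u := fun j ω => ∑ k ∈ hitIndex A j x₀ c, coefErr B W lam L n f j k ω ^ 2)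
      (fun _ _ => zero_le_one)
      (fun j _ => windowProfile_nonneg hK₃ hK₄ hA0 hc0.le hL0.le hn0.le (by positivity))
      (fun j _ => Finset.aemeasurable_fun_sum _ fun k hk =>
        (aemeasurable_coefErr hB hWr hr hfc lam L n
          (IntervalWavelets.nearIndex_subset _ _ _ hk)).pow_const 2)
      (fun j _ ω => Finset.sum_nonneg fun _ _ => sq_nonneg _)
      (fun j hj => lintegral_sum_hitIndex_le_windowProfile hB hW hWr hA hα hαr hM hf hlam_one hlam
        hn (hI2 j hj) x₀ hc0.le)
    simp only [one_mul] at h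
    refine h.trans (ENNReal.ofReal_le_ofReal (hC L n d c S₂ hn1 hL1 hd hc hn.le_rpow ?_))
    intro j hj
    obtain ⟨hj1, hj2⟩ := Finset.mem_filter.1 hj
    exact ⟨(not_le.1 hj2).le, two_pow_le_of_mem_Ico_clog hj1⟩
  refine (localRisk_blockJS_le hB hW hWr hr hA hfc (Finset.disjoint_filter_filter_not _ _ _)
    (Finset.filter_union_filter_not_eq _ _) hc0 (by positivity) (by positivity) hpoint
    hwindow).trans (ENNReal.ofReal_le_ofReal (le_of_eq ?_))
  rw [mul_div_cancel_left₀ _ hc0.ne', ha]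
  ring

end

/-! ### Maximal risk and asymptotics -/

noncomputable section

section Asymptotics

theorem limsup_mul_lt_top_of_le {w b : ℕ → ℝ} {R : ℕ → ℝ≥0∞} {C : ℝ}
    (hw : ∀ᶠ n in atTop, 0 ≤ w n) (hR : ∀ᶠ n in atTop, R n ≤ ENNReal.ofReal (b n))
    (h : ∀ᶠ n in atTop, w n * b n ≤ C) :
    limsup (fun n => ENNReal.ofReal (w n) * R n) atTop < ⊤ := by
  refine lt_of_le_of_lt (limsup_le_of_le (a := ENNReal.ofReal C) (by isBoundedDefault) ?_)
    ENNReal.ofReal_lt_top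
  filter_upwards [hw, hR, h] with n h1 h2 h3
  calc _ ≤ ENNReal.ofReal (w n) * ENNReal.ofReal (b n) := by gcongr
    _ = ENNReal.ofReal (w n * b n) := (ENNReal.ofReal_mul h1).symm
    _ ≤ _ := ENNReal.ofReal_le_ofReal h3

theorem blockJSMaxRisk_le {Ω : Type*} [MeasurableSpace Ω] {P : Measure Ω} {B : ℝ≥0 → Ω → ℝ}
    {W : IntervalWavelets} {lam : ℝ} {L n : ℕ} {α M x₀ c : ℝ} {b : ℝ≥0∞}
    (h : ∀ f ∈ holderClass α M, localRisk P
      (fun ω => blockJS W lam L n (observedPath n f fun t => B t ω)) f x₀ c ≤ b) :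
    blockJSMaxRisk P B W lam L n α M x₀ c ≤ b := iSup₂_le h

theorem div_log_rpow_mul_le {C l n x ρ : ℝ} (hC : 0 ≤ C) (hn : 0 < n) (hx : 0 < x) (hl : 0 ≤ l)
    (hlx : l ≤ 2 * x) (hρ : 0 ≤ ρ) : (n / x) ^ ρ * (C * (l / n) ^ ρ) ≤ C * 2 ^ ρ := by
  rw [mul_left_comm, ← Real.mul_rpow (by positivity) (by positivity)]
  have h : n / x * (l / n) ≤ 2 := by
    rw [div_mul_div_comm, mul_comm x n, mul_div_mul_left _ _ hn.ne', div_le_iff₀ hx]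
    exact hlx
  gcongr

/-- The rate on windows with `x ^ (1 / (1 + 2 α)) ≪ d ≪ x log x`, where `x = log n`. -/
theorem mul_windowRate_le_of_le {C l d x m : ℝ} (hC : 0 ≤ C) (hm : 0 < m) (hd : 1 ≤ d)
    (hx : 0 < x) (hlx : l ≤ 2 * x) (hll : 1 ≤ Real.log x) (h : d ≤ x * Real.log x) :
    m * (d / (x * Real.log x)) * (C * m⁻¹ * (1 + l * (1 + Real.log d) / d)) ≤ C * 7 := by
  have hd0 : 0 < d := by linarith
  have hlogd : Real.log d ≤ 2 * Real.log x := by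
    calc Real.log d ≤ Real.log (x * x) := by
          refine Real.log_le_log hd0 (h.trans ?_)
          have := Real.log_le_self hx.le
          gcongr
      _ = _ := by rw [Real.log_mul hx.ne' hx.ne']; ring
  have hlogd0 : 0 ≤ Real.log d := Real.log_nonneg hd
  have hp : 0 < x * Real.log x := by positivity
  have e : m * (d / (x * Real.log x)) * (C * m⁻¹ * (1 + l * (1 + Real.log d) / d))
      = C * ((d + l * (1 + Real.log d)) / (x * Real.log x)) := by field_simp
  rw [e]
  refine mul_le_mul_of_nonneg_left ?_ hC
  rw [div_le_iff₀ hp]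
  have : l * (1 + Real.log d) ≤ 2 * x * (3 * Real.log x) := by
    gcongr; linarith
  linarith

/-- On windows with `d ≥ ε x log x`, where `x = log n`, the logarithmic terms are negligible. -/
theorem mul_windowRate_le_of_ge {C l d x m ε : ℝ} (hC : 0 ≤ C) (hm : 0 < m) (hd : 1 ≤ d)
    (hx : 0 < x) (hlx : l ≤ 2 * x) (hll : 1 ≤ Real.log x) (hε : 0 < ε)
    (h : ε * (x * Real.log x) ≤ d) :
    m * (C * m⁻¹ * (1 + l * (1 + Real.log d) / d)) ≤ C * (1 + (6 / ε + 4)) := by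
  have hd0 : 0 < d := by linarith
  have hlogd0 : 0 ≤ Real.log d := Real.log_nonneg hd
  have e : m * (C * m⁻¹ * (1 + l * (1 + Real.log d) / d))
      = C * (1 + l * (1 + Real.log d) / d) := by field_simp
  rw [e]
  refine mul_le_mul_of_nonneg_left ?_ hC
  gcongr
  rw [div_le_iff₀ hd0]
  have h6 : 0 < 6 / ε := by positivity
  rcases le_or_gt (Real.log d) (2 * Real.log x) with h1 | h1
  · calc l * (1 + Real.log d) ≤ 2 * x * (3 * Real.log x) := by gcongr; linarith
      _ = 6 / ε * (ε * (x * Real.log x)) := by field_simp; ring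
      _ ≤ 6 / ε * d := by gcongr
      _ ≤ _ := by gcongr; linarith
  · have hxd : x ≤ √d := by
      refine Real.le_sqrt_of_sq_le ?_
      have : Real.log (x ^ 2) < Real.log d := by rw [Real.log_pow]; exact_mod_cast h1
      exact ((Real.log_lt_log_iff (by positivity) hd0).1 this).le
    have hlog : 1 + Real.log d ≤ 2 * √d := by
      have h2 := Real.log_le_sub_one_of_pos (Real.sqrt_pos.2 hd0)
      rw [Real.log_sqrt hd0.le] at h2
      linarith
    calc l * (1 + Real.log d) ≤ 2 * √d * (2 * √d) := by gcongr; linarith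
      _ = 4 * d := by rw [mul_mul_mul_comm, Real.mul_self_sqrt hd0.le]; ring
      _ ≤ _ := by gcongr; linarith

end Asymptotics

theorem theorem4 {Ω : Type*} [MeasurableSpace Ω] (P : Measure Ω) (B : ℝ≥0 → Ω → ℝ)
    (hB : ProbabilityTheory.IsBrownianReal B P)
    (W : IntervalWavelets) (hW : W.IsWaveletBasis) (r : ℕ) (hWr : W.IsRegular r)
    (lam : ℝ) (hlam_one : 1 < lam) (hlam : lam - Real.log lam - 1 = 2)
    (L : ℕ → ℕ) (hL : ∀ n : ℕ, |(L n : ℝ) - Real.log n| ≤ 1)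
    (α M : ℝ) (hα : 0 < α) (hαr : α < r) (hM : 0 < M)
    (x₀ : ℝ) (hx₀ : 0 < x₀) (hx₀' : x₀ < 1)
    (d c : ℕ → ℝ) (hd : ∀ n, 0 ≤ d n)
    (hc : ∀ n : ℕ, c n = d n * (n : ℝ) ^ (-(1 / (1 + 2 * α)))) :
    (limsup (fun n : ℕ =>
          ENNReal.ofReal (d n * Real.log n ^ (-(1 / (1 + 2 * α))))) atTop < ⊤ →
      limsup (fun n : ℕ =>
          ENNReal.ofReal (((n : ℝ) / Real.log n) ^ (2 * α / (1 + 2 * α)))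
            * blockJSMaxRisk P B W lam (L n) n α M x₀ (c n)) atTop < ⊤) ∧
    (liminf (fun n : ℕ =>
          ENNReal.ofReal (d n * Real.log n ^ (-(1 / (1 + 2 * α))))) atTop = ⊤ →
      limsup (fun n : ℕ =>
          ENNReal.ofReal (d n * (Real.log n * Real.log (Real.log n))⁻¹)) atTop = 0 →
      limsup (fun n : ℕ =>
          ENNReal.ofReal ((n : ℝ) ^ (2 * α / (1 + 2 * α))
              * (d n / (Real.log n * Real.log (Real.log n))))
            * blockJSMaxRisk P B W lam (L n) n α M x₀ (c n)) atTop < ⊤) ∧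
    (0 < liminf (fun n : ℕ =>
          ENNReal.ofReal (d n * (Real.log n * Real.log (Real.log n))⁻¹)) atTop →
      limsup (fun n : ℕ =>
          ENNReal.ofReal ((n : ℝ) ^ (2 * α / (1 + 2 * α)))
            * blockJSMaxRisk P B W lam (L n) n α M x₀ (c n)) atTop < ⊤) := by
  have hρ : 0 ≤ 2 * α / (1 + 2 * α) := by positivity
  have hcast := tendsto_natCast_atTop_atTop (R := ℝ)
  have hlog : Tendsto (fun n : ℕ => Real.log n) atTop atTop := Real.tendsto_log_atTop.comp hcast
  have hlog1 := hlog.eventually_ge_atTop 1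
  have hloglog := (Real.tendsto_log_atTop.comp hlog).eventually_ge_atTop 1
  have hn0 : ∀ᶠ n : ℕ in atTop, (0 : ℝ) < n := hcast.eventually_gt_atTop 0
  have hlarge := eventually_isLargeSample W hα hL
  obtain ⟨C, hC0, hC⟩ := exists_localRisk_le hB hW hWr hα hαr hM hlam_one hlam x₀
  have hrisk : (∀ᶠ n in atTop, 1 ≤ d n) → ∀ᶠ n in atTop,
      blockJSMaxRisk P B W lam (L n) n α M x₀ (c n) ≤ ENNReal.ofReal
        (C * ((n : ℝ) ^ (2 * α / (1 + 2 * α)))⁻¹ * (1 + L n * (1 + Real.log (d n)) / d n)) := by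
    intro h
    filter_upwards [h, hlarge] with n h1 h2
    rw [← Real.rpow_neg (Nat.cast_nonneg n)]
    exact blockJSMaxRisk_le fun f hf => hC (L n) n h2 f hf (d n) (c n) h1 (hc n)
  refine ⟨fun _ => ?_, fun hd_large hd_small => ?_, fun hd_large => ?_⟩
  · obtain ⟨C', hC'0, hC'⟩ := exists_localRisk_le_pointwise hB hW hWr hα hαr hM hlam_one hlam
      (x₀ := x₀) ⟨hx₀.le, hx₀'.le⟩
    refine limsup_mul_lt_top_of_le
      (b := fun n => C' * ((L n : ℝ) / n) ^ (2 * α / (1 + 2 * α)))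
      (C := C' * 2 ^ (2 * α / (1 + 2 * α))) ?_ ?_ ?_
    · filter_upwards [hlog1] with n h1
      positivity
    · filter_upwards [hlarge] with n h1
      refine blockJSMaxRisk_le fun f hf => hC' (L n) n h1 f hf (c n) ?_
      rw [hc]
      exact mul_nonneg (hd n) (by positivity)
    · filter_upwards [hlog1, hlarge, hn0] with n h1 h2 h3
      exact div_log_rpow_mul_le hC'0 h3 (by linarith) (Nat.cast_nonneg _) h2.le_two_mul_log hρ
  · have hd1 : ∀ᶠ n in atTop, 1 ≤ d n := by
      have h := eventually_lt_of_lt_liminf (ENNReal.one_lt_top.trans_eq hd_large.symm)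
      filter_upwards [h, hlog1] with n h1 h2
      rw [← ENNReal.ofReal_one, ENNReal.ofReal_lt_ofReal_iff_of_nonneg zero_le_one] at h1
      have h3 : Real.log n ^ (-(1 / (1 + 2 * α))) ≤ 1 :=
        Real.rpow_le_one_of_one_le_of_nonpos h2 (by
          have : 0 < 1 / (1 + 2 * α) := by positivity
          linarith)
      exact h1.le.trans (mul_le_of_le_one_right (hd n) h3)
    refine limsup_mul_lt_top_of_le (C := C * 7) ?_ (hrisk hd1) ?_
    · filter_upwards [hlog1, hloglog] with n h1 h2
      have h2 : 1 ≤ Real.log (Real.log n) := h2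
      have := hd n
      positivity
    · have h := eventually_lt_of_limsup_lt (hd_small.trans_lt zero_lt_one)
      filter_upwards [h, hd1, hlog1, hloglog, hlarge, hn0] with n h1 h2 h3 h4 h5 h6
      have h4 : 1 ≤ Real.log (Real.log n) := h4
      have h7 : 0 < Real.log n * Real.log (Real.log n) := by positivity
      rw [← ENNReal.ofReal_one, ENNReal.ofReal_lt_ofReal_iff zero_lt_one, ← div_eq_mul_inv,
        div_lt_one h7] at h1
      exact mul_windowRate_le_of_le hC0 (by positivity) h2 (by linarith) h5.le_two_mul_log h4 h1.le
  · obtain ⟨ε, hε0, hε⟩ := ENNReal.lt_iff_exists_nnreal_btwn.1 hd_large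
    have hε0 : (0 : ℝ) < ε := by exact_mod_cast hε0
    have hεd : ∀ᶠ n : ℕ in atTop, ε * (Real.log n * Real.log (Real.log n)) ≤ d n := by
      filter_upwards [eventually_lt_of_lt_liminf hε, hlog1, hloglog] with n h1 h3 h4
      have h4 : 1 ≤ Real.log (Real.log n) := h4
      have h7 : 0 < Real.log n * Real.log (Real.log n) := by positivity
      rw [← ENNReal.ofReal_coe_nnreal, ENNReal.ofReal_lt_ofReal_iff_of_nonneg hε0.le,
        ← div_eq_mul_inv, lt_div_iff₀ h7] at h1
      exact h1.le
    have hd1 : ∀ᶠ n in atTop, 1 ≤ d n := by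
      filter_upwards [hεd, hlog.eventually_ge_atTop (1 / ε), hloglog] with n h1 h2 h4
      have h4 : 1 ≤ Real.log (Real.log n) := h4
      rw [div_le_iff₀ hε0] at h2
      calc (1 : ℝ) ≤ ε * Real.log n * 1 := by linarith
        _ ≤ ε * Real.log n * Real.log (Real.log n) := by
            have : 0 ≤ ε * Real.log n := by linarith
            gcongr
        _ ≤ d n := by linarith
    refine limsup_mul_lt_top_of_le (C := C * (1 + (6 / ε + 4))) ?_ (hrisk hd1) ?_
    · exact Eventually.of_forall fun n => by positivity
    · filter_upwards [hεd, hd1, hlog1, hloglog, hlarge, hn0] with n h1 h2 h3 h4 h5 h6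
      exact mul_windowRate_le_of_ge hC0 (by positivity) h2 (by linarith) h5.le_two_mul_log h4 hε0 h1

end
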